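/- Let $G$ be a (discrete) group and $\Bbbk$ an algebraically closed field. **Terminology.** A $\Bbbk$-additive monoidal category is a monoidal category whose Hom-sets are $\Bbbk$-modules, whose composition and monoidal product are $\Bbbk$-bilinear, and in which every finite family of objects has a direct sum. A *pivotal* category is a monoidal category in which every object $X$ has an object $X^*$ that is at once a left dual of $X$ (through $\mathrm{ev}_X\colon X^*\otimes X\to\mathbb 1$, $\mathrm{coev}_X\colon\mathbb 1\to X\otimes X^*$) and a right dual of $X$ (through $\widetilde{\mathrm{ev}}_X\colon X\otimes X^*\to\mathbb 1$, $\widetilde{\mathrm{coev}}_X\colon\mathbb 1\to X^*\otimes X$), such that the left and right dual functors coincide as monoidal functors; set $\dim_l(X)=\mathrm{ev}_X\widetilde{\mathrm{coev}}_X$ and $\dim_r(X)=\widetilde{\mathrm{ev}}_X\mathrm{coev}_X$ in $\mathrm{End}(\mathbb 1)$. An object $i$ is *simple* if $\mathrm{End}(i)$ is a free $\Bbbk$-module of rank $1$. A $\Bbbk$-additive category is *split semisimple* if each object is a finite direct sum of simple objects and $\mathrm{Hom}(i,j)=0$ for any non-isomorphic simple objects $i,j$. A *$G$-graded category* is a $\Bbbk$-additive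 monoidal category $\mathcal C$ with full subcategories $\{\mathcal C_\alpha\}_{\alpha\in G}$, each closed under finite direct sums (that is, every finite family of objects of $\mathcal C_\alpha$ has a direct sum in $\mathcal C_\alpha$), such that each object of $\mathcal C$ is a finite direct sum $\bigoplus_\alpha X_\alpha$ with $X_\alpha\in\mathcal C_\alpha$; $X\otimes Y\in\mathcal C_{\alpha\beta}$ for $X\in\mathcal C_\alpha$, $Y\in\mathcal C_\beta$; $\mathrm{Hom}(X,Y)=0$ for $X\in\mathcal C_\alpha$, $Y\in\mathcal C_\beta$, $\alpha\ne\beta$; and $\mathbb 1\in\mathcal C_1$. (Hence distinct $\mathcal C_\alpha$ share at most zero objects.) If $\mathcal C$ is pivotal, duals are chosen so that $X^*\in\mathcal C_{\alpha^{-1}}$ for $X\in\mathcal C_\alpha$. A *$G$-fusion category* is a pivotal $G$-graded category that is split semisimple, whose unit object is simple, and such that for every $\alpha\in G$ the category $\mathcal C_\alpha$ has at least one simple object and only finitely many isomorphism classes of simple objects. The *$G$-center* $\mathcal Z_G(\mathcal C)$ has as objects the pairs $(A,\sigma)$ where $A\in\mathcal C$ and $\sigma=\{\sigma_X\colon A\otimes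 X\to X\otimes A\}_{X\in\mathcal C_1}$ is a family of isomorphisms natural in $X\in\mathcal C_1$ with $\sigma_{X\otimes Y}=(\mathrm{id}_X\otimes\sigma_Y)(\sigma_X\otimes\mathrm{id}_Y)$ up to the associativity constraints. Its morphisms $(A,\sigma)\to(A',\sigma')$ are the morphisms $f\colon A\to A'$ of $\mathcal C$ with $(\mathrm{id}_X\otimes f)\sigma_X=\sigma'_X(f\otimes\mathrm{id}_X)$ for all $X\in\mathcal C_1$. Its monoidal product is $(A,\sigma)\otimes(B,\rho)=(A\otimes B,(\sigma\otimes\mathrm{id}_B)(\mathrm{id}_A\otimes\rho))$, its $\Bbbk$-linear structure is that of $\mathcal C$, its pivotal structure is $(A,\sigma)^*=(A^*,\sigma^\dagger)$ with the (co)evaluations of $A$, where $\sigma^\dagger_X=(\mathrm{ev}_A\otimes\mathrm{id}_{X\otimes A^*})(\mathrm{id}_{A^*}\otimes\sigma_X^{-1}\otimes\mathrm{id}_{A^*})(\mathrm{id}_{A^*\otimes X}\otimes\mathrm{coev}_A)$, and $\mathcal Z_\alpha(\mathcal C)$ is the full subcategory of the pairs $(A,\sigma)$ with $A\in\mathcal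 C_\alpha$. **Lemma.** Let $\mathcal C$ be a $G$-fusion category over $\Bbbk$ such that $$\dim(\mathcal C_1)=\sum_{i}\dim_l(i)\dim_r(i)\neq 0,$$ where $i$ runs over a representative set of simple objects of $\mathcal C_1$. Then $\mathcal Z_G(\mathcal C)$, with the structure above, is a $G$-fusion category over $\Bbbk$. Moreover, if the subcategories $\mathcal C_\alpha$ are pairwise disjoint as classes of objects, then so are the subcategories $\mathcal Z_\alpha(\mathcal C)$. -/

import Mathlib

open CategoryTheory CategoryTheory.Limits CategoryTheory.MonoidalCategory

universe w w' v u

noncomputable section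

namespace TV

section Pivotal

/-- A choice of left and right duals on the same objects. -/
class DualityData (C : Type u) [Category.{v} C] [MonoidalCategory C] where
  /-- The dual object `X^*`. -/
  dual : C → C
  /-- `X^*` is a left dual of `X`, through `ev` and `coev`. -/
  left (X : C) : ExactPairing X (dual X)
  /-- `X^*` is a right dual of `X`, through the other evaluation and coevaluation. -/
  right (X : C) : ExactPairing (dual X) X

variable {C : Type u} [Category.{v} C] [MonoidalCategory C] [DualityData C]

/-- The dual object `X^*`. -/
abbrev dual (X : C) : C := DualityData.dual X

/-- `ev_X : X^* ⊗ X ⟶ 𝟙`. -/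
def ev (X : C) : dual X ⊗ X ⟶ 𝟙_ C := (DualityData.left X).evaluation'

/-- `coev_X : 𝟙 ⟶ X ⊗ X^*`. -/
def coev (X : C) : 𝟙_ C ⟶ X ⊗ dual X := (DualityData.left X).coevaluation'

/-- The right evaluation `X ⊗ X^* ⟶ 𝟙`. -/
def evR (X : C) : X ⊗ dual X ⟶ 𝟙_ C := (DualityData.right X).evaluation'

/-- The right coevaluation `𝟙 ⟶ X^* ⊗ X`. -/
def coevR (X : C) : 𝟙_ C ⟶ dual X ⊗ X := (DualityData.right X).coevaluation'

/-- The left dual `Y^* ⟶ X^*` of a morphism `f : X ⟶ Y`. -/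
def leftDualMap {X Y : C} (f : X ⟶ Y) : dual Y ⟶ dual X :=
  (ρ_ _).inv ≫ dual Y ◁ coev X ≫ dual Y ◁ f ▷ dual X ≫ (α_ _ _ _).inv ≫
    ev Y ▷ dual X ≫ (λ_ _).hom

/-- The right dual `Y^* ⟶ X^*` of a morphism `f : X ⟶ Y`. -/
def rightDualMap {X Y : C} (f : X ⟶ Y) : dual Y ⟶ dual X :=
  (λ_ _).inv ≫ coevR X ▷ dual Y ≫ (dual X ◁ f) ▷ dual Y ≫ (α_ _ _ _).hom ≫
    dual X ◁ evR Y ≫ (ρ_ _).hom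

/-- The left monoidal constraint `X^* ⊗ Y^* ⟶ (Y ⊗ X)^*`. -/
def leftConstraint (X Y : C) : dual X ⊗ dual Y ⟶ dual (Y ⊗ X) :=
  (ρ_ _).inv ≫ (dual X ⊗ dual Y) ◁ coev (Y ⊗ X) ≫
    (α_ _ _ _).hom ≫ dual X ◁ (dual Y ◁ (α_ _ _ _).hom ≫ (α_ _ _ _).inv ≫
      ev Y ▷ (X ⊗ dual (Y ⊗ X)) ≫ (λ_ _).hom) ≫
    (α_ _ _ _).inv ≫ ev X ▷ dual (Y ⊗ X) ≫ (λ_ _).hom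

/-- The right monoidal constraint `X^* ⊗ Y^* ⟶ (Y ⊗ X)^*`. -/
def rightConstraint (X Y : C) : dual X ⊗ dual Y ⟶ dual (Y ⊗ X) :=
  (λ_ _).inv ≫ coevR (Y ⊗ X) ▷ (dual X ⊗ dual Y) ≫
    (α_ _ _ _).inv ≫ ((α_ _ _ _).inv ▷ dual X ≫ (α_ _ _ _).hom ≫
      (dual (Y ⊗ X) ⊗ Y) ◁ evR X ≫ (ρ_ _).hom) ▷ dual Y ≫
    (α_ _ _ _).hom ≫ dual (Y ⊗ X) ◁ evR Y ≫ (ρ_ _).hom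

variable (C) in
/-- The left monoidal unit constraint `𝟙 ⟶ 𝟙^*`. -/
def leftUnitConstraint : 𝟙_ C ⟶ dual (𝟙_ C) := coev (𝟙_ C) ≫ (λ_ _).hom

variable (C) in
/-- The right monoidal unit constraint `𝟙 ⟶ 𝟙^*`. -/
def rightUnitConstraint : 𝟙_ C ⟶ dual (𝟙_ C) := coevR (𝟙_ C) ≫ (ρ_ _).hom

end Pivotal

/-- A pivotal category: the left and the right dual functors are equal as monoidal functors. -/
class PivotalCategory (C : Type u) [Category.{v} C] [MonoidalCategory C] extends
    DualityData C where
  map_eq {X Y : C} (f : X ⟶ Y) : leftDualMap f = rightDualMap f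
  constraint_eq (X Y : C) : leftConstraint X Y = rightConstraint X Y
  unitConstraint_eq : leftUnitConstraint C = rightUnitConstraint C

section Trace

variable {C : Type u} [Category.{v} C] [MonoidalCategory C] [PivotalCategory C]

/-- The left trace. -/
def trL {X : C} (g : X ⟶ X) : 𝟙_ C ⟶ 𝟙_ C := coevR X ≫ dual X ◁ g ≫ ev X

/-- The right trace. -/
def trR {X : C} (g : X ⟶ X) : 𝟙_ C ⟶ 𝟙_ C := coev X ≫ g ▷ dual X ≫ evR X

/-- The left dimension. -/
def dimL (X : C) : 𝟙_ C ⟶ 𝟙_ C := trL (𝟙 X)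

/-- The right dimension. -/
def dimR (X : C) : 𝟙_ C ⟶ 𝟙_ C := trR (𝟙 X)

end Trace

end TV

namespace TV
variable {C : Type u} [Category.{v} C] [MonoidalCategory C]

/-- A half braiding on `A` relative to the full monoidal subcategory of `C` with objects `P`. -/
structure RelHalfBraiding (P : ObjectProperty C) [P.IsMonoidal] (A : C) where
  β (U : C) (hU : P U) : A ⊗ U ≅ U ⊗ A
  naturality {U V : C} (hU : P U) (hV : P V) (f : U ⟶ V) :
    A ◁ f ≫ (β V hV).hom = (β U hU).hom ≫ f ▷ A
  monoidal (U V : C) (hU : P U) (hV : P V) :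
    (β (U ⊗ V) (P.prop_tensor hU hV)).hom =
      (α_ _ _ _).inv ≫ (β U hU).hom ▷ V ≫ (α_ _ _ _).hom ≫ U ◁ (β V hV).hom ≫ (α_ _ _ _).inv

/-- Objects of the relative center. -/
structure RelCenter (P : ObjectProperty C) [P.IsMonoidal] where
  pt : C
  half : RelHalfBraiding P pt

namespace RelCenter

variable {P : ObjectProperty C} [P.IsMonoidal]

/-- The half braiding as a morphism. -/
abbrev σ (A : RelCenter P) (U : C) (hU : P U) : A.pt ⊗ U ⟶ U ⊗ A.pt := (A.half.β U hU).hom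

/-- Morphisms of the relative center. -/
@[ext]
structure Hom (A B : RelCenter P) where
  f : A.pt ⟶ B.pt
  comm (U : C) (hU : P U) : f ▷ U ≫ B.σ U hU = A.σ U hU ≫ U ◁ f

instance : Category (RelCenter P) where
  Hom := Hom
  id A := { f := 𝟙 A.pt, comm := by intros; simp }
  comp f g := { f := f.f ≫ g.f
                comm := by
                  intro U hU
                  rw [comp_whiskerRight, Category.assoc, g.comm, ← Category.assoc, f.comm]
                  simp }

@[ext] lemma hom_ext {A B : RelCenter P} {f g : A ⟶ B} (h : Hom.f f = Hom.f g) : f = g :=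
  Hom.ext h

@[simp] lemma id_f (A : RelCenter P) : Hom.f (𝟙 A) = 𝟙 A.pt := rfl
@[simp] lemma comp_f {A B D : RelCenter P} (f : A ⟶ B) (g : B ⟶ D) :
    Hom.f (f ≫ g) = Hom.f f ≫ Hom.f g := rfl

lemma hom_comm {A B : RelCenter P} (f : A ⟶ B) (U : C) (hU : P U) :
    Hom.f f ▷ U ≫ B.σ U hU = A.σ U hU ≫ U ◁ Hom.f f := f.comm U hU

/-- A morphism of the relative center whose underlying morphism is invertible is invertible. -/
def isoMk {A B : RelCenter P} (e : A.pt ≅ B.pt)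
    (comm : ∀ (U : C) (hU : P U), e.hom ▷ U ≫ B.σ U hU = A.σ U hU ≫ U ◁ e.hom) : A ≅ B where
  hom := ⟨e.hom, comm⟩
  inv := ⟨e.inv, fun U hU => by
    rw [← cancel_epi (e.hom ▷ U), ← comp_whiskerRight_assoc, e.hom_inv_id, id_whiskerRight,
      Category.id_comp, ← Category.assoc, comm, Category.assoc, ← MonoidalCategory.whiskerLeft_comp,
      e.hom_inv_id, MonoidalCategory.whiskerLeft_id, Category.comp_id]⟩
  hom_inv_id := by ext; exact e.hom_inv_id
  inv_hom_id := by ext; exact e.inv_hom_id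

/-- The tensor product of relative half braidings. -/
def tensorHalf (A B : RelCenter P) : RelHalfBraiding P (A.pt ⊗ B.pt) where
  β U hU := α_ _ _ _ ≪≫ whiskerLeftIso A.pt (B.half.β U hU) ≪≫ (α_ _ _ _).symm ≪≫
    whiskerRightIso (A.half.β U hU) B.pt ≪≫ α_ _ _ _
  naturality {U V} hU hV f := by
    simp only [Iso.trans_hom, whiskerLeftIso_hom, Iso.symm_hom, whiskerRightIso_hom]
    calc
      _ = 𝟙 _ ⊗≫ (A.pt ◁ (B.pt ◁ f ≫ (B.half.β V hV).hom)) ⊗≫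
            (A.half.β V hV).hom ▷ B.pt ⊗≫ 𝟙 _ := by monoidal
      _ = 𝟙 _ ⊗≫ A.pt ◁ (B.half.β U hU).hom ⊗≫
            (A.pt ◁ f ≫ (A.half.β V hV).hom) ▷ B.pt ⊗≫ 𝟙 _ := by
          rw [B.half.naturality hU hV]; monoidal
      _ = _ := by rw [A.half.naturality hU hV]; monoidal
  monoidal U V hU hV := by
    simp only [Iso.trans_hom, whiskerLeftIso_hom, Iso.symm_hom, whiskerRightIso_hom]
    rw [A.half.monoidal U V hU hV, B.half.monoidal U V hU hV]
    calc
      _ = 𝟙 _ ⊗≫ A.pt ◁ (B.half.β U hU).hom ▷ V ⊗≫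
            (_ ◁ (B.half.β V hV).hom ≫ (A.half.β U hU).hom ▷ _) ⊗≫
              U ◁ (A.half.β V hV).hom ▷ B.pt ⊗≫ 𝟙 _ := by monoidal
      _ = _ := by rw [whisker_exchange]; monoidal

/-- The half braiding on the unit. -/
def unitHalf : RelHalfBraiding P (𝟙_ C) where
  β U _ := λ_ U ≪≫ (ρ_ U).symm
  naturality _ _ f := by simp
  monoidal U V hU hV := by simp

lemma tensor_comm_left (A : RelCenter P) {B B' : RelCenter P} (f : B ⟶ B') (U : C) (hU : P U) :
    (A.pt ◁ Hom.f f) ▷ U ≫ ((tensorHalf A B').β U hU).hom =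
      ((tensorHalf A B).β U hU).hom ≫ U ◁ (A.pt ◁ Hom.f f) := by
  simp only [tensorHalf, Iso.trans_hom, whiskerLeftIso_hom, Iso.symm_hom, whiskerRightIso_hom]
  calc
    _ = 𝟙 _ ⊗≫ A.pt ◁ (Hom.f f ▷ U ≫ B'.σ U hU) ⊗≫ A.σ U hU ▷ B'.pt ⊗≫ 𝟙 _ := by monoidal
    _ = 𝟙 _ ⊗≫ A.pt ◁ B.σ U hU ⊗≫ ((A.pt ⊗ U) ◁ Hom.f f ≫ A.σ U hU ▷ B'.pt) ⊗≫ 𝟙 _ := by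
        rw [hom_comm]; monoidal
    _ = _ := by rw [whisker_exchange]; monoidal

lemma tensor_comm_right {A A' : RelCenter P} (f : A ⟶ A') (B : RelCenter P) (U : C) (hU : P U) :
    (Hom.f f ▷ B.pt) ▷ U ≫ ((tensorHalf A' B).β U hU).hom =
      ((tensorHalf A B).β U hU).hom ≫ U ◁ (Hom.f f ▷ B.pt) := by
  simp only [tensorHalf, Iso.trans_hom, whiskerLeftIso_hom, Iso.symm_hom, whiskerRightIso_hom]
  calc
    _ = 𝟙 _ ⊗≫ (Hom.f f ▷ (B.pt ⊗ U) ≫ A'.pt ◁ B.σ U hU) ⊗≫ A'.σ U hU ▷ B.pt ⊗≫ 𝟙 _ := by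
        monoidal
    _ = 𝟙 _ ⊗≫ A.pt ◁ B.σ U hU ⊗≫ (Hom.f f ▷ U ≫ A'.σ U hU) ▷ B.pt ⊗≫ 𝟙 _ := by
        rw [← whisker_exchange]; monoidal
    _ = _ := by rw [hom_comm]; monoidal

/-- The monoidal structure of the relative center. -/
instance : MonoidalCategoryStruct (RelCenter P) where
  tensorObj A B := ⟨A.pt ⊗ B.pt, tensorHalf A B⟩
  tensorUnit := ⟨𝟙_ C, unitHalf⟩
  whiskerLeft A _ _ f := ⟨A.pt ◁ Hom.f f, tensor_comm_left A f⟩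
  whiskerRight f B := ⟨Hom.f f ▷ B.pt, tensor_comm_right f B⟩
  associator A B D := isoMk (α_ A.pt B.pt D.pt) (fun U hU => by
    simp [σ, tensorHalf])
  leftUnitor A := isoMk (λ_ A.pt) (fun U hU => by
    simp [σ, tensorHalf, unitHalf])
  rightUnitor A := isoMk (ρ_ A.pt) (fun U hU => by
    simp [σ, tensorHalf, unitHalf])

@[simp] lemma tensor_pt (A B : RelCenter P) : (A ⊗ B).pt = A.pt ⊗ B.pt := rfl
@[simp] lemma unit_pt : (𝟙_ (RelCenter P)).pt = 𝟙_ C := rfl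
@[simp] lemma whiskerLeft_f (A : RelCenter P) {B B' : RelCenter P} (f : B ⟶ B') :
    Hom.f (A ◁ f) = A.pt ◁ Hom.f f := rfl
@[simp] lemma whiskerRight_f {A A' : RelCenter P} (f : A ⟶ A') (B : RelCenter P) :
    Hom.f (f ▷ B) = Hom.f f ▷ B.pt := rfl
@[simp] lemma tensorHom_f {A A' B B' : RelCenter P} (f : A ⟶ A') (g : B ⟶ B') :
    Hom.f (f ⊗ₘ g) = Hom.f f ⊗ₘ Hom.f g := (MonoidalCategory.tensorHom_def _ _).symm
@[simp] lemma associator_hom_f (A B D : RelCenter P) :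
    Hom.f (α_ A B D).hom = (α_ A.pt B.pt D.pt).hom := rfl
@[simp] lemma associator_inv_f (A B D : RelCenter P) :
    Hom.f (α_ A B D).inv = (α_ A.pt B.pt D.pt).inv := rfl
@[simp] lemma leftUnitor_hom_f (A : RelCenter P) : Hom.f (λ_ A).hom = (λ_ A.pt).hom := rfl
@[simp] lemma leftUnitor_inv_f (A : RelCenter P) : Hom.f (λ_ A).inv = (λ_ A.pt).inv := rfl
@[simp] lemma rightUnitor_hom_f (A : RelCenter P) : Hom.f (ρ_ A).hom = (ρ_ A.pt).hom := rfl
@[simp] lemma rightUnitor_inv_f (A : RelCenter P) : Hom.f (ρ_ A).inv = (ρ_ A.pt).inv := rfl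

instance : MonoidalCategory (RelCenter P) where
  tensorHom_def _ _ := rfl
  id_tensorHom_id _ _ := by ext; simp
  tensorHom_comp_tensorHom _ _ _ _ := by ext; simp
  whiskerLeft_id _ _ := by ext; simp
  id_whiskerRight _ _ := by ext; simp
  associator_naturality _ _ _ := by ext; simp
  leftUnitor_naturality _ := by ext; simp
  rightUnitor_naturality _ := by ext; simp
  pentagon _ _ _ _ := by ext; simp
  triangle _ _ := by ext; simp

end RelCenter
end TV

namespace TV
section Nested
variable {C : Type u} [Category.{v} C] [MonoidalCategory C]

/-- The mate of `f : X ⟶ Y` through a coevaluation of `X` and an evaluation of `Y`. -/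
def mateL {X Y X' Y' : C} (c : 𝟙_ C ⟶ X ⊗ X') (e : Y' ⊗ Y ⟶ 𝟙_ C) (f : X ⟶ Y) : Y' ⟶ X' :=
  (ρ_ _).inv ≫ Y' ◁ c ≫ Y' ◁ f ▷ X' ≫ (α_ _ _ _).inv ≫ e ▷ X' ≫ (λ_ _).hom

/-- The mate of `f : X ⟶ Y` through a coevaluation of `X` and an evaluation of `Y`. -/
def mateR {X Y X' Y' : C} (c : 𝟙_ C ⟶ X' ⊗ X) (e : Y ⊗ Y' ⟶ 𝟙_ C) (f : X ⟶ Y) : Y' ⟶ X' :=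
  (λ_ _).inv ≫ c ▷ Y' ≫ (X' ◁ f) ▷ Y' ≫ (α_ _ _ _).hom ≫ X' ◁ e ≫ (ρ_ _).hom

lemma mateL_comp {X Y Z X' Y' Z' : C} (pX : ExactPairing X X') (pY : ExactPairing Y Y')
    (pZ : ExactPairing Z Z') (f : X ⟶ Y) (g : Y ⟶ Z) :
    mateL pY.coevaluation' pZ.evaluation' g ≫ mateL pX.coevaluation' pY.evaluation' f =
      mateL pX.coevaluation' pZ.evaluation' (f ≫ g) :=
  (@comp_rightAdjointMate C _ _ X Y Z ⟨X'⟩ ⟨Y'⟩ ⟨Z'⟩ f g).symm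

lemma mateL_id {X X' : C} (pX : ExactPairing X X') :
    mateL pX.coevaluation' pX.evaluation' (𝟙 X) = 𝟙 X' :=
  @rightAdjointMate_id C _ _ X ⟨X'⟩

lemma mateR_comp {X Y Z X' Y' Z' : C} (pX : ExactPairing X' X) (pY : ExactPairing Y' Y)
    (pZ : ExactPairing Z' Z) (f : X ⟶ Y) (g : Y ⟶ Z) :
    mateR pY.coevaluation' pZ.evaluation' g ≫ mateR pX.coevaluation' pY.evaluation' f =
      mateR pX.coevaluation' pZ.evaluation' (f ≫ g) :=
  (@comp_leftAdjointMate C _ _ X Y Z ⟨X'⟩ ⟨Y'⟩ ⟨Z'⟩ f g).symm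

variable [DualityData C]

/-- The evaluation of a tensor product obtained by nesting. -/
def evT (X Y : C) : (dual Y ⊗ dual X) ⊗ (X ⊗ Y) ⟶ 𝟙_ C :=
  𝟙 _ ⊗≫ dual Y ◁ (ev X ▷ Y) ⊗≫ ev Y

/-- The coevaluation of a tensor product obtained by nesting. -/
def coevT (X Y : C) : 𝟙_ C ⟶ (X ⊗ Y) ⊗ (dual Y ⊗ dual X) :=
  coev X ⊗≫ (X ◁ coev Y) ▷ dual X ⊗≫ 𝟙 _

/-- The right evaluation of a tensor product obtained by nesting. -/
def evRT (X Y : C) : (X ⊗ Y) ⊗ (dual Y ⊗ dual X) ⟶ 𝟙_ C :=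
  𝟙 _ ⊗≫ X ◁ (evR Y ▷ dual X) ⊗≫ evR X

/-- The right coevaluation of a tensor product obtained by nesting. -/
def coevRT (X Y : C) : 𝟙_ C ⟶ (dual Y ⊗ dual X) ⊗ (X ⊗ Y) :=
  coevR Y ⊗≫ (dual Y ◁ coevR X) ▷ Y ⊗≫ 𝟙 _

/-- The nested left duality. -/
abbrev leftT (X Y : C) : ExactPairing (X ⊗ Y) (dual Y ⊗ dual X) :=
  @ExactPairing.tensor C _ _ X Y (dual X) (dual Y) (DualityData.left X) (DualityData.left Y)

/-- The nested right duality. -/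
abbrev rightT (X Y : C) : ExactPairing (dual Y ⊗ dual X) (X ⊗ Y) :=
  @ExactPairing.tensor C _ _ (dual Y) (dual X) Y X (DualityData.right Y) (DualityData.right X)

/-- The left dual of `f`, with nested duality morphisms. -/
def leftNest {A B D E : C} (f : A ⊗ B ⟶ D ⊗ E) : dual E ⊗ dual D ⟶ dual B ⊗ dual A :=
  mateL (coevT A B) (evT D E) f

/-- The right dual of `f`, with nested duality morphisms. -/
def rightNest {A B D E : C} (f : A ⊗ B ⟶ D ⊗ E) : dual E ⊗ dual D ⟶ dual B ⊗ dual A :=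
  mateR (coevRT A B) (evRT D E) f

lemma leftConstraint_eq (X Y : C) :
    leftConstraint X Y = mateL (coev (Y ⊗ X)) (evT Y X) (𝟙 (Y ⊗ X)) := by
  unfold mateL leftConstraint evT
  monoidal

lemma rightConstraint_eq (X Y : C) :
    rightConstraint X Y = mateR (coevR (Y ⊗ X)) (evRT Y X) (𝟙 (Y ⊗ X)) := by
  unfold mateR rightConstraint evRT
  monoidal

lemma leftNest_comp {A B D E : C} (f : A ⊗ B ⟶ D ⊗ E) :
    leftNest f ≫ leftConstraint B A = leftConstraint E D ≫ leftDualMap f := by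
  have h1 := mateL_comp (DualityData.left (A ⊗ B)) (leftT A B) (leftT D E) (𝟙 _) f
  have h2 := mateL_comp (DualityData.left (A ⊗ B)) (DualityData.left (D ⊗ E)) (leftT D E) f (𝟙 _)
  rw [Category.id_comp] at h1
  rw [Category.comp_id] at h2
  rw [leftConstraint_eq, leftConstraint_eq]
  exact h1.trans h2.symm

lemma rightNest_comp {A B D E : C} (f : A ⊗ B ⟶ D ⊗ E) :
    rightNest f ≫ rightConstraint B A = rightConstraint E D ≫ rightDualMap f := by
  have h1 := mateR_comp (DualityData.right (A ⊗ B)) (rightT A B) (rightT D E) (𝟙 _) f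
  have h2 := mateR_comp (DualityData.right (A ⊗ B)) (DualityData.right (D ⊗ E)) (rightT D E) f (𝟙 _)
  rw [Category.id_comp] at h1
  rw [Category.comp_id] at h2
  rw [rightConstraint_eq, rightConstraint_eq]
  exact h1.trans h2.symm

lemma mono_leftConstraint (X Y : C) : Mono (leftConstraint X Y) := by
  have h1 := mateL_comp (leftT Y X) (DualityData.left (Y ⊗ X)) (leftT Y X) (𝟙 _) (𝟙 _)
  rw [Category.id_comp, mateL_id] at h1
  rw [leftConstraint_eq]
  exact SplitMono.mono ⟨mateL (coevT Y X) (ev (Y ⊗ X)) (𝟙 (Y ⊗ X)), h1⟩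

end Nested

section
variable {C : Type u} [Category.{v} C] [MonoidalCategory C] [PivotalCategory C]

lemma nest_eq {A B D E : C} (f : A ⊗ B ⟶ D ⊗ E) : leftNest f = rightNest f := by
  have := mono_leftConstraint B A
  rw [← cancel_mono (leftConstraint B A), leftNest_comp, PivotalCategory.map_eq,
    PivotalCategory.constraint_eq, PivotalCategory.constraint_eq, rightNest_comp]
end
section
variable {C : Type u} [Category.{v} C] [MonoidalCategory C] [DualityData C]

lemma leftNest_def {A B D E : C} (f : A ⊗ B ⟶ D ⊗ E) :
    leftNest f = 𝟙 _ ⊗≫ (dual E ⊗ dual D) ◁ coev A ⊗≫ (dual E ⊗ dual D ⊗ A) ◁ coev B ▷ dual A ⊗≫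
      (dual E ⊗ dual D) ◁ f ▷ (dual B ⊗ dual A) ⊗≫ dual E ◁ ev D ▷ (E ⊗ dual B ⊗ dual A) ⊗≫
      ev E ▷ (dual B ⊗ dual A) ⊗≫ 𝟙 _ := by
  unfold leftNest mateL evT coevT
  monoidal

lemma rightNest_def {A B D E : C} (f : A ⊗ B ⟶ D ⊗ E) :
    rightNest f = 𝟙 _ ⊗≫ coevR B ▷ (dual E ⊗ dual D) ⊗≫ dual B ◁ coevR A ▷ (B ⊗ dual E ⊗ dual D) ⊗≫
      (dual B ⊗ dual A) ◁ f ▷ (dual E ⊗ dual D) ⊗≫ (dual B ⊗ dual A ⊗ D) ◁ evR E ▷ dual D ⊗≫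
      (dual B ⊗ dual A) ◁ evR D ⊗≫ 𝟙 _ := by
  unfold rightNest mateR evRT coevRT
  monoidal

end
end TV

namespace TV
section Triangles
variable {C : Type u} [Category.{v} C] [MonoidalCategory C] [DualityData C]

lemma tri1 (X : C) : coev X ▷ X ⊗≫ X ◁ ev X = ⊗𝟙.hom :=
  @ExactPairing.evaluation_coevaluation'' C _ _ X (dual X) (DualityData.left X)

lemma tri2 (X : C) : dual X ◁ coev X ⊗≫ ev X ▷ dual X = ⊗𝟙.hom :=
  @ExactPairing.coevaluation_evaluation'' C _ _ X (dual X) (DualityData.left X)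

lemma tri3 (X : C) : coevR X ▷ dual X ⊗≫ dual X ◁ evR X = ⊗𝟙.hom :=
  @ExactPairing.evaluation_coevaluation'' C _ _ (dual X) X (DualityData.right X)

lemma tri4 (X : C) : X ◁ coevR X ⊗≫ evR X ▷ X = ⊗𝟙.hom :=
  @ExactPairing.coevaluation_evaluation'' C _ _ (dual X) X (DualityData.right X)

end Triangles

section Lax
variable {C : Type u} [Category.{v} C] [MonoidalCategory C]

/-- A half braiding whose components need not be invertible. -/
structure LaxHalf (P : ObjectProperty C) [P.IsMonoidal] (B : C) where
  s (U : C) (hU : P U) : B ⊗ U ⟶ U ⊗ B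
  nat {U V : C} (hU : P U) (hV : P V) (f : U ⟶ V) : B ◁ f ≫ s V hV = s U hU ≫ f ▷ B
  mul (U V : C) (hU : P U) (hV : P V) :
    s (U ⊗ V) (P.prop_tensor hU hV) =
      (α_ _ _ _).inv ≫ s U hU ▷ V ≫ (α_ _ _ _).hom ≫ U ◁ s V hV ≫ (α_ _ _ _).inv
  one : s (𝟙_ C) P.prop_unit = (ρ_ B).hom ≫ (λ_ B).inv

variable {P : ObjectProperty C} [P.IsMonoidal] {B : C}

/-- The candidate for the inverse of the component at `V`. -/
def LaxHalf.rot (b : LaxHalf P B) {V W : C} (hW : P W) (c : 𝟙_ C ⟶ W ⊗ V)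
    (e : V ⊗ W ⟶ 𝟙_ C) : V ⊗ B ⟶ B ⊗ V :=
  𝟙 _ ⊗≫ (V ⊗ B) ◁ c ⊗≫ V ◁ b.s W hW ▷ V ⊗≫ e ▷ (B ⊗ V) ⊗≫ 𝟙 _

lemma LaxHalf.comp_rot (b : LaxHalf P B) {V W : C} (hV : P V) (hW : P W) (c : 𝟙_ C ⟶ W ⊗ V)
    (e : V ⊗ W ⟶ 𝟙_ C) (h : V ◁ c ⊗≫ e ▷ V = ⊗𝟙.hom) : b.s V hV ≫ b.rot hW c e = 𝟙 _ := by
  unfold LaxHalf.rot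
  calc
    _ = 𝟙 _ ⊗≫ (b.s V hV ▷ 𝟙_ C ≫ (V ⊗ B) ◁ c) ⊗≫ V ◁ b.s W hW ▷ V ⊗≫ e ▷ (B ⊗ V) ⊗≫ 𝟙 _ := by
        monoidal
    _ = 𝟙 _ ⊗≫ (B ⊗ V) ◁ c ⊗≫ (((α_ _ _ _).inv ≫ b.s V hV ▷ W ≫ (α_ _ _ _).hom ≫ V ◁ b.s W hW ≫
          (α_ _ _ _).inv) ≫ e ▷ B) ▷ V ⊗≫ 𝟙 _ := by
        rw [← whisker_exchange]; monoidal
    _ = 𝟙 _ ⊗≫ B ◁ (V ◁ c ⊗≫ e ▷ V) ⊗≫ 𝟙 _ := by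
        rw [← b.mul V W hV hW, ← b.nat _ P.prop_unit, b.one]; monoidal
    _ = 𝟙 _ := by rw [h]; monoidal

lemma LaxHalf.rot_comp (b : LaxHalf P B) {V W : C} (hV : P V) (hW : P W) (c : 𝟙_ C ⟶ W ⊗ V)
    (e : V ⊗ W ⟶ 𝟙_ C) (h : V ◁ c ⊗≫ e ▷ V = ⊗𝟙.hom) : b.rot hW c e ≫ b.s V hV = 𝟙 _ := by
  unfold LaxHalf.rot
  calc
    _ = 𝟙 _ ⊗≫ (V ⊗ B) ◁ c ⊗≫ V ◁ b.s W hW ▷ V ⊗≫ (e ▷ (B ⊗ V) ≫ 𝟙_ C ◁ b.s V hV) ⊗≫ 𝟙 _ := by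
        monoidal
    _ = 𝟙 _ ⊗≫ V ◁ (B ◁ c ≫ ((α_ _ _ _).inv ≫ b.s W hW ▷ V ≫ (α_ _ _ _).hom ≫ W ◁ b.s V hV ≫
          (α_ _ _ _).inv)) ⊗≫ e ▷ (V ⊗ B) ⊗≫ 𝟙 _ := by
        rw [← whisker_exchange]; monoidal
    _ = 𝟙 _ ⊗≫ (V ◁ c ⊗≫ e ▷ V) ▷ B ⊗≫ 𝟙 _ := by
        rw [← b.mul W V hW hV, b.nat P.prop_unit, b.one]; monoidal
    _ = 𝟙 _ := by rw [h]; monoidal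

/-- The half braiding at the unit object. -/
lemma RelHalfBraiding.one (b : RelHalfBraiding P B) :
    (b.β (𝟙_ C) P.prop_unit).hom = (ρ_ B).hom ≫ (λ_ B).inv := by
  have h := b.naturality (P.prop_tensor P.prop_unit P.prop_unit) P.prop_unit (λ_ (𝟙_ C)).hom
  rw [b.monoidal _ _ P.prop_unit P.prop_unit] at h
  have h2 : (b.β (𝟙_ C) P.prop_unit).hom ≫ ((λ_ B).hom ≫ (ρ_ B).inv) ≫
      (b.β (𝟙_ C) P.prop_unit).hom = (b.β (𝟙_ C) P.prop_unit).hom ≫ 𝟙 _ := by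
    calc
      _ = 𝟙 _ ⊗≫ (((α_ _ _ _).inv ≫ (b.β (𝟙_ C) P.prop_unit).hom ▷ 𝟙_ C ≫ (α_ _ _ _).hom ≫
            𝟙_ C ◁ (b.β (𝟙_ C) P.prop_unit).hom ≫ (α_ _ _ _).inv) ≫ (λ_ (𝟙_ C)).hom ▷ B) ⊗≫
              𝟙 _ := by monoidal
      _ = _ := by rw [← h]; monoidal
  rw [cancel_epi] at h2
  rw [← cancel_epi ((λ_ B).hom ≫ (ρ_ B).inv), h2]
  simp

/-- A half braiding as a lax half braiding. -/
def RelHalfBraiding.toLax (b : RelHalfBraiding P B) : LaxHalf P B where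
  s U hU := (b.β U hU).hom
  nat := b.naturality
  mul := b.monoidal
  one := b.one

/-- Naturality of the inverse half braiding. -/
lemma RelHalfBraiding.inv_nat (b : RelHalfBraiding P B) {U V : C} (hU : P U) (hV : P V)
    (f : U ⟶ V) : f ▷ B ≫ (b.β V hV).inv = (b.β U hU).inv ≫ B ◁ f := by
  rw [Iso.comp_inv_eq, Category.assoc, b.naturality hU hV, Iso.inv_hom_id_assoc]

/-- Multiplicativity of the inverse half braiding. -/
lemma RelHalfBraiding.inv_mul (b : RelHalfBraiding P B) {U V : C} (hU : P U) (hV : P V) :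
    (b.β (U ⊗ V) (P.prop_tensor hU hV)).inv =
      (α_ _ _ _).hom ≫ U ◁ (b.β V hV).inv ≫ (α_ _ _ _).inv ≫ (b.β U hU).inv ▷ V ≫
        (α_ _ _ _).hom := by
  rw [← cancel_epi (b.β (U ⊗ V) (P.prop_tensor hU hV)).hom, Iso.hom_inv_id,
    b.monoidal _ _ hU hV]
  simp

/-- The inverse half braiding at the unit object. -/
lemma RelHalfBraiding.inv_one (b : RelHalfBraiding P B) :
    (b.β (𝟙_ C) P.prop_unit).inv = (λ_ B).hom ≫ (ρ_ B).inv := by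
  rw [← cancel_epi (b.β (𝟙_ C) P.prop_unit).hom, Iso.hom_inv_id, b.one]
  simp

end Lax

section DualHalf
variable {C : Type u} [Category.{v} C] [MonoidalCategory C] [DualityData C]
variable {P : ObjectProperty C} [P.IsMonoidal] {A : C}

/-- `σ†_U : A^* ⊗ U ⟶ U ⊗ A^*`, obtained from the inverse of `σ_U`. -/
def dualHom (b : RelHalfBraiding P A) (U : C) (hU : P U) : dual A ⊗ U ⟶ U ⊗ dual A :=
  𝟙 _ ⊗≫ (dual A ⊗ U) ◁ coev A ⊗≫ dual A ◁ (b.β U hU).inv ▷ dual A ⊗≫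
    ev A ▷ (U ⊗ dual A) ⊗≫ 𝟙 _

/-- The inverse of `σ†_U`. -/
def dualInv (b : RelHalfBraiding P A) (U : C) (hU : P U) : U ⊗ dual A ⟶ dual A ⊗ U :=
  𝟙 _ ⊗≫ coevR A ▷ (U ⊗ dual A) ⊗≫ dual A ◁ (b.β U hU).hom ▷ dual A ⊗≫
    (dual A ⊗ U) ◁ evR A ⊗≫ 𝟙 _

lemma dualHom_ev (b : RelHalfBraiding P A) (U : C) (hU : P U) :
    dualHom b U hU ▷ A ⊗≫ U ◁ ev A = 𝟙 _ ⊗≫ dual A ◁ (b.β U hU).inv ⊗≫ ev A ▷ U ⊗≫ 𝟙 _ := by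
  unfold dualHom
  calc
    _ = 𝟙 _ ⊗≫ (dual A ⊗ U) ◁ coev A ▷ A ⊗≫ ((dual A ◁ (b.β U hU).inv ⊗≫
          ev A ▷ U) ▷ (dual A ⊗ A) ≫ (𝟙_ C ⊗ U) ◁ ev A) ⊗≫ 𝟙 _ := by monoidal
    _ = 𝟙 _ ⊗≫ (dual A ⊗ U) ◁ (coev A ▷ A ⊗≫ A ◁ ev A) ⊗≫ dual A ◁ (b.β U hU).inv ⊗≫
          ev A ▷ U ⊗≫ 𝟙 _ := by rw [← whisker_exchange]; monoidal
    _ = _ := by rw [tri1]; monoidal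

lemma coev_dualHom (b : RelHalfBraiding P A) (U : C) (hU : P U) :
    coev A ▷ U ⊗≫ A ◁ dualHom b U hU =
      𝟙 _ ⊗≫ U ◁ coev A ⊗≫ (b.β U hU).inv ▷ dual A ⊗≫ 𝟙 _ := by
  unfold dualHom
  calc
    _ = 𝟙 _ ⊗≫ (coev A ▷ (U ⊗ 𝟙_ C) ≫ (A ⊗ dual A) ◁ (U ◁ coev A ⊗≫ (b.β U hU).inv ▷ dual A)) ⊗≫
          A ◁ ev A ▷ (U ⊗ dual A) ⊗≫ 𝟙 _ := by monoidal
    _ = 𝟙 _ ⊗≫ U ◁ coev A ⊗≫ (b.β U hU).inv ▷ dual A ⊗≫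
          (coev A ▷ A ⊗≫ A ◁ ev A) ▷ (U ⊗ dual A) ⊗≫ 𝟙 _ := by
        rw [← whisker_exchange]; monoidal
    _ = _ := by rw [tri1]; monoidal

lemma dualInv_evR (b : RelHalfBraiding P A) (U : C) (hU : P U) :
    A ◁ dualInv b U hU ⊗≫ evR A ▷ U =
      𝟙 _ ⊗≫ (b.β U hU).hom ▷ dual A ⊗≫ U ◁ evR A ⊗≫ 𝟙 _ := by
  unfold dualInv
  calc
    _ = 𝟙 _ ⊗≫ A ◁ coevR A ▷ (U ⊗ dual A) ⊗≫ ((A ⊗ dual A) ◁ ((b.β U hU).hom ▷ dual A ⊗≫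
          U ◁ evR A) ≫ evR A ▷ (U ⊗ 𝟙_ C)) ⊗≫ 𝟙 _ := by monoidal
    _ = 𝟙 _ ⊗≫ (A ◁ coevR A ⊗≫ evR A ▷ A) ▷ (U ⊗ dual A) ⊗≫ (b.β U hU).hom ▷ dual A ⊗≫
          U ◁ evR A ⊗≫ 𝟙 _ := by rw [whisker_exchange]; monoidal
    _ = _ := by rw [tri4]; monoidal

lemma coevR_dualInv (b : RelHalfBraiding P A) (U : C) (hU : P U) :
    U ◁ coevR A ⊗≫ dualInv b U hU ▷ A =
      𝟙 _ ⊗≫ coevR A ▷ U ⊗≫ dual A ◁ (b.β U hU).hom ⊗≫ 𝟙 _ := by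
  unfold dualInv
  calc
    _ = 𝟙 _ ⊗≫ ((𝟙_ C ⊗ U) ◁ coevR A ≫ (coevR A ▷ U ⊗≫ dual A ◁ (b.β U hU).hom) ▷ (dual A ⊗ A)) ⊗≫
          (dual A ⊗ U) ◁ evR A ▷ A ⊗≫ 𝟙 _ := by monoidal
    _ = 𝟙 _ ⊗≫ coevR A ▷ U ⊗≫ dual A ◁ (b.β U hU).hom ⊗≫
          (dual A ⊗ U) ◁ (A ◁ coevR A ⊗≫ evR A ▷ A) ⊗≫ 𝟙 _ := by
        rw [whisker_exchange]; monoidal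
    _ = _ := by rw [tri4]; monoidal

/-- The family `σ†` as a lax half braiding. -/
def dualLax (b : RelHalfBraiding P A) : LaxHalf P (dual A) where
  s := dualHom b
  nat {U V} hU hV f := by
    unfold dualHom
    calc
      _ = 𝟙 _ ⊗≫ dual A ◁ (f ▷ 𝟙_ C ≫ V ◁ coev A) ⊗≫ dual A ◁ (b.β V hV).inv ▷ dual A ⊗≫
            ev A ▷ (V ⊗ dual A) ⊗≫ 𝟙 _ := by monoidal
      _ = 𝟙 _ ⊗≫ dual A ◁ U ◁ coev A ⊗≫ dual A ◁ (f ▷ A ≫ (b.β V hV).inv) ▷ dual A ⊗≫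
            ev A ▷ (V ⊗ dual A) ⊗≫ 𝟙 _ := by rw [← whisker_exchange]; monoidal
      _ = 𝟙 _ ⊗≫ dual A ◁ U ◁ coev A ⊗≫ dual A ◁ (b.β U hU).inv ▷ dual A ⊗≫
            ((dual A ⊗ A) ◁ f ≫ ev A ▷ V) ▷ dual A ⊗≫ 𝟙 _ := by
          rw [b.inv_nat hU hV]; monoidal
      _ = _ := by rw [whisker_exchange]; monoidal
  mul U V hU hV := by
    symm
    calc
      _ = 𝟙 _ ⊗≫ (dualHom b U hU ▷ (V ⊗ 𝟙_ C) ≫ (U ⊗ dual A) ◁ (V ◁ coev A ⊗≫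
            (b.β V hV).inv ▷ dual A)) ⊗≫ U ◁ ev A ▷ (V ⊗ dual A) ⊗≫ 𝟙 _ := by
          conv_lhs => enter [2, 2, 2, 1]; unfold dualHom
          monoidal
      _ = 𝟙 _ ⊗≫ (dual A ⊗ U) ◁ (V ◁ coev A ⊗≫ (b.β V hV).inv ▷ dual A) ⊗≫
            (dualHom b U hU ▷ A ⊗≫ U ◁ ev A) ▷ (V ⊗ dual A) ⊗≫ 𝟙 _ := by
          rw [← whisker_exchange]; monoidal
      _ = _ := by
          rw [dualHom_ev]
          unfold dualHom
          rw [b.inv_mul hU hV]; monoidal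
  one := by
    unfold dualHom
    calc
      _ = 𝟙 _ ⊗≫ (dual A ◁ coev A ⊗≫ ev A ▷ dual A) ⊗≫ 𝟙 _ := by rw [b.inv_one]; monoidal
      _ = _ := by rw [tri2]; monoidal

lemma inv_eq_rot (b : RelHalfBraiding P A) {U : C} (hU : P U) (hU' : P (dual U)) :
    (b.β (dual U) hU').inv = b.toLax.rot hU (coev U) (ev U) := by
  have h := b.toLax.comp_rot hU' hU (coev U) (ev U) (tri2 U)
  rw [← cancel_epi (b.β (dual U) hU').hom, Iso.hom_inv_id]
  exact h.symm

lemma dualHom_dual (b : RelHalfBraiding P A) {U : C} (hU : P U) (hU' : P (dual U)) :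
    dualHom b (dual U) hU' = leftNest (b.β U hU).hom := by
  unfold dualHom
  rw [inv_eq_rot b hU hU', leftNest_def]
  change 𝟙 _ ⊗≫ (dual A ⊗ dual U) ◁ coev A ⊗≫ dual A ◁ (𝟙 _ ⊗≫ (dual U ⊗ A) ◁ coev U ⊗≫
    dual U ◁ (b.β U hU).hom ▷ dual U ⊗≫ ev U ▷ (A ⊗ dual U) ⊗≫ 𝟙 _) ▷ dual A ⊗≫
    ev A ▷ (dual U ⊗ dual A) ⊗≫ 𝟙 _ = _
  monoidal

lemma rot_rightNest (b : RelHalfBraiding P A) {U : C} (hU : P U) :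
    (𝟙 _ ⊗≫ (U ⊗ dual A) ◁ coevR U ⊗≫ U ◁ rightNest (b.β U hU).hom ▷ U ⊗≫
      evR U ▷ (dual A ⊗ U) ⊗≫ 𝟙 _ : U ⊗ dual A ⟶ dual A ⊗ U) = dualInv b U hU := by
  have key : rightNest (b.β U hU).hom = 𝟙 _ ⊗≫ coevR U ▷ (dual A ⊗ dual U) ⊗≫
      dual U ◁ dualInv b U hU ▷ dual U ⊗≫ (dual U ⊗ dual A) ◁ evR U ⊗≫ 𝟙 _ := by
    rw [rightNest_def]
    unfold dualInv
    monoidal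
  rw [key]
  calc
    _ = 𝟙 _ ⊗≫ U ◁ ((𝟙_ C ⊗ dual A) ◁ coevR U ≫ (coevR U ▷ dual A ⊗≫ dual U ◁ dualInv b U hU) ▷
            (dual U ⊗ U)) ⊗≫ (U ⊗ dual U ⊗ dual A) ◁ evR U ▷ U ⊗≫
            evR U ▷ (dual A ⊗ U) ⊗≫ 𝟙 _ := by monoidal
    _ = 𝟙 _ ⊗≫ U ◁ (coevR U ▷ dual A ⊗≫ dual U ◁ dualInv b U hU) ⊗≫
            (U ⊗ dual U ⊗ dual A) ◁ (U ◁ coevR U ⊗≫ evR U ▷ U) ⊗≫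
            evR U ▷ (dual A ⊗ U) ⊗≫ 𝟙 _ := by rw [whisker_exchange]; monoidal
    _ = 𝟙 _ ⊗≫ U ◁ coevR U ▷ dual A ⊗≫ ((U ⊗ dual U) ◁ dualInv b U hU ≫
            evR U ▷ (dual A ⊗ U)) ⊗≫ 𝟙 _ := by rw [tri4]; monoidal
    _ = 𝟙 _ ⊗≫ (U ◁ coevR U ⊗≫ evR U ▷ U) ▷ dual A ⊗≫ dualInv b U hU ⊗≫ 𝟙 _ := by
        rw [whisker_exchange]; monoidal
    _ = _ := by rw [tri4]; monoidal

end DualHalf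

section
variable {C : Type u} [Category.{v} C] [MonoidalCategory C] [PivotalCategory C]
variable {P : ObjectProperty C} [P.IsMonoidal] {A : C}

lemma dualLax_rot (b : RelHalfBraiding P A) {U : C} (hU : P U) (hU' : P (dual U)) :
    (dualLax b).rot hU' (coevR U) (evR U) = dualInv b U hU := by
  rw [← rot_rightNest, ← nest_eq, ← dualHom_dual b hU hU']
  rfl

/-- A class of objects stable under duality. -/
class DualStable (P : ObjectProperty C) : Prop where
  prop_dual {X : C} (hX : P X) : P (dual X)

/-- The dual half braiding `σ†`. -/
def dualHalf [DualStable P] (b : RelHalfBraiding P A) : RelHalfBraiding P (dual A) where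
  β U hU :=
    { hom := dualHom b U hU
      inv := dualInv b U hU
      hom_inv_id := by
        have h := (dualLax b).comp_rot hU (DualStable.prop_dual hU) (coevR U) (evR U) (tri4 U)
        rw [dualLax_rot] at h
        exact h
      inv_hom_id := by
        have h := (dualLax b).rot_comp hU (DualStable.prop_dual hU) (coevR U) (evR U) (tri4 U)
        rw [dualLax_rot] at h
        exact h }
  naturality := (dualLax b).nat
  monoidal := (dualLax b).mul

namespace RelCenter
variable [DualStable P]

/-- The dual `(A^*, σ†)` of `(A, σ)`. -/
def dualObj (A : RelCenter P) : RelCenter P := ⟨dual A.pt, dualHalf A.half⟩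

lemma ev_comm (A : RelCenter P) (U : C) (hU : P U) :
    ev A.pt ▷ U ≫ (𝟙_ (RelCenter P)).σ U hU = (dualObj A ⊗ A).σ U hU ≫ U ◁ ev A.pt := by
  change ev A.pt ▷ U ≫ (λ_ U).hom ≫ (ρ_ U).inv = ((α_ _ _ _).hom ≫
    dual A.pt ◁ A.σ U hU ≫ (α_ _ _ _).inv ≫ dualHom A.half U hU ▷ A.pt ≫ (α_ _ _ _).hom) ≫
      U ◁ ev A.pt
  symm
  calc
    _ = 𝟙 _ ⊗≫ dual A.pt ◁ A.σ U hU ⊗≫ (dualHom A.half U hU ▷ A.pt ⊗≫ U ◁ ev A.pt) ⊗≫ 𝟙 _ := by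
        monoidal
    _ = 𝟙 _ ⊗≫ dual A.pt ◁ ((A.half.β U hU).hom ≫ (A.half.β U hU).inv) ⊗≫ ev A.pt ▷ U ⊗≫ 𝟙 _ := by
        rw [dualHom_ev]; monoidal
    _ = _ := by rw [Iso.hom_inv_id]; monoidal

lemma coev_comm (A : RelCenter P) (U : C) (hU : P U) :
    coev A.pt ▷ U ≫ (A ⊗ dualObj A).σ U hU = (𝟙_ (RelCenter P)).σ U hU ≫ U ◁ coev A.pt := by
  change coev A.pt ▷ U ≫ ((α_ _ _ _).hom ≫
    A.pt ◁ dualHom A.half U hU ≫ (α_ _ _ _).inv ≫ A.σ U hU ▷ dual A.pt ≫ (α_ _ _ _).hom) =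
      ((λ_ U).hom ≫ (ρ_ U).inv) ≫ U ◁ coev A.pt
  calc
    _ = 𝟙 _ ⊗≫ (coev A.pt ▷ U ⊗≫ A.pt ◁ dualHom A.half U hU) ⊗≫ A.σ U hU ▷ dual A.pt ⊗≫ 𝟙 _ := by
        monoidal
    _ = 𝟙 _ ⊗≫ U ◁ coev A.pt ⊗≫ ((A.half.β U hU).inv ≫ (A.half.β U hU).hom) ▷ dual A.pt ⊗≫
          𝟙 _ := by
        rw [coev_dualHom]; monoidal
    _ = _ := by rw [Iso.inv_hom_id]; monoidal

lemma evR_comm (A : RelCenter P) (U : C) (hU : P U) :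
    evR A.pt ▷ U ≫ (𝟙_ (RelCenter P)).σ U hU = (A ⊗ dualObj A).σ U hU ≫ U ◁ evR A.pt := by
  change evR A.pt ▷ U ≫ (λ_ U).hom ≫ (ρ_ U).inv = ((α_ _ _ _).hom ≫
    A.pt ◁ dualHom A.half U hU ≫ (α_ _ _ _).inv ≫ A.σ U hU ▷ dual A.pt ≫ (α_ _ _ _).hom) ≫
      U ◁ evR A.pt
  symm
  calc
    _ = 𝟙 _ ⊗≫ A.pt ◁ dualHom A.half U hU ⊗≫ (𝟙 (A.pt ⊗ U ⊗ dual A.pt) ⊗≫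
          A.σ U hU ▷ dual A.pt ⊗≫ U ◁ evR A.pt ⊗≫ 𝟙 (𝟙_ C ⊗ U)) ⊗≫ 𝟙 _ := by monoidal
    _ = 𝟙 _ ⊗≫ A.pt ◁ (((dualHalf A.half).β U hU).hom ≫ ((dualHalf A.half).β U hU).inv) ⊗≫
          evR A.pt ▷ U ⊗≫ 𝟙 _ := by
        rw [← dualInv_evR]
        change _ = 𝟙 _ ⊗≫ A.pt ◁ (dualHom A.half U hU ≫ dualInv A.half U hU) ⊗≫
          evR A.pt ▷ U ⊗≫ 𝟙 _
        monoidal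
    _ = _ := by rw [Iso.hom_inv_id]; monoidal

lemma coevR_comm (A : RelCenter P) (U : C) (hU : P U) :
    coevR A.pt ▷ U ≫ (dualObj A ⊗ A).σ U hU = (𝟙_ (RelCenter P)).σ U hU ≫ U ◁ coevR A.pt := by
  change coevR A.pt ▷ U ≫ ((α_ _ _ _).hom ≫
    dual A.pt ◁ A.σ U hU ≫ (α_ _ _ _).inv ≫ dualHom A.half U hU ▷ A.pt ≫ (α_ _ _ _).hom) =
      ((λ_ U).hom ≫ (ρ_ U).inv) ≫ U ◁ coevR A.pt
  calc
    _ = 𝟙 _ ⊗≫ (𝟙 (U ⊗ 𝟙_ C) ⊗≫ coevR A.pt ▷ U ⊗≫ dual A.pt ◁ A.σ U hU ⊗≫ 𝟙 ((dual A.pt ⊗ U) ⊗ A.pt)) ⊗≫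
          dualHom A.half U hU ▷ A.pt ⊗≫ 𝟙 _ := by monoidal
    _ = 𝟙 _ ⊗≫ U ◁ coevR A.pt ⊗≫ (((dualHalf A.half).β U hU).inv ≫
          ((dualHalf A.half).β U hU).hom) ▷ A.pt ⊗≫ 𝟙 _ := by
        rw [← coevR_dualInv]
        change _ = 𝟙 _ ⊗≫ U ◁ coevR A.pt ⊗≫ (dualInv A.half U hU ≫
          dualHom A.half U hU) ▷ A.pt ⊗≫ 𝟙 _
        monoidal
    _ = _ := by rw [Iso.inv_hom_id]; monoidal

/-- The duality of the relative center lifts that of `C`. -/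
instance : DualityData (RelCenter P) where
  dual := dualObj
  left A :=
    { coevaluation' := ⟨coev A.pt, coev_comm A⟩
      evaluation' := ⟨ev A.pt, ev_comm A⟩
      coevaluation_evaluation' := by
        apply hom_ext
        exact (DualityData.left A.pt).coevaluation_evaluation'
      evaluation_coevaluation' := by
        apply hom_ext
        exact (DualityData.left A.pt).evaluation_coevaluation' }
  right A :=
    { coevaluation' := ⟨coevR A.pt, coevR_comm A⟩
      evaluation' := ⟨evR A.pt, evR_comm A⟩
      coevaluation_evaluation' := by
        apply hom_ext
        exact (DualityData.right A.pt).coevaluation_evaluation'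
      evaluation_coevaluation' := by
        apply hom_ext
        exact (DualityData.right A.pt).evaluation_coevaluation' }

/-- The pivotal structure of the relative center. -/
instance : PivotalCategory (RelCenter P) where
  map_eq f := by
    apply hom_ext
    exact PivotalCategory.map_eq (Hom.f f)
  constraint_eq A B := by
    apply hom_ext
    exact PivotalCategory.constraint_eq A.pt B.pt
  unitConstraint_eq := by
    apply hom_ext
    exact PivotalCategory.unitConstraint_eq (C := C)

end RelCenter

end
end TV

namespace TV

namespace RelCenter

section Additive
variable {C : Type u} [Category.{v} C] [MonoidalCategory C] [Preadditive C]
  [MonoidalPreadditive C] {P : ObjectProperty C} [P.IsMonoidal]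

instance (A B : RelCenter P) : Zero (A ⟶ B) := ⟨⟨0, fun U hU => by simp⟩⟩

instance (A B : RelCenter P) : Add (A ⟶ B) :=
  ⟨fun f g => ⟨Hom.f f + Hom.f g, fun U hU => by simp [hom_comm]⟩⟩

instance (A B : RelCenter P) : Neg (A ⟶ B) :=
  ⟨fun f => ⟨-Hom.f f, fun U hU => by
    have h1 : (-Hom.f f) ▷ U = -(Hom.f f ▷ U) := ((tensorRight U).map_neg (f := Hom.f f))
    have h2 : U ◁ (-Hom.f f) = -(U ◁ Hom.f f) := ((tensorLeft U).map_neg (f := Hom.f f))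
    rw [h1, h2, Preadditive.neg_comp, Preadditive.comp_neg, hom_comm]⟩⟩

@[simp] lemma zero_f (A B : RelCenter P) : Hom.f (0 : A ⟶ B) = 0 := rfl
@[simp] lemma add_f {A B : RelCenter P} (f g : A ⟶ B) : Hom.f (f + g) = Hom.f f + Hom.f g := rfl
@[simp] lemma neg_f {A B : RelCenter P} (f : A ⟶ B) : Hom.f (-f) = -Hom.f f := rfl

instance (A B : RelCenter P) : AddCommGroup (A ⟶ B) where
  add_assoc _ _ _ := hom_ext (add_assoc _ _ _)
  zero_add _ := hom_ext (zero_add _)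
  add_zero _ := hom_ext (add_zero _)
  add_comm _ _ := hom_ext (add_comm _ _)
  neg_add_cancel _ := hom_ext (neg_add_cancel _)
  nsmul := nsmulRec
  zsmul := zsmulRec

/-- Morphisms of the relative center are added as in `C`. -/
instance : Preadditive (RelCenter P) where
  add_comp _ _ _ _ _ _ := hom_ext (Preadditive.add_comp _ _ _ _ _ _)
  comp_add _ _ _ _ _ _ := hom_ext (Preadditive.comp_add _ _ _ _ _ _)

instance : MonoidalPreadditive (RelCenter P) where
  whiskerLeft_zero := hom_ext MonoidalPreadditive.whiskerLeft_zero
  zero_whiskerRight := hom_ext MonoidalPreadditive.zero_whiskerRight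
  whiskerLeft_add _ _ := hom_ext (MonoidalPreadditive.whiskerLeft_add _ _)
  add_whiskerRight _ _ := hom_ext (MonoidalPreadditive.add_whiskerRight _ _)

variable {𝕜 : Type w} [CommRing 𝕜] [Linear 𝕜 C] [MonoidalLinear 𝕜 C]

instance (A B : RelCenter P) : SMul 𝕜 (A ⟶ B) :=
  ⟨fun r f => ⟨r • Hom.f f, fun U hU => by simp [hom_comm]⟩⟩

@[simp] lemma smul_f {A B : RelCenter P} (r : 𝕜) (f : A ⟶ B) : Hom.f (r • f) = r • Hom.f f := rfl

instance (A B : RelCenter P) : Module 𝕜 (A ⟶ B) where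
  one_smul _ := hom_ext (one_smul _ _)
  mul_smul _ _ _ := hom_ext (mul_smul _ _ _)
  smul_zero _ := hom_ext (smul_zero _)
  smul_add _ _ _ := hom_ext (smul_add _ _ _)
  add_smul _ _ _ := hom_ext (add_smul _ _ _)
  zero_smul _ := hom_ext (zero_smul _ _)

/-- Morphisms of the relative center are multiplied by scalars as in `C`. -/
instance : Linear 𝕜 (RelCenter P) where
  smul_comp _ _ _ _ _ _ := hom_ext (Linear.smul_comp _ _ _ _ _ _)
  comp_smul _ _ _ _ _ _ := hom_ext (Linear.comp_smul _ _ _ _ _ _)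

instance : MonoidalLinear 𝕜 (RelCenter P) where
  whiskerLeft_smul _ _ _ _ _ := hom_ext (MonoidalLinear.whiskerLeft_smul _ _ _)
  smul_whiskerRight _ _ _ _ _ := hom_ext (MonoidalLinear.smul_whiskerRight _ _ _)

end Additive

end RelCenter

section Semisimple
variable {C : Type u} [Category.{v} C] [Preadditive C]

/-- `X` is a direct sum of the family `f`. -/
def IsDirectSum {ι : Type w} (X : C) (f : ι → C) : Prop :=
  ∃ b : Bicone f, Nonempty b.IsBilimit ∧ Nonempty (b.pt ≅ X)

variable (𝕜 : Type w) [CommRing 𝕜] [Linear 𝕜 C]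

/-- `X` is simple: `End X` is a free `𝕜`-module of rank one. -/
def IsSimpleObj (X : C) : Prop := Nonempty (𝕜 ≃ₗ[𝕜] (X ⟶ X))

variable (C) in
/-- Split semisimplicity: every object is a finite direct sum of simple objects, and there are no
nonzero morphisms between non-isomorphic simple objects. -/
structure IsSplitSemisimple : Prop where
  decomposes (X : C) : ∃ (n : ℕ) (f : Fin n → C), (∀ j, IsSimpleObj 𝕜 (f j)) ∧ IsDirectSum X f
  hom_eq_zero (X Y : C) : IsSimpleObj 𝕜 X → IsSimpleObj 𝕜 Y → IsEmpty (X ≅ Y) →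
    ∀ f : X ⟶ Y, f = 0

/-- The isomorphism classes of simple objects in the full subcategory with objects `P`. -/
def simpleClasses (P : ObjectProperty C) : Set (Quotient (isIsomorphicSetoid C)) :=
  {c | ∃ X : C, P X ∧ IsSimpleObj 𝕜 X ∧ Quotient.mk (isIsomorphicSetoid C) X = c}

/-- A simple object of the full subcategory with objects `P`, in a given isomorphism class. -/
def simpleRep (P : ObjectProperty C) (c : simpleClasses 𝕜 P) : C := c.2.choose

/-- The dimension `∑ dim_l(i) dim_r(i)` of the full subcategory with objects `P`; here `i` runs over
a representative set of simple objects of the subcategory, which is assumed to be finite. -/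
def dimension [MonoidalCategory C] [PivotalCategory C] (P : ObjectProperty C) : 𝟙_ C ⟶ 𝟙_ C :=
  ∑ᶠ c : simpleClasses 𝕜 P, dimL (simpleRep 𝕜 P c) ≫ dimR (simpleRep 𝕜 P c)

end Semisimple

section Graded
variable {C : Type u} [Category.{v} C] [MonoidalCategory C] [Preadditive C]
  {G : Type w'} [Group G]

/-- `grading α` is the class of objects of the full subcategory `C_α` of a `G`-graded category.
The subcategories are disjoint up to zero objects by `hom_eq_zero`. -/
class IsGGraded (grading : G → ObjectProperty C) : Prop where
  hasFiniteBiproducts : HasFiniteBiproducts C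
  additive (α : G) (n : ℕ) (f : Fin n → C) : (∀ j, grading α (f j)) →
    ∃ X, grading α X ∧ IsDirectSum X f
  splits (X : C) : ∃ (s : Finset G) (Y : G → C), (∀ α ∈ s, grading α (Y α)) ∧
    IsDirectSum X (fun α : s => Y α)
  tensor {α β : G} {X Y : C} : grading α X → grading β Y → grading (α * β) (X ⊗ Y)
  hom_eq_zero {α β : G} {X Y : C} : grading α X → grading β Y → α ≠ β → ∀ f : X ⟶ Y, f = 0
  unit : grading 1 (𝟙_ C)

/-- A pivotal `G`-graded category. The dual of an object of `C_α` is chosen in `C_{α⁻¹}`. -/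
class IsPivotalGraded [PivotalCategory C] (grading : G → ObjectProperty C) : Prop extends
    IsGGraded grading where
  dual_mem {α : G} {X : C} : grading α X → grading α⁻¹ (dual X)

instance (grading : G → ObjectProperty C) [h : IsGGraded grading] : (grading 1).IsMonoidal where
  prop_unit := h.unit
  prop_tensor _ _ hX hY := one_mul (1 : G) ▸ h.tensor hX hY

instance [PivotalCategory C] (grading : G → ObjectProperty C) [h : IsPivotalGraded grading] :
    DualStable (grading 1) where
  prop_dual hX := inv_one (G := G) ▸ h.dual_mem hX

/-- A `G`-fusion category. -/
structure IsGFusion (𝕜 : Type w) [CommRing 𝕜] [Linear 𝕜 C] [MonoidalPreadditive C]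
    [MonoidalLinear 𝕜 C] [PivotalCategory C] (grading : G → ObjectProperty C) : Prop extends
    IsPivotalGraded grading where
  unit_simple : IsSimpleObj 𝕜 (𝟙_ C)
  splitSemisimple : IsSplitSemisimple C 𝕜
  exists_simple (α : G) : ∃ X : C, grading α X ∧ IsSimpleObj 𝕜 X
  finite_simple (α : G) : (simpleClasses 𝕜 (grading α)).Finite

/-- The `G`-center: the center of `C` relative to `C_1`. -/
abbrev GCenter (grading : G → ObjectProperty C) [IsGGraded grading] := RelCenter (grading 1)

/-- The grading of the `G`-center: `Z_α(C)` consists of the half braidings `(A, σ)` with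
`A ∈ C_α`. -/
def centerGrading (grading : G → ObjectProperty C) [IsGGraded grading] :
    G → ObjectProperty (GCenter grading) := fun α A => grading α A.pt

end Graded

end TV

end

/-! The linear, monoidal and pivotal structures of the center are lifted from `C`. The grading lifts
as well: tensoring with an object of `C_1` preserves degree, so a half braiding is block diagonal
for the homogeneous decomposition. What needs an argument is semisimplicity and the count of simple
objects.

Semisimplicity is a Maschke argument. Over an algebraically closed field, a linear category with
finite-dimensional endomorphism spaces is split semisimple once every `f` has a `g` with `f ≫ g ≫ f
= f` and idempotents split (`isSplitSemisimple_of_regular`). An idempotent of the center splits in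
`C`, and its image inherits a half braiding. For regularity, `g` exists in `C` and is then averaged:
conjugate it by the half braidings at each simple `i` of `C_1`, close the strand `i` into a loop,
and sum with weights `dim_l(i)`. The result is a morphism of the center because the weighted loop
slides across any strand `U` of `C_1` (`RelCenter.sum_avg_whiskerRight`). This handle slide rests on
`SimpleSystem.sum_rotOut_rotIn`: resolutions of the objects `U ⊗ i`, rotated and weighted, resolve
`j^* ⊗ U`. Averaging commutes with composition by morphisms of the center and sends the identity to
`dim(C_1)` times the identity, which can be divided out.

Simple objects are controlled by induction: `X` in `C_α` gives an object of the center on `⨁ i ⊗ X ⊗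
i^*`, where `i` runs over the simples of `C_1`. Its half braiding is a canonical sum over
resolutions, and the axioms follow from dinaturality of that sum. Every nonzero `f : A ⟶ X` in `C`
yields a nonzero morphism from `(A, σ)` to the induced object (`RelCenter.toInduced_ne_zero`). Hence
each simple object of degree `α` is a summand of an object induced from one of the finitely many
simples of `C_α`. Induced objects are nonzero, so simples exist in every degree. Both nonvanishing
statements need only one `i` with `dim_l(i) ≠ 0`, which `dim(C_1) ≠ 0` provides. -/

set_option linter.unusedSectionVars false

noncomputable section

namespace TV

/-! ### Finite direct sums as explicit inclusions and projections -/

section Splitting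
variable {C : Type u} [Category.{v} C] [Preadditive C]

/-- Inclusions and projections exhibiting `X` as the direct sum of a finite family. -/
structure Splitting {J : Type*} [Fintype J] (X : C) (f : J → C) where
  ι (j : J) : f j ⟶ X
  π (j : J) : X ⟶ f j
  ι_π_self (j : J) : ι j ≫ π j = 𝟙 (f j)
  ι_π_ne {j k : J} (h : j ≠ k) : ι j ≫ π k = 0
  total : ∑ j, π j ≫ ι j = 𝟙 X

attribute [simp] Splitting.ι_π_self

variable {J : Type*} [Fintype J] {X : C} {f : J → C}

lemma IsDirectSum.nonempty_splitting (h : IsDirectSum X f) : Nonempty (Splitting X f) := by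
  obtain ⟨b, ⟨hb⟩, ⟨e⟩⟩ := h
  exact ⟨{
    ι := fun j => b.ι j ≫ e.hom
    π := fun j => e.inv ≫ b.π j
    ι_π_self := fun j => by simp
    ι_π_ne := fun h => by simp [bicone_ι_π_ne b h]
    total := by
      have : ∑ j, (e.inv ≫ b.π j) ≫ b.ι j ≫ e.hom = e.inv ≫ (∑ j, b.π j ≫ b.ι j) ≫ e.hom := by
        simp [Preadditive.comp_sum, Preadditive.sum_comp]
      rw [this, IsBilimit.total hb]
      simp }⟩

open Classical in
/-- The bicone of a splitting. -/
def Splitting.bicone (s : Splitting X f) : Bicone f where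
  pt := X
  ι := s.ι
  π := s.π
  ι_π j j' := by
    split_ifs with h
    · subst h; simp
    · exact s.ι_π_ne h

lemma Splitting.isDirectSum (s : Splitting X f) : IsDirectSum X f :=
  ⟨s.bicone, ⟨isBilimitOfTotal s.bicone s.total⟩, ⟨Iso.refl X⟩⟩

lemma Splitting.hasBiproduct (s : Splitting X f) : HasBiproduct f :=
  hasBiproduct_of_total s.bicone s.total

/-- Reindexing a splitting. -/
def Splitting.reindex {K : Type*} [Fintype K] (s : Splitting X f) (e : K ≃ J) :
    Splitting X (fun k => f (e k)) where
  ι k := s.ι (e k)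
  π k := s.π (e k)
  ι_π_self k := s.ι_π_self _
  ι_π_ne h := s.ι_π_ne (fun h' => h (e.injective h'))
  total := by rw [← s.total, ← e.sum_comp]

/-- The splitting of a biproduct. -/
def Splitting.biproduct (f : J → C) [HasBiproduct f] : Splitting (⨁ f) f where
  ι := biproduct.ι f
  π := biproduct.π f
  ι_π_self j := by simp
  ι_π_ne h := biproduct.ι_π_ne f h
  total := IsBilimit.total (biproduct.isBilimit f)

lemma Splitting.hom_ext_right (s : Splitting X f) {Z : C} {g h : X ⟶ Z}
    (H : ∀ j, s.ι j ≫ g = s.ι j ≫ h) : g = h := by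
  rw [← Category.id_comp g, ← Category.id_comp h, ← s.total, Preadditive.sum_comp,
    Preadditive.sum_comp]
  exact Finset.sum_congr rfl fun j _ => by simp [H]

lemma Splitting.hom_ext_left (s : Splitting X f) {Z : C} {g h : Z ⟶ X}
    (H : ∀ j, g ≫ s.π j = h ≫ s.π j) : g = h := by
  rw [← Category.comp_id g, ← Category.comp_id h, ← s.total, Preadditive.comp_sum,
    Preadditive.comp_sum]
  exact Finset.sum_congr rfl fun j _ => by rw [← Category.assoc, H, Category.assoc]

end Splitting

/-! ### Simple objects over a field -/

section Schur
variable {C : Type u} [Category.{v} C] [Preadditive C] {𝕜 : Type w} [Field 𝕜] [Linear 𝕜 C]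

lemma IsSimpleObj.id_ne_zero {X : C} (h : IsSimpleObj 𝕜 X) : 𝟙 X ≠ 0 := by
  obtain ⟨e⟩ := h
  intro h0
  have h1 : e 1 = e 0 := by
    rw [← Category.comp_id (e 1), ← Category.comp_id (e 0), h0]; simp
  exact one_ne_zero (e.injective h1)

lemma IsSimpleObj.exists_smul {X : C} (h : IsSimpleObj 𝕜 X) (f : X ⟶ X) :
    ∃ c : 𝕜, f = c • 𝟙 X := by
  have h0 := h.id_ne_zero
  obtain ⟨e⟩ := h
  have h1 : e.symm (𝟙 X) ≠ 0 := by simpa using h0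
  refine ⟨e.symm f / e.symm (𝟙 X), e.symm.injective ?_⟩
  rw [map_smul, smul_eq_mul, div_mul_cancel₀ _ h1]

lemma isSimpleObj_of_exists_smul {X : C} (h0 : 𝟙 X ≠ 0) (h : ∀ f : X ⟶ X, ∃ c : 𝕜, f = c • 𝟙 X) :
    IsSimpleObj 𝕜 X := by
  refine ⟨LinearEquiv.ofBijective (LinearMap.toSpanSingleton 𝕜 (X ⟶ X) (𝟙 X)) ⟨?_, fun f => ?_⟩⟩
  · rw [injective_iff_map_eq_zero]
    intro c hc
    rw [LinearMap.toSpanSingleton_apply] at hc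
    exact (smul_eq_zero.1 hc).resolve_right h0
  · obtain ⟨c, hc⟩ := h f
    exact ⟨c, by rw [LinearMap.toSpanSingleton_apply, hc]⟩

lemma IsSimpleObj.of_iso {X Y : C} (h : IsSimpleObj 𝕜 X) (e : X ≅ Y) : IsSimpleObj 𝕜 Y := by
  refine isSimpleObj_of_exists_smul (fun h0 => h.id_ne_zero ?_) fun f => ?_
  · rw [← Category.comp_id (𝟙 X), ← e.hom_inv_id, ← Category.id_comp e.inv, h0]; simp
  · obtain ⟨c, hc⟩ := h.exists_smul (e.hom ≫ f ≫ e.inv)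
    refine ⟨c, ?_⟩
    rw [← cancel_epi e.hom, ← cancel_mono e.inv, Category.assoc, hc]
    simp

end Schur

/-! ### Finiteness, regularity and split idempotents in a split semisimple category -/

section Split
variable {C : Type u} [Category.{v} C] [Preadditive C] {𝕜 : Type w} [Field 𝕜] [Linear 𝕜 C]

lemma IsSplitSemisimple.exists_splitting (h : IsSplitSemisimple C 𝕜) (X : C) :
    ∃ (n : ℕ) (f : Fin n → C), (∀ j, IsSimpleObj 𝕜 (f j)) ∧ Nonempty (Splitting X f) := by
  obtain ⟨n, f, hf, hX⟩ := h.decomposes X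
  exact ⟨n, f, hf, hX.nonempty_splitting⟩

/-- Matrix entries embed `X ⟶ Y` into a finite product of Hom-spaces between simples, each of
dimension at most one. -/
lemma IsSplitSemisimple.finite_hom (h : IsSplitSemisimple C 𝕜) (X Y : C) :
    Module.Finite 𝕜 (X ⟶ Y) := by
  obtain ⟨n, f, hf, ⟨s⟩⟩ := h.exists_splitting X
  obtain ⟨m, g, hg, ⟨t⟩⟩ := h.exists_splitting Y
  have hfin (j : Fin n) (k : Fin m) : Module.Finite 𝕜 (f j ⟶ g k) := by
    by_cases he : Nonempty (f j ≅ g k)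
    · obtain ⟨e⟩ := he
      refine Module.Finite.of_surjective (LinearMap.toSpanSingleton 𝕜 (f j ⟶ g k) e.hom) fun x => ?_
      obtain ⟨c, hc⟩ := (hf j).exists_smul (x ≫ e.inv)
      refine ⟨c, ?_⟩
      rw [LinearMap.toSpanSingleton_apply, ← cancel_mono e.inv, hc]
      simp
    · have : Subsingleton (f j ⟶ g k) := ⟨fun a b => by
        rw [h.hom_eq_zero _ _ (hf j) (hg k) (not_nonempty_iff.1 he) a,
          h.hom_eq_zero _ _ (hf j) (hg k) (not_nonempty_iff.1 he) b]⟩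
      infer_instance
  refine Module.Finite.of_injective (N := ∀ (j : Fin n) (k : Fin m), f j ⟶ g k)
    (LinearMap.pi fun j => LinearMap.pi fun k =>
      (Linear.leftComp 𝕜 (g k) (s.ι j)).comp (Linear.rightComp 𝕜 X (t.π k))) ?_
  intro a b hab
  refine s.hom_ext_right fun j => t.hom_ext_left fun k => ?_
  have := congr_fun (congr_fun hab j) k
  simpa using this

/-- A nonzero morphism has a simple object on which it is invertible. -/
lemma IsSplitSemisimple.exists_simple_retract (h : IsSplitSemisimple C 𝕜) {X Y : C} (f : X ⟶ Y)
    (hf0 : f ≠ 0) : ∃ (S : C) (a : S ⟶ X) (b : Y ⟶ S), IsSimpleObj 𝕜 S ∧ a ≫ f ≫ b = 𝟙 S := by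
  obtain ⟨n, S, hS, ⟨s⟩⟩ := h.exists_splitting X
  obtain ⟨m, T, hT, ⟨t⟩⟩ := h.exists_splitting Y
  obtain ⟨j, k, hjk⟩ : ∃ j k, s.ι j ≫ f ≫ t.π k ≠ 0 := by
    by_contra! H
    refine hf0 (s.hom_ext_right fun j => t.hom_ext_left fun k => ?_)
    simp [H]
  have he : Nonempty (S j ≅ T k) := by
    by_contra he
    exact hjk (h.hom_eq_zero _ _ (hS j) (hT k) (not_nonempty_iff.1 he) _)
  obtain ⟨e⟩ := he
  obtain ⟨c, hc⟩ := (hS j).exists_smul (s.ι j ≫ f ≫ t.π k ≫ e.inv)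
  have hc0 : c ≠ 0 := by
    rintro rfl
    apply hjk
    rw [← cancel_mono e.inv]
    simpa using hc
  refine ⟨S j, s.ι j, c⁻¹ • (t.π k ≫ e.inv), hS j, ?_⟩
  simp [hc, smul_smul, hc0]

/-- Every morphism is a split epimorphism followed by a split monomorphism. -/
theorem IsSplitSemisimple.exists_factorization (h : IsSplitSemisimple C 𝕜)
    [HasFiniteBiproducts C] {X Y : C} (f : X ⟶ Y) :
    ∃ (S : C) (p : X ⟶ S) (s : S ⟶ X) (i : S ⟶ Y) (r : Y ⟶ S),
      s ≫ p = 𝟙 S ∧ i ≫ r = 𝟙 S ∧ p ≫ i = f := by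
  have hfin := h.finite_hom X X
  -- The measure is the dimension of the ideal of all `f ≫ g` inside `X ⟶ X`.
  induction hn : Module.finrank 𝕜 (LinearMap.range (Linear.leftComp 𝕜 X f))
    using Nat.strong_induction_on generalizing f with
  | _ n ih =>
  have hb : HasBinaryBiproducts C := hasBinaryBiproducts_of_finite_biproducts C
  by_cases hf0 : f = 0
  -- The empty biproduct plays the role of a zero object.
  · exact ⟨(⨁ (fun a : PEmpty.{1} => a.elim)), 0, 0, 0, 0,
      biproduct.hom_ext _ _ (fun j => j.elim), biproduct.hom_ext _ _ (fun j => j.elim), by simp [hf0]⟩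
  obtain ⟨S, a, b, hS, hab⟩ := h.exists_simple_retract f hf0
  have hab' : a ≫ f ≫ b ≫ a ≫ f = a ≫ f := by
    rw [← Category.assoc f b, ← Category.assoc a, hab, Category.id_comp]
  -- The part of `f` that passes through `S` is removed; the remainder is annihilated by `a` on the
  -- source side and by `b` on the target side.
  set f' : X ⟶ Y := f - f ≫ b ≫ a ≫ f with hf'
  have haf' : a ≫ f' = 0 := by rw [hf', Preadditive.comp_sub, hab', sub_self]
  have hf'b : f' ≫ b = 0 := by simp [hf', Preadditive.sub_comp, hab]
  have hlt : Module.finrank 𝕜 (LinearMap.range (Linear.leftComp 𝕜 X f')) < n := by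
    rw [← hn]
    apply Submodule.finrank_lt_finrank_of_lt
    refine lt_of_le_of_ne ?_ ?_
    · rintro _ ⟨g, rfl⟩
      refine ⟨g - b ≫ a ≫ f ≫ g, ?_⟩
      simp [hf', Preadditive.sub_comp, Preadditive.comp_sub]
    · intro heq
      -- This element witnesses that the ideal shrinks: if it had the form `f' ≫ g`, precomposing
      -- with `a` would give `a = 0`.
      have hmem : f ≫ b ≫ a ∈ LinearMap.range (Linear.leftComp 𝕜 X f) := ⟨b ≫ a, rfl⟩
      rw [← heq] at hmem
      obtain ⟨g, hg⟩ := hmem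
      have h1 : a ≫ f' ≫ g = a ≫ f ≫ b ≫ a := by rw [← hg]; rfl
      rw [← Category.assoc, haf', zero_comp] at h1
      have h2 : a = 0 := by
        rw [← Category.id_comp a, ← hab, Category.assoc, Category.assoc]
        exact h1.symm
      exact hS.id_ne_zero (by rw [← hab, h2, zero_comp])
  obtain ⟨S', p, s, i, r, hsp, hir, hpi⟩ := ih _ hlt f' rfl
  have hap : a ≫ p = 0 := by
    have : (a ≫ p) ≫ i = 0 := by rw [Category.assoc, hpi, haf']
    rw [← Category.comp_id (a ≫ p), ← hir, ← Category.assoc, this, zero_comp]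
  have hib : i ≫ b = 0 := by
    have : p ≫ i ≫ b = 0 := by rw [← Category.assoc, hpi, hf'b]
    rw [← Category.id_comp (i ≫ b), ← hsp, Category.assoc, this, comp_zero]
  -- `hap` and `hib` kill one off-diagonal entry of each 2×2 matrix; the correction terms added to
  -- `s` and `r` kill the other.
  refine ⟨S' ⊞ S, biprod.lift p (f ≫ b), biprod.desc (s - s ≫ f ≫ b ≫ a) a,
    biprod.desc i (a ≫ f), biprod.lift (r - b ≫ a ≫ f ≫ r) b, ?_, ?_, ?_⟩
  · ext
    · simp [Preadditive.sub_comp, hap, hsp]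
    · simp [Preadditive.sub_comp, hab]
    · simp [hap]
    · simp [hab]
  · ext
    · simp [Preadditive.comp_sub, reassoc_of% hib, hir]
    · simp [hib]
    · simp only [biprod.inr_desc_assoc, Category.assoc, biprod.lift_fst, Preadditive.comp_sub]
      rw [← Category.assoc b, ← Category.assoc (b ≫ a)]
      simp [reassoc_of% hab]
    · simp [hab]
  · rw [biprod.lift_desc, hpi, hf']
    simp

/-- A retraction of the mono part followed by a section of the epi part is a quasi-inverse. -/
lemma IsSplitSemisimple.exists_regular (h : IsSplitSemisimple C 𝕜)
    [HasFiniteBiproducts C] {X Y : C} (f : X ⟶ Y) : ∃ g : Y ⟶ X, f ≫ g ≫ f = f := by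
  obtain ⟨S, p, s, i, r, hsp, hir, rfl⟩ := h.exists_factorization f
  exact ⟨r ≫ s, by simp [reassoc_of% hir, reassoc_of% hsp]⟩

/-- In `e = p ≫ i`, cancelling the split epi `p` and the split mono `i` from `e ≫ e = e` leaves `i ≫
p = 𝟙`. -/
lemma IsSplitSemisimple.exists_split_idem (h : IsSplitSemisimple C 𝕜)
    [HasFiniteBiproducts C] {X : C} (e : X ⟶ X) (he : e ≫ e = e) :
    ∃ (Y : C) (i : Y ⟶ X) (p : X ⟶ Y), i ≫ p = 𝟙 Y ∧ p ≫ i = e := by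
  obtain ⟨S, p, s, i, r, hsp, hir, rfl⟩ := h.exists_factorization e
  refine ⟨S, i, p, ?_, rfl⟩
  have h1 : s ≫ ((p ≫ i) ≫ (p ≫ i)) ≫ r = s ≫ (p ≫ i) ≫ r := by rw [he]
  simpa [reassoc_of% hsp, hir, hsp] using h1

end Split

/-! ### A criterion for split semisimplicity -/

section Criterion
variable {D : Type u} [Category.{v} D] [Preadditive D] {𝕜 : Type w} [Field 𝕜] [IsAlgClosed 𝕜]
  [Linear 𝕜 D]

/-- The splitting of an object along complementary idempotents. -/
def Splitting.sum {X Y₁ Y₂ : D} {i₁ : Y₁ ⟶ X} {p₁ : X ⟶ Y₁} {i₂ : Y₂ ⟶ X} {p₂ : X ⟶ Y₂}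
    (h₁ : i₁ ≫ p₁ = 𝟙 Y₁) (h₂ : i₂ ≫ p₂ = 𝟙 Y₂) (h : p₁ ≫ i₁ + p₂ ≫ i₂ = 𝟙 X)
    {J₁ J₂ : Type*} [Fintype J₁] [Fintype J₂] {f₁ : J₁ → D} {f₂ : J₂ → D}
    (s₁ : Splitting Y₁ f₁) (s₂ : Splitting Y₂ f₂) : Splitting X (Sum.elim f₁ f₂) where
  ι
    | .inl j => s₁.ι j ≫ i₁
    | .inr j => s₂.ι j ≫ i₂
  π
    | .inl j => p₁ ≫ s₁.π j
    | .inr j => p₂ ≫ s₂.π j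
  ι_π_self
    | .inl j => by simp [reassoc_of% h₁]
    | .inr j => by simp [reassoc_of% h₂]
  ι_π_ne {j k} hjk := by
    have h12 : i₁ ≫ p₂ = 0 := by
      have := congrArg (fun g => i₁ ≫ g ≫ p₂) h
      simpa [reassoc_of% h₁, h₂] using this
    have h21 : i₂ ≫ p₁ = 0 := by
      have := congrArg (fun g => i₂ ≫ g ≫ p₁) h
      simpa [reassoc_of% h₂, h₁] using this
    rcases j with j | j <;> rcases k with k | k
    · exact (by simp [reassoc_of% h₁, s₁.ι_π_ne (fun h' => hjk (congrArg _ h'))] :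
        (s₁.ι j ≫ i₁) ≫ p₁ ≫ s₁.π k = 0)
    · exact (by simp [reassoc_of% h12] : (s₁.ι j ≫ i₁) ≫ p₂ ≫ s₂.π k = 0)
    · exact (by simp [reassoc_of% h21] : (s₂.ι j ≫ i₂) ≫ p₁ ≫ s₁.π k = 0)
    · exact (by simp [reassoc_of% h₂, s₂.ι_π_ne (fun h' => hjk (congrArg _ h'))] :
        (s₂.ι j ≫ i₂) ≫ p₂ ≫ s₂.π k = 0)
  total := by
    have e1 : ∑ j, (p₁ ≫ s₁.π j) ≫ s₁.ι j ≫ i₁ = p₁ ≫ (∑ j, s₁.π j ≫ s₁.ι j) ≫ i₁ := by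
      simp [Preadditive.comp_sum, Preadditive.sum_comp]
    have e2 : ∑ j, (p₂ ≫ s₂.π j) ≫ s₂.ι j ≫ i₂ = p₂ ≫ (∑ j, s₂.π j ≫ s₂.ι j) ≫ i₂ := by
      simp [Preadditive.comp_sum, Preadditive.sum_comp]
    rw [Fintype.sum_sum_type]
    change ∑ j, (p₁ ≫ s₁.π j) ≫ s₁.ι j ≫ i₁ + ∑ j, (p₂ ≫ s₂.π j) ≫ s₂.ι j ≫ i₂ = _
    rw [e1, e2, s₁.total, s₂.total, Category.id_comp, Category.id_comp, h]

/-- The splitting of an object into itself. -/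
def Splitting.single (X : D) : Splitting X (fun _ : Unit => X) where
  ι _ := 𝟙 X
  π _ := 𝟙 X
  ι_π_self _ := by simp
  ι_π_ne h := (h rfl).elim
  total := by simp

/-- An object whose only idempotent endomorphisms are trivial is simple. -/
lemma isSimpleObj_of_idem {X : D} [Module.Finite 𝕜 (X ⟶ X)]
    (reg : ∀ f : X ⟶ X, ∃ g : X ⟶ X, f ≫ g ≫ f = f) (h0 : 𝟙 X ≠ 0)
    (idem : ∀ e : X ⟶ X, e ≫ e = e → e = 0 ∨ e = 𝟙 X) : IsSimpleObj 𝕜 X := by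
  refine isSimpleObj_of_exists_smul h0 fun f => ?_
  have : Nontrivial (X ⟶ X) := ⟨⟨_, _, h0⟩⟩
  -- Algebraic closedness enters here: the operator `x ↦ f ≫ x` on the finite-dimensional space `X ⟶
  -- X` has an eigenvalue.
  obtain ⟨c, hc⟩ := Module.End.exists_eigenvalue (Linear.leftComp 𝕜 X f)
  obtain ⟨x, hx, hx0⟩ := hc.exists_hasEigenvector
  rw [Module.End.mem_eigenspace_iff] at hx
  refine ⟨c, ?_⟩
  by_contra hne
  obtain ⟨g, hg⟩ := reg (f - c • 𝟙 X)
  have hx' : (f - c • 𝟙 X) ≫ x = 0 := by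
    rw [Preadditive.sub_comp, Linear.smul_comp, Category.id_comp, sub_eq_zero]; exact hx
  -- If this idempotent is zero then `f = c • 𝟙`; if it is the identity then `f - c • 𝟙` cannot
  -- annihilate the eigenvector.
  rcases idem (g ≫ (f - c • 𝟙 X)) (by rw [Category.assoc, hg]) with h | h
  · rw [h, comp_zero] at hg
    exact hne (sub_eq_zero.1 hg.symm)
  · apply hx0
    rw [← Category.id_comp x, ← h, Category.assoc, hx', comp_zero]

/-- A linear category with finite-dimensional Hom-spaces over an algebraically closed field, in
which morphisms are von Neumann regular and idempotents split, is split semisimple. -/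
theorem isSplitSemisimple_of_regular (fin : ∀ X : D, Module.Finite 𝕜 (X ⟶ X))
    (reg : ∀ {X Y : D} (f : X ⟶ Y), ∃ g : Y ⟶ X, f ≫ g ≫ f = f)
    (idem : ∀ {X : D} (e : X ⟶ X), e ≫ e = e →
      ∃ (Y : D) (i : Y ⟶ X) (p : X ⟶ Y), i ≫ p = 𝟙 Y ∧ p ≫ i = e) : IsSplitSemisimple D 𝕜 := by
  have main : ∀ (n : ℕ) (X : D), Module.finrank 𝕜 (X ⟶ X) = n →
      ∃ (J : Type) (_ : Fintype J) (f : J → D), (∀ j, IsSimpleObj 𝕜 (f j)) ∧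
        Nonempty (Splitting X f) := by
    intro n
    induction n using Nat.strong_induction_on with
    | _ n ih =>
    intro X hn
    by_cases h0 : 𝟙 X = 0
    · exact ⟨PEmpty, inferInstance, fun a => a.elim, fun a => a.elim,
        ⟨{ ι := fun a => a.elim, π := fun a => a.elim, ι_π_self := fun a => a.elim,
           ι_π_ne := fun {a} => a.elim, total := by simp [h0] }⟩⟩
    by_cases hid : ∀ e : X ⟶ X, e ≫ e = e → e = 0 ∨ e = 𝟙 X
    · have := fin X
      exact ⟨Unit, inferInstance, fun _ => X, fun _ => isSimpleObj_of_idem (fun f => reg f) h0 hid,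
        ⟨Splitting.single X⟩⟩
    push Not at hid
    obtain ⟨e, he, he0, he1⟩ := hid
    -- Endomorphisms of `Y` form a corner of those of `X`. The corner is proper: `p ≫ i` acts on it
    -- as the identity, so if it contained `𝟙 X` then `p ≫ i` would equal `𝟙 X`.
    have small : ∀ {Y : D} (i : Y ⟶ X) (p : X ⟶ Y), i ≫ p = 𝟙 Y → p ≫ i ≠ 𝟙 X →
        Module.finrank 𝕜 (Y ⟶ Y) < n := by
      intro Y i p hip hpi
      have := fin X
      let L : (Y ⟶ Y) →ₗ[𝕜] (X ⟶ X) := (Linear.leftComp 𝕜 X p).comp (Linear.rightComp 𝕜 Y i)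
      have hL : ∀ g, L g = p ≫ g ≫ i := fun g => rfl
      have hinj : Function.Injective L := by
        intro a b hab
        rw [hL, hL] at hab
        have := congrArg (fun g => i ≫ g ≫ p) hab
        simpa [reassoc_of% hip, hip] using this
      rw [← hn, ← LinearMap.finrank_range_of_inj hinj]
      apply Submodule.finrank_lt
      intro htop
      have hmem : 𝟙 X ∈ LinearMap.range L := htop ▸ Submodule.mem_top
      obtain ⟨g, hg⟩ := hmem
      apply hpi
      calc p ≫ i = (p ≫ i) ≫ L g := by rw [hg, Category.comp_id]
        _ = L g := by rw [hL]; simp [reassoc_of% hip]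
        _ = 𝟙 X := hg
    obtain ⟨Y₁, i₁, p₁, h₁, e₁⟩ := idem e he
    obtain ⟨Y₂, i₂, p₂, h₂, e₂⟩ := idem (𝟙 X - e) (by
      simp [Preadditive.comp_sub, Preadditive.sub_comp, he])
    obtain ⟨J₁, _, f₁, hf₁, ⟨s₁⟩⟩ := ih _ (small i₁ p₁ h₁ (by rw [e₁]; exact he1)) Y₁ rfl
    obtain ⟨J₂, _, f₂, hf₂, ⟨s₂⟩⟩ := ih _ (small i₂ p₂ h₂ (by
      rw [e₂]
      intro h
      exact he0 (by simpa using h))) Y₂ rfl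
    refine ⟨J₁ ⊕ J₂, inferInstance, Sum.elim f₁ f₂, ?_, ⟨Splitting.sum h₁ h₂ (by
      rw [e₁, e₂]; simp) s₁ s₂⟩⟩
    rintro (j | j)
    · exact hf₁ j
    · exact hf₂ j
  refine ⟨fun X => ?_, fun X Y hX hY hXY f => ?_⟩
  · obtain ⟨J, _, f, hf, ⟨s⟩⟩ := main _ X rfl
    exact ⟨Fintype.card J, fun j => f ((Fintype.equivFin J).symm j), fun j => hf _,
      (s.reindex (Fintype.equivFin J).symm).isDirectSum⟩
  · by_contra hf
    -- Both `f ≫ g` and `g ≫ f` are scalars, equal by associativity and nonzero by regularity, so a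
    -- multiple of `g` inverts `f`.
    obtain ⟨g, hg⟩ := reg f
    obtain ⟨a, ha⟩ := hX.exists_smul (f ≫ g)
    obtain ⟨b, hb⟩ := hY.exists_smul (g ≫ f)
    have ha0 : a ≠ 0 := by
      rintro rfl
      apply hf
      rw [← hg, ← Category.assoc, ha, zero_smul, zero_comp]
    have hab : a = b := by
      have h1 : a • f = b • f := by
        have h2 : (f ≫ g) ≫ f = f ≫ (g ≫ f) := Category.assoc _ _ _
        rw [ha, hb] at h2
        simpa using h2
      rw [← sub_eq_zero, ← sub_smul] at h1
      exact sub_eq_zero.1 ((smul_eq_zero.1 h1).resolve_right hf)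
    refine hXY.false ⟨f, a⁻¹ • g, ?_, ?_⟩
    · rw [Linear.comp_smul, ha, smul_smul, inv_mul_cancel₀ ha0, one_smul]
    · rw [Linear.smul_comp, hb, ← hab, smul_smul, inv_mul_cancel₀ ha0, one_smul]

end Criterion

/-! ### Retracts and direct sums within one degree -/

section Graded
variable {C : Type u} [Category.{v} C] [MonoidalCategory C] [Preadditive C]
  {G : Type w'} [Group G] {grading : G → ObjectProperty C} [IsGGraded grading]

/-- A retract of an object of `C_α` is isomorphic to an object of `C_α`. -/
lemma exists_iso_of_retract {α : G} {X : C} (hX : grading α X) {Y : C} (i : Y ⟶ X) (p : X ⟶ Y)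
    (h : i ≫ p = 𝟙 Y) : ∃ Z, grading α Z ∧ Nonempty (Y ≅ Z) := by
  obtain ⟨s, T, hT, hY⟩ := IsGGraded.splits (grading := grading) Y
  obtain ⟨d⟩ := hY.nonempty_splitting
  -- A component of degree other than `α` maps to `X` by zero, and `i` is a split mono.
  have hz (β : s) (hβ : (β : G) ≠ α) : d.π β ≫ d.ι β = 0 := by
    have h0 : d.ι β ≫ i = 0 := IsGGraded.hom_eq_zero (hT β β.2) hX hβ _
    have : d.ι β = 0 := by rw [← Category.comp_id (d.ι β), ← h, ← Category.assoc, h0, zero_comp]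
    rw [this, comp_zero]
  by_cases hα : α ∈ s
  · refine ⟨T α, hT α hα, ⟨⟨d.π ⟨α, hα⟩, d.ι ⟨α, hα⟩, ?_, d.ι_π_self ⟨α, hα⟩⟩⟩⟩
    rw [← d.total, Finset.sum_eq_single (⟨α, hα⟩ : s)]
    · intro β _ hβ
      exact hz β fun h => hβ (Subtype.ext h)
    · simp
  -- Here `Y` is a zero object. Since `C_α` is not assumed closed under isomorphism, a zero object
  -- inside it is taken from the empty direct sum.
  · have hY0 : 𝟙 Y = 0 := by
      rw [← d.total]
      exact Finset.sum_eq_zero fun β _ => hz β fun h => hα (h ▸ β.2)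
    obtain ⟨Z, hZ, hZ'⟩ := IsGGraded.additive (grading := grading) α 0 (fun j => j.elim0)
      (fun j => j.elim0)
    obtain ⟨e⟩ := hZ'.nonempty_splitting
    have hZ0 : 𝟙 Z = 0 := by rw [← e.total]; simp
    exact ⟨Z, hZ, ⟨⟨0, 0, by rw [hY0, zero_comp], by rw [hZ0, zero_comp]⟩⟩⟩

/-- A direct sum of objects of `C_α` may be chosen in `C_α`. -/
lemma exists_splitting_mem {α : G} {J : Type*} [Fintype J] (f : J → C)
    (hf : ∀ j, grading α (f j)) : ∃ X, grading α X ∧ Nonempty (Splitting X f) := by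
  obtain ⟨X, hX, hX'⟩ := IsGGraded.additive (grading := grading) α (Fintype.card J)
    (fun j => f ((Fintype.equivFin J).symm j)) (fun j => hf _)
  obtain ⟨s⟩ := hX'.nonempty_splitting
  refine ⟨X, hX, ⟨?_⟩⟩
  have := s.reindex (Fintype.equivFin J)
  simpa using this

end Graded

end TV

namespace TV

/-! ### Retracts, direct sums and the grading of the relative center -/

section
variable {C : Type u} [Category.{v} C] [Preadditive C]

/-- Orthogonality kills the cross terms; this is how block-diagonal half braidings are composed
block by block. -/
lemma sum_comp_sum_of_orthogonal {J : Type*} [Fintype J] {X Z : C} {Y : J → C}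
    {W : C} (a : ∀ j, X ⟶ Y j) (p : ∀ j, Y j ⟶ W) (q : ∀ j, W ⟶ Y j) (b : ∀ j, Y j ⟶ Z)
    (hs : ∀ j, p j ≫ q j = 𝟙 _) (hn : ∀ j k, j ≠ k → p j ≫ q k = 0) :
    (∑ j, a j ≫ p j) ≫ (∑ k, q k ≫ b k) = ∑ j, a j ≫ b j := by
  rw [Preadditive.sum_comp]
  refine Finset.sum_congr rfl fun j _ => ?_
  rw [Preadditive.comp_sum, Finset.sum_eq_single j]
  · simp [reassoc_of% hs j]
  · intro k _ hk
    simp [reassoc_of% hn j k hk.symm]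
  · simp

end

namespace RelCenter
variable {C : Type u} [Category.{v} C] [MonoidalCategory C]
variable {P : ObjectProperty C} [P.IsMonoidal]

section Retract
variable (A : RelCenter P) {Y : C} (i : Y ⟶ A.pt) (p : A.pt ⟶ Y) (h : i ≫ p = 𝟙 Y)
  (hc : ∀ (U : C) (hU : P U), (p ≫ i) ▷ U ≫ A.σ U hU = A.σ U hU ≫ U ◁ (p ≫ i))

/-- The image of an idempotent of the relative center that splits in `C`. -/
def retract : RelCenter P where
  pt := Y
  half :=
    { β := fun U hU =>
        { hom := i ▷ U ≫ A.σ U hU ≫ U ◁ p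
          inv := U ◁ i ≫ (A.half.β U hU).inv ≫ p ▷ U
          hom_inv_id := by
            calc
              _ = i ▷ U ≫ (A.σ U hU ≫ U ◁ (p ≫ i)) ≫ (A.half.β U hU).inv ≫ p ▷ U := by simp
              _ = ((i ≫ p) ≫ (i ≫ p)) ▷ U := by rw [← hc]; simp
              _ = _ := by rw [h]; simp
          inv_hom_id := by
            calc
              _ = U ◁ i ≫ (A.half.β U hU).inv ≫ ((p ≫ i) ▷ U ≫ A.σ U hU) ≫ U ◁ p := by simp
              _ = U ◁ ((i ≫ p) ≫ (i ≫ p)) := by rw [hc]; simp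
              _ = _ := by rw [h]; simp }
      naturality := fun {U V} hU hV f => by
        calc
          _ = i ▷ U ≫ (A.pt ◁ f ≫ (A.half.β V hV).hom) ≫ V ◁ p := by
            simp [whisker_exchange_assoc]
          _ = _ := by rw [A.half.naturality hU hV]; simp [whisker_exchange]
      monoidal := fun U V hU hV => by
        symm
        calc
          _ = 𝟙 _ ⊗≫ (i ▷ U ≫ (A.σ U hU ≫ U ◁ (p ≫ i))) ▷ V ⊗≫
                U ◁ (A.σ V hV ≫ V ◁ p) ⊗≫ 𝟙 _ := by dsimp only; monoidal
          _ = 𝟙 _ ⊗≫ (i ≫ p ≫ i) ▷ U ▷ V ⊗≫ A.σ U hU ▷ V ⊗≫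
                U ◁ (A.σ V hV ≫ V ◁ p) ⊗≫ 𝟙 _ := by rw [← hc]; monoidal
          _ = _ := by
            have hm : A.σ (U ⊗ V) (P.prop_tensor hU hV) = _ := A.half.monoidal U V hU hV
            dsimp only
            rw [reassoc_of% h, hm]; monoidal }

/-- The inclusion of the image of an idempotent. -/
def retractι : retract A i p h hc ⟶ A where
  f := i
  comm U hU := by
    change i ▷ U ≫ A.σ U hU = (i ▷ U ≫ A.σ U hU ≫ U ◁ p) ≫ U ◁ i
    calc
      _ = (i ≫ p ≫ i) ▷ U ≫ A.σ U hU := by rw [reassoc_of% h]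
      _ = i ▷ U ≫ (p ≫ i) ▷ U ≫ A.σ U hU := by simp
      _ = _ := by rw [hc]; simp

/-- The projection to the image of an idempotent. -/
def retractπ : A ⟶ retract A i p h hc where
  f := p
  comm U hU := by
    change p ▷ U ≫ i ▷ U ≫ A.σ U hU ≫ U ◁ p = A.σ U hU ≫ U ◁ p
    calc
      _ = ((p ≫ i) ▷ U ≫ A.σ U hU) ≫ U ◁ p := by simp
      _ = A.σ U hU ≫ U ◁ (p ≫ i ≫ p) := by rw [hc]; simp
      _ = _ := by rw [h, Category.comp_id]

@[simp] lemma retract_pt : (retract A i p h hc).pt = Y := rfl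
@[simp] lemma retractι_f : Hom.f (retractι A i p h hc) = i := rfl
@[simp] lemma retractπ_f : Hom.f (retractπ A i p h hc) = p := rfl

end Retract

section Sum
variable [Preadditive C] [MonoidalPreadditive C]

@[simp] lemma sum_f {A B : RelCenter P} {J : Type*} (s : Finset J) (f : J → (A ⟶ B)) :
    Hom.f (∑ j ∈ s, f j : A ⟶ B) = ∑ j ∈ s, Hom.f (f j) :=
  map_sum ({ toFun := fun g => Hom.f g, map_zero' := rfl, map_add' := fun _ _ => rfl } :
    (A ⟶ B) →+ (A.pt ⟶ B.pt)) f s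

variable {J : Type*} [Fintype J] {X : C} {A : J → RelCenter P}
  (s : Splitting X fun j => (A j).pt)

/-- The direct sum in the relative center, with a given underlying direct sum. -/
def sum : RelCenter P where
  pt := X
  half :=
    { β := fun U hU =>
        { hom := ∑ j, s.π j ▷ U ≫ (A j).σ U hU ≫ U ◁ s.ι j
          inv := ∑ j, U ◁ s.π j ≫ ((A j).half.β U hU).inv ≫ s.ι j ▷ U
          hom_inv_id := by
            simp only [← Category.assoc (_ ▷ _) ((A _).σ U hU)]
            rw [sum_comp_sum_of_orthogonal]
            · have : 𝟙 (X ⊗ U) = (∑ j, s.π j ≫ s.ι j) ▷ U := by rw [s.total]; simp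
              rw [this, sum_whiskerRight]
              exact Finset.sum_congr rfl fun j _ => by simp
            · intro j; rw [← MonoidalCategory.whiskerLeft_comp]; simp
            · intro j k hjk; rw [← MonoidalCategory.whiskerLeft_comp, s.ι_π_ne hjk]; simp
          inv_hom_id := by
            simp only [← Category.assoc (_ ◁ _) ((A _).half.β U hU).inv]
            rw [sum_comp_sum_of_orthogonal]
            · have : 𝟙 (U ⊗ X) = U ◁ (∑ j, s.π j ≫ s.ι j) := by rw [s.total]; simp
              rw [this, whiskerLeft_sum]
              exact Finset.sum_congr rfl fun j _ => by simp
            · intro j; rw [← comp_whiskerRight]; simp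
            · intro j k hjk; rw [← comp_whiskerRight, s.ι_π_ne hjk]; simp }
      naturality := fun {U V} hU hV f => by
        dsimp only
        rw [Preadditive.comp_sum, Preadditive.sum_comp]
        refine Finset.sum_congr rfl fun j _ => ?_
        calc
          _ = s.π j ▷ U ≫ ((A j).pt ◁ f ≫ ((A j).half.β V hV).hom) ≫ V ◁ s.ι j := by
            simp [whisker_exchange_assoc]
          _ = _ := by rw [(A j).half.naturality hU hV]; simp [whisker_exchange]
      monoidal := fun U V hU hV => by
        dsimp only
        have e1 : (∑ j, s.π j ▷ U ≫ (A j).σ U hU ≫ U ◁ s.ι j) ▷ V ≫ (α_ _ _ _).hom =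
            ∑ j, ((s.π j ▷ U ≫ (A j).σ U hU) ▷ V ≫ (α_ _ _ _).hom) ≫ U ◁ s.ι j ▷ V := by
          rw [sum_whiskerRight, Preadditive.sum_comp]
          exact Finset.sum_congr rfl fun j _ => by simp
        have e2 : U ◁ (∑ j, s.π j ▷ V ≫ (A j).σ V hV ≫ V ◁ s.ι j) ≫ (α_ _ _ _).inv =
            ∑ j, U ◁ s.π j ▷ V ≫ U ◁ ((A j).σ V hV ≫ V ◁ s.ι j) ≫ (α_ _ _ _).inv := by
          rw [whiskerLeft_sum, Preadditive.sum_comp]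
          exact Finset.sum_congr rfl fun j _ => by simp
        rw [e2, ← Category.assoc (_ ▷ V), e1, sum_comp_sum_of_orthogonal, Preadditive.comp_sum]
        · refine Finset.sum_congr rfl fun j _ => ?_
          have hm : (A j).σ (U ⊗ V) (P.prop_tensor hU hV) = _ := (A j).half.monoidal U V hU hV
          rw [hm]; monoidal
        · intro j
          rw [← MonoidalCategory.whiskerLeft_comp, ← comp_whiskerRight]; simp
        · intro j k hjk
          rw [← MonoidalCategory.whiskerLeft_comp, ← comp_whiskerRight, s.ι_π_ne hjk]; simp }

lemma sum_ι_comm (j : J) (U : C) (hU : P U) :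
    s.ι j ▷ U ≫ (∑ k, s.π k ▷ U ≫ (A k).σ U hU ≫ U ◁ s.ι k) = (A j).σ U hU ≫ U ◁ s.ι j := by
  rw [Preadditive.comp_sum, Finset.sum_eq_single j]
  · rw [← comp_whiskerRight_assoc]; simp
  · intro k _ hk
    rw [← comp_whiskerRight_assoc, s.ι_π_ne hk.symm]; simp
  · simp

lemma sum_π_comm (j : J) (U : C) (hU : P U) :
    s.π j ▷ U ≫ (A j).σ U hU = (∑ k, s.π k ▷ U ≫ (A k).σ U hU ≫ U ◁ s.ι k) ≫ U ◁ s.π j := by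
  rw [Preadditive.sum_comp, Finset.sum_eq_single j]
  · simp [← MonoidalCategory.whiskerLeft_comp]
  · intro k _ hk
    simp [← MonoidalCategory.whiskerLeft_comp, s.ι_π_ne hk]
  · simp

/-- The direct sum in the relative center. -/
def sumSplitting : Splitting (sum s) A where
  ι j := { f := s.ι j, comm := sum_ι_comm s j }
  π j := { f := s.π j, comm := sum_π_comm s j }
  ι_π_self j := hom_ext (s.ι_π_self j)
  ι_π_ne h := hom_ext (s.ι_π_ne h)
  total := hom_ext (by rw [sum_f]; exact s.total)

lemma hasFiniteBiproducts [HasFiniteBiproducts C] : HasFiniteBiproducts (RelCenter P) :=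
  ⟨fun _ => ⟨fun F =>
    (sumSplitting (A := F) (Splitting.biproduct fun j => (F j).pt)).hasBiproduct⟩⟩

end Sum

end RelCenter

section Graded
variable {C : Type u} [Category.{v} C] [MonoidalCategory C] [Preadditive C]
  {G : Type w'} [Group G] (grading : G → ObjectProperty C)

lemma IsGGraded.tensor_one [IsGGraded grading] {α : G} {X U : C} (hX : grading α X)
    (hU : grading 1 U) : grading α (X ⊗ U) := mul_one α ▸ IsGGraded.tensor hX hU

lemma IsGGraded.one_tensor [IsGGraded grading] {α : G} {X U : C} (hX : grading α X)
    (hU : grading 1 U) : grading α (U ⊗ X) := one_mul α ▸ IsGGraded.tensor hU hX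

variable [MonoidalPreadditive C]

instance isGGraded_center [IsGGraded grading] : IsGGraded (centerGrading grading) where
  hasFiniteBiproducts := by
    have := IsGGraded.hasFiniteBiproducts (grading := grading)
    exact RelCenter.hasFiniteBiproducts
  additive α n f hf := by
    obtain ⟨X, hX, ⟨s⟩⟩ := exists_splitting_mem (fun j => (f j).pt) hf
    exact ⟨RelCenter.sum s, hX, (RelCenter.sumSplitting s).isDirectSum⟩
  splits A := by
    classical
    obtain ⟨t, Y, hY, hA⟩ := IsGGraded.splits (grading := grading) A.pt
    obtain ⟨s⟩ := hA.nonempty_splitting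
    -- The homogeneous projections of `A.pt` commute with the half braiding: as `U` has degree one,
    -- the blocks of `σ_U` between distinct degrees vanish.
    have hc (β : t) (U : C) (hU : grading 1 U) :
        (s.π β ≫ s.ι β) ▷ U ≫ A.σ U hU = A.σ U hU ≫ U ◁ (s.π β ≫ s.ι β) := by
      have hz (γ δ : t) (h : γ ≠ δ) : s.ι γ ▷ U ≫ A.σ U hU ≫ U ◁ s.π δ = 0 :=
        IsGGraded.hom_eq_zero (grading := grading) (IsGGraded.tensor_one grading (hY γ γ.2) hU)
          (IsGGraded.one_tensor grading (hY δ δ.2) hU) (fun h' => h (Subtype.ext h')) _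
      have h1 : (s.π β ≫ s.ι β) ▷ U ≫ A.σ U hU =
          s.π β ▷ U ≫ s.ι β ▷ U ≫ A.σ U hU ≫ U ◁ (∑ δ, s.π δ ≫ s.ι δ) := by
        rw [s.total]; simp
      have h2 : A.σ U hU ≫ U ◁ (s.π β ≫ s.ι β) =
          (∑ δ, s.π δ ≫ s.ι δ) ▷ U ≫ A.σ U hU ≫ U ◁ (s.π β ≫ s.ι β) := by
        rw [s.total]; simp
      rw [h1, h2, whiskerLeft_sum, sum_whiskerRight, Preadditive.sum_comp]
      simp only [Preadditive.comp_sum, comp_whiskerRight, MonoidalCategory.whiskerLeft_comp,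
        Category.assoc]
      rw [Finset.sum_eq_single β, Finset.sum_eq_single β]
      · intro δ _ hδ
        rw [reassoc_of% hz δ β hδ]; simp
      · simp
      · intro δ _ hδ
        rw [reassoc_of% hz β δ hδ.symm]; simp
      · simp
    let B (β : t) : GCenter grading :=
      RelCenter.retract A (s.ι β) (s.π β) (s.ι_π_self β) (hc β)
    refine ⟨t, fun α => if h : α ∈ t then B ⟨α, h⟩ else A, fun α hα => ?_, ?_⟩
    · dsimp only; rw [dif_pos hα]; exact hY α hα
    · have hB : (fun α : t => if h : (α : G) ∈ t then B ⟨α, h⟩ else A) = B := by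
        funext α; rw [dif_pos α.2]
      rw [hB]
      let S : Splitting A B :=
        { ι := fun β => RelCenter.retractι A _ _ (s.ι_π_self β) (hc β)
          π := fun β => RelCenter.retractπ A _ _ (s.ι_π_self β) (hc β)
          ι_π_self := fun β => RelCenter.hom_ext (s.ι_π_self β)
          ι_π_ne := fun h => RelCenter.hom_ext (s.ι_π_ne h)
          total := RelCenter.hom_ext (by rw [RelCenter.sum_f]; exact s.total) }
      exact S.isDirectSum
  tensor hA hB := IsGGraded.tensor (grading := grading) hA hB
  hom_eq_zero hA hB h f := RelCenter.hom_ext (IsGGraded.hom_eq_zero (grading := grading) hA hB h _)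
  unit := IsGGraded.unit (grading := grading)

instance isPivotalGraded_center [PivotalCategory C] [IsPivotalGraded grading] :
    IsPivotalGraded (centerGrading grading) where
  dual_mem h := IsPivotalGraded.dual_mem (grading := grading) h

end Graded

end TV

namespace TV

/-! ### Rotation of morphisms by duality -/

section Rotation
variable {C : Type u} [Category.{v} C] [MonoidalCategory C] [DualityData C]

/-- The rotation `Y^* ⊗ U ⟶ X^*` of a morphism `U ⊗ X ⟶ Y`. -/
def rotOut {U X Y : C} (p : U ⊗ X ⟶ Y) : dual Y ⊗ U ⟶ dual X :=
  𝟙 _ ⊗≫ (dual Y ⊗ U) ◁ coev X ⊗≫ dual Y ◁ p ▷ dual X ⊗≫ ev Y ▷ dual X ⊗≫ 𝟙 _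

/-- The rotation `X^* ⟶ Y^* ⊗ U` of a morphism `Y ⟶ U ⊗ X`. -/
def rotIn {U X Y : C} (i : Y ⟶ U ⊗ X) : dual X ⟶ dual Y ⊗ U :=
  𝟙 _ ⊗≫ coevR Y ▷ dual X ⊗≫ dual Y ◁ i ▷ dual X ⊗≫ (dual Y ⊗ U) ◁ evR X ⊗≫ 𝟙 _

/-- The inverse of `rotIn`. -/
def unrotIn {U X Y : C} (g : dual X ⟶ dual Y ⊗ U) : Y ⟶ U ⊗ X :=
  𝟙 _ ⊗≫ Y ◁ coevR X ⊗≫ Y ◁ g ▷ X ⊗≫ evR Y ▷ (U ⊗ X) ⊗≫ 𝟙 _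

variable {U X Y : C}

/-- With `rotIn_evR`, this slides a rotated morphism along a cup or cap, where it becomes the
original one. -/
lemma coev_rotOut (p : U ⊗ X ⟶ Y) :
    coev Y ▷ U ⊗≫ Y ◁ rotOut p = 𝟙 _ ⊗≫ U ◁ coev X ⊗≫ p ▷ dual X ⊗≫ 𝟙 _ := by
  unfold rotOut
  calc
    _ = 𝟙 _ ⊗≫ (coev Y ▷ (U ⊗ 𝟙_ C) ≫ (Y ⊗ dual Y) ◁ (U ◁ coev X ⊗≫ p ▷ dual X)) ⊗≫
          Y ◁ ev Y ▷ dual X ⊗≫ 𝟙 _ := by monoidal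
    _ = 𝟙 _ ⊗≫ U ◁ coev X ⊗≫ p ▷ dual X ⊗≫ (coev Y ▷ Y ⊗≫ Y ◁ ev Y) ▷ dual X ⊗≫ 𝟙 _ := by
        rw [← whisker_exchange]; monoidal
    _ = _ := by rw [tri1]; monoidal

lemma rotIn_evR (i : Y ⟶ U ⊗ X) :
    Y ◁ rotIn i ⊗≫ evR Y ▷ U = 𝟙 _ ⊗≫ i ▷ dual X ⊗≫ U ◁ evR X ⊗≫ 𝟙 _ := by
  unfold rotIn
  calc
    _ = 𝟙 _ ⊗≫ Y ◁ coevR Y ▷ dual X ⊗≫ ((Y ⊗ dual Y) ◁ (i ▷ dual X ⊗≫ U ◁ evR X) ≫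
          evR Y ▷ (U ⊗ 𝟙_ C)) ⊗≫ 𝟙 _ := by monoidal
    _ = 𝟙 _ ⊗≫ (Y ◁ coevR Y ⊗≫ evR Y ▷ Y) ▷ dual X ⊗≫ i ▷ dual X ⊗≫ U ◁ evR X ⊗≫ 𝟙 _ := by
        rw [whisker_exchange]; monoidal
    _ = _ := by rw [tri4]; monoidal

/-- With `rotOut_ev`, this turns the left trace of `rotIn i ≫ rotOut p` into the left trace of `i ≫
p`. Rotating inwards by the right duality and outwards by the left one is what suits the left trace.
-/
lemma coevR_rotIn (i : Y ⟶ U ⊗ X) :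
    coevR X ≫ rotIn i ▷ X = coevR Y ≫ dual Y ◁ i ≫ (α_ _ _ _).inv := by
  unfold rotIn
  calc
    _ = 𝟙 _ ⊗≫ (𝟙_ C ◁ coevR X ≫ (coevR Y ⊗≫ dual Y ◁ i) ▷ (dual X ⊗ X)) ⊗≫
          (dual Y ⊗ U) ◁ evR X ▷ X ⊗≫ 𝟙 _ := by monoidal
    _ = 𝟙 _ ⊗≫ coevR Y ⊗≫ dual Y ◁ i ⊗≫ (dual Y ⊗ U) ◁ (X ◁ coevR X ⊗≫ evR X ▷ X) ⊗≫ 𝟙 _ := by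
        rw [whisker_exchange]; monoidal
    _ = _ := by rw [tri4]; monoidal

lemma rotOut_ev (p : U ⊗ X ⟶ Y) :
    rotOut p ▷ X ≫ ev X = (α_ _ _ _).hom ≫ dual Y ◁ p ≫ ev Y := by
  unfold rotOut
  calc
    _ = 𝟙 _ ⊗≫ (dual Y ⊗ U) ◁ coev X ▷ X ⊗≫ ((dual Y ◁ p ⊗≫ ev Y) ▷ (dual X ⊗ X) ≫
          𝟙_ C ◁ ev X) ⊗≫ 𝟙 _ := by monoidal
    _ = 𝟙 _ ⊗≫ (dual Y ⊗ U) ◁ (coev X ▷ X ⊗≫ X ◁ ev X) ⊗≫ dual Y ◁ p ⊗≫ ev Y ⊗≫ 𝟙 _ := by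
        rw [← whisker_exchange]; monoidal
    _ = _ := by rw [tri1]; monoidal

/-- Its role is surjectivity of `rotIn`, so that statements about dual objects reduce to the
original simples. -/
lemma rotIn_unrotIn (g : dual X ⟶ dual Y ⊗ U) : rotIn (unrotIn g) = g := by
  -- A morphism is recovered from its bent form, so it is enough to compare bent forms.
  have inj (k : dual X ⟶ dual Y ⊗ U) :
      k = 𝟙 _ ⊗≫ coevR Y ▷ dual X ⊗≫ dual Y ◁ (Y ◁ k ⊗≫ evR Y ▷ U) ⊗≫ 𝟙 _ := by
    symm
    calc
      _ = 𝟙 _ ⊗≫ (coevR Y ▷ dual X ≫ (dual Y ⊗ Y) ◁ k) ⊗≫ dual Y ◁ evR Y ▷ U ⊗≫ 𝟙 _ := by monoidal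
      _ = 𝟙 _ ⊗≫ k ⊗≫ (coevR Y ▷ dual Y ⊗≫ dual Y ◁ evR Y) ▷ U ⊗≫ 𝟙 _ := by
          rw [← whisker_exchange]; monoidal
      _ = _ := by rw [tri3]; monoidal
  have key : Y ◁ rotIn (unrotIn g) ⊗≫ evR Y ▷ U = Y ◁ g ⊗≫ evR Y ▷ U := by
    rw [rotIn_evR]
    unfold unrotIn
    calc
      _ = 𝟙 _ ⊗≫ Y ◁ coevR X ▷ dual X ⊗≫ ((Y ◁ g ⊗≫ evR Y ▷ U) ▷ (X ⊗ dual X) ≫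
            (𝟙_ C ⊗ U) ◁ evR X) ⊗≫ 𝟙 _ := by monoidal
      _ = 𝟙 _ ⊗≫ Y ◁ (coevR X ▷ dual X ⊗≫ dual X ◁ evR X) ⊗≫ (Y ◁ g ⊗≫ evR Y ▷ U) ⊗≫ 𝟙 _ := by
          rw [← whisker_exchange]; monoidal
      _ = _ := by rw [tri3]; monoidal
  rw [inj (rotIn (unrotIn g)), key, ← inj g]

lemma rotIn_leftUnitor (X : C) : rotIn (λ_ X).inv = (ρ_ (dual X)).inv := by
  unfold rotIn
  calc
    _ = 𝟙 _ ⊗≫ (coevR X ▷ dual X ⊗≫ dual X ◁ evR X) ⊗≫ 𝟙 _ := by monoidal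
    _ = _ := by rw [tri3]; monoidal

lemma rotOut_comp_left {V : C} (f : U ⟶ V) (p : V ⊗ X ⟶ Y) :
    rotOut (f ▷ X ≫ p) = dual Y ◁ f ≫ rotOut p := by
  unfold rotOut
  symm
  calc
    _ = 𝟙 _ ⊗≫ dual Y ◁ (f ▷ 𝟙_ C ≫ V ◁ coev X) ⊗≫ dual Y ◁ p ▷ dual X ⊗≫
          ev Y ▷ dual X ⊗≫ 𝟙 _ := by monoidal
    _ = _ := by rw [← whisker_exchange]; monoidal

lemma rotOut_comp_rotOut {V Z : C} (p : U ⊗ X ⟶ Y) (p' : V ⊗ Z ⟶ X) :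
    rotOut p ▷ V ≫ rotOut p' =
      (α_ _ _ _).hom ≫ rotOut ((α_ U V Z).hom ≫ U ◁ p' ≫ p) := by
  calc
    _ = 𝟙 _ ⊗≫ (rotOut p ▷ (V ⊗ 𝟙_ C) ≫ dual X ◁ (V ◁ coev Z ⊗≫ p' ▷ dual Z)) ⊗≫
          ev X ▷ dual Z ⊗≫ 𝟙 _ := by
        conv_lhs => enter [2]; unfold rotOut
        monoidal
    _ = 𝟙 _ ⊗≫ (dual Y ⊗ U) ◁ (V ◁ coev Z ⊗≫ p' ▷ dual Z) ⊗≫ (rotOut p ▷ X ≫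
          ev X) ▷ dual Z ⊗≫ 𝟙 _ := by
        rw [← whisker_exchange]; monoidal
    _ = _ := by
        rw [rotOut_ev]
        unfold rotOut
        monoidal

lemma rotOut_leftUnitor (X : C) : rotOut (λ_ X).hom = (ρ_ (dual X)).hom := by
  unfold rotOut
  calc
    _ = 𝟙 _ ⊗≫ (dual X ◁ coev X ⊗≫ ev X ▷ dual X) ⊗≫ 𝟙 _ := by monoidal
    _ = _ := by rw [tri2]; monoidal

variable [Preadditive C] [MonoidalPreadditive C] {𝕜 : Type w} [Field 𝕜] [Linear 𝕜 C]
  [MonoidalLinear 𝕜 C]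

variable (𝕜) in
/-- `rotIn` as a linear map. -/
def rotInₗ : (Y ⟶ U ⊗ X) →ₗ[𝕜] (dual X ⟶ dual Y ⊗ U) where
  toFun := rotIn
  map_add' f g := by simp [rotIn, monoidalComp]
  map_smul' c f := by simp [rotIn, monoidalComp]

end Rotation

/-! ### Resolutions by simple objects and dinaturality of the canonical element -/

section Resolution
variable {C : Type u} [Category.{v} C] [Preadditive C]

/-- A factorization of the identity of `W` through the objects `S j`. -/
structure Resolution {I : Type w'} [Fintype I] (S : I → C) (W : C) where
  n : ℕ
  ι (j : I) (k : Fin n) : S j ⟶ W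
  π (j : I) (k : Fin n) : W ⟶ S j
  total : ∑ j, ∑ k, π j k ≫ ι j k = 𝟙 W

/-- A finite family of pairwise non-isomorphic simple objects through which the identities of all
objects of `P` factor. -/
structure SimpleSystem (𝕜 : Type w) [Field 𝕜] [Linear 𝕜 C] (P : ObjectProperty C)
    (I : Type w') [Fintype I] where
  S : I → C
  mem (i : I) : P (S i)
  simple (i : I) : IsSimpleObj 𝕜 (S i)
  hom_eq_zero {i j : I} (h : i ≠ j) (f : S i ⟶ S j) : f = 0
  res (W : C) (hW : P W) : Resolution S W

namespace SimpleSystem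
variable {𝕜 : Type w} [Field 𝕜] [Linear 𝕜 C] {P : ObjectProperty C} {I : Type w'} [Fintype I]
  (D : SimpleSystem 𝕜 P I)

lemma sum_comp_π_ι {W : C} (R : Resolution D.S W) {j : I} (h : D.S j ⟶ W) :
    ∑ k, h ≫ R.π j k ≫ R.ι j k = h := by
  conv_rhs => rw [← Category.comp_id h, ← R.total, Preadditive.comp_sum]
  rw [Finset.sum_eq_single j]
  · rw [Preadditive.comp_sum]
  · intro i _ hi
    rw [Preadditive.comp_sum]
    exact Finset.sum_eq_zero fun k _ => by
      rw [← Category.assoc, D.hom_eq_zero hi.symm (h ≫ R.π i k), zero_comp]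
  · simp

lemma sum_π_ι_comp {W : C} (R : Resolution D.S W) {j : I} (h : W ⟶ D.S j) :
    ∑ k, R.π j k ≫ R.ι j k ≫ h = h := by
  conv_rhs => rw [← Category.id_comp h, ← R.total, Preadditive.sum_comp]
  rw [Finset.sum_eq_single j]
  · rw [Preadditive.sum_comp]; simp
  · intro i _ hi
    rw [Preadditive.sum_comp]
    exact Finset.sum_eq_zero fun k _ => by
      rw [Category.assoc, D.hom_eq_zero hi (R.ι i k ≫ h), comp_zero]
  · simp

/-- The canonical element of `⨁ Hom(S j, W) ⊗ Hom(W, S j)` is dinatural in `W`. -/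
lemma dinatural {W W' : C} (R : Resolution D.S W) (R' : Resolution D.S W') (u : W ⟶ W')
    {M : Type*} [AddCommGroup M] [Module 𝕜 M]
    (b : ∀ j, (D.S j ⟶ W') →ₗ[𝕜] (W ⟶ D.S j) →ₗ[𝕜] M) :
    ∑ j, ∑ k, b j (R.ι j k ≫ u) (R.π j k) = ∑ j, ∑ k, b j (R'.ι j k) (u ≫ R'.π j k) := by
  refine Finset.sum_congr rfl fun j _ => ?_
  -- One matrix expresses both `ι ≫ u` through the inclusions of `R'` and `u ≫ π'` through the
  -- projections of `R`. No linear independence is needed.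
  choose c hc using fun k l => (D.simple j).exists_smul (R.ι j k ≫ u ≫ R'.π j l)
  have h1 (k : Fin R.n) : R.ι j k ≫ u = ∑ l, c k l • R'.ι j l := by
    rw [← D.sum_comp_π_ι R' (R.ι j k ≫ u)]
    refine Finset.sum_congr rfl fun l _ => ?_
    rw [← Category.assoc, Category.assoc (R.ι j k), hc]; simp
  have h2 (l : Fin R'.n) : u ≫ R'.π j l = ∑ k, c k l • R.π j k := by
    rw [← D.sum_π_ι_comp R (u ≫ R'.π j l)]
    refine Finset.sum_congr rfl fun k _ => ?_
    rw [hc]; simp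
  simp only [h1, h2, map_sum, map_smul, LinearMap.sum_apply, LinearMap.smul_apply]
  exact Finset.sum_comm

end SimpleSystem

end Resolution

/-! ### Rotated resolutions and left dimensions -/

section Casimir
variable {C : Type u} [Category.{v} C] [MonoidalCategory C] [Preadditive C]
  [MonoidalPreadditive C] {𝕜 : Type w} [Field 𝕜] [Linear 𝕜 C] [MonoidalLinear 𝕜 C]
  {P : ObjectProperty C} {I : Type w'} [Fintype I]

namespace SimpleSystem
variable (D : SimpleSystem 𝕜 P I)

section
variable [DualityData C]

/-- Rotation with `U = 𝟙` identifies such an `f` with a morphism `D.S j ⟶ D.S i`. -/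
lemma dual_hom_eq_zero {i j : I} (h : i ≠ j) (f : dual (D.S i) ⟶ dual (D.S j)) : f = 0 := by
  rw [← cancel_mono (ρ_ _).inv, zero_comp, ← rotIn_unrotIn (f ≫ (ρ_ _).inv)]
  have : unrotIn (f ≫ (ρ_ _).inv) = 0 := by
    rw [← cancel_mono (λ_ _).hom, zero_comp]
    exact D.hom_eq_zero h.symm _
  rw [this]
  exact map_zero (rotInₗ 𝕜)

lemma exists_smul_dual (i : I) (f : dual (D.S i) ⟶ dual (D.S i)) :
    ∃ c : 𝕜, f = c • 𝟙 (dual (D.S i)) := by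
  obtain ⟨c, hc⟩ := (D.simple i).exists_smul (unrotIn (f ≫ (ρ_ _).inv) ≫ (λ_ _).hom)
  refine ⟨c, ?_⟩
  have : unrotIn (f ≫ (ρ_ _).inv) = c • (λ_ _).inv := by
    rw [← cancel_mono (λ_ _).hom, hc]; simp
  rw [← cancel_mono (ρ_ _).inv, ← rotIn_unrotIn (f ≫ (ρ_ _).inv), this]
  refine (map_smul (rotInₗ 𝕜) c _).trans ?_
  change c • rotIn _ = _
  rw [rotIn_leftUnitor]; simp

/-- The mates of a resolution of `dual W` factor the identity of `W` through the duals of the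
simples, so these duals detect morphisms out of `W`. -/
lemma dual_hom_ext {W Z : C} (hW : P (dual W)) {f g : W ⟶ Z}
    (H : ∀ (r : I) (h : dual (D.S r) ⟶ W), h ≫ f = h ≫ g) : f = g := by
  let R := D.res _ hW
  let pW : ExactPairing (dual W) W := DualityData.right W
  let pS (r : I) : ExactPairing (D.S r) (dual (D.S r)) := DualityData.left (D.S r)
  have hlin : mateL pW.coevaluation' pW.evaluation' (𝟙 (dual W)) =
      ∑ r, ∑ k, mateL pW.coevaluation' pW.evaluation' (R.π r k ≫ R.ι r k) := by
    rw [← R.total]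
    simp [mateL, sum_whiskerRight, whiskerLeft_sum, Preadditive.sum_comp, Preadditive.comp_sum]
  have hid : 𝟙 W = ∑ r, ∑ k, mateL (pS r).coevaluation' pW.evaluation' (R.ι r k) ≫
      mateL pW.coevaluation' (pS r).evaluation' (R.π r k) := by
    rw [← mateL_id pW, hlin]
    exact Finset.sum_congr rfl fun r _ => Finset.sum_congr rfl fun k _ =>
      (mateL_comp pW (pS r) pW _ _).symm
  rw [← Category.id_comp f, ← Category.id_comp g, hid]
  simp only [Preadditive.sum_comp, Category.assoc]
  exact Finset.sum_congr rfl fun r _ => Finset.sum_congr rfl fun k _ => by rw [H]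

end

section
variable [PivotalCategory C]

/-- Both sides evaluate one closed diagram, read as a left trace over `D.S r` or over `D.S j`. This
is why the average must be weighted by left dimensions. -/
lemma rot_scalar {d : I → 𝕜} (hd : ∀ i, dimL (D.S i) = d i • 𝟙 (𝟙_ C)) (h1 : 𝟙 (𝟙_ C) ≠ 0)
    {U : C} {j r : I} (h : D.S j ⟶ U ⊗ D.S r) (p : U ⊗ D.S r ⟶ D.S j) {a c : 𝕜}
    (ha : h ≫ p = a • 𝟙 _) (hc : rotIn h ≫ rotOut p = c • 𝟙 _) : d r * c = d j * a := by
  have e1 : coevR (D.S r) ≫ (rotIn h ≫ rotOut p) ▷ D.S r ≫ ev (D.S r) =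
      coevR (D.S j) ≫ dual (D.S j) ◁ (h ≫ p) ≫ ev (D.S j) := by
    rw [comp_whiskerRight, Category.assoc, rotOut_ev, ← Category.assoc, coevR_rotIn]
    simp
  have e2 (i : I) : coevR (D.S i) ≫ ev (D.S i) = d i • 𝟙 (𝟙_ C) := by
    rw [← hd]; simp [dimL, trL]
  rw [ha, hc] at e1
  simp only [MonoidalLinear.smul_whiskerRight, MonoidalLinear.whiskerLeft_smul, id_whiskerRight,
    MonoidalCategory.whiskerLeft_id, Linear.smul_comp, Linear.comp_smul, Category.id_comp, e2,
    smul_smul] at e1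
  rw [← sub_eq_zero, ← sub_smul] at e1
  have := sub_eq_zero.1 ((smul_eq_zero.1 e1).resolve_right h1)
  linear_combination this

variable [P.IsMonoidal] [DualStable P]

/-- The rotations of resolutions of the objects `U ⊗ S i`, weighted with the left dimensions,
resolve the object `(S j)^* ⊗ U`. -/
theorem sum_rotOut_rotIn {d : I → 𝕜} (hd : ∀ i, dimL (D.S i) = d i • 𝟙 (𝟙_ C))
    (h1 : 𝟙 (𝟙_ C) ≠ 0) {U : C} (hU : P U) (R : ∀ i, Resolution D.S (U ⊗ D.S i)) (j : I) :
    ∑ i, ∑ k, d i • (rotOut ((R i).π j k) ≫ rotIn ((R i).ι j k)) =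
      d j • 𝟙 (dual (D.S j) ⊗ U) := by
  refine D.dual_hom_ext (DualStable.prop_dual (P.prop_tensor (DualStable.prop_dual (D.mem j)) hU))
    fun r g => ?_
  obtain ⟨h, rfl⟩ : ∃ h : D.S j ⟶ U ⊗ D.S r, rotIn h = g := ⟨_, rotIn_unrotIn g⟩
  -- Tested against `rotIn h`, only `i = r` contributes: the composite with `rotOut` is a morphism
  -- between duals of simples.
  rw [Preadditive.comp_sum, Finset.sum_eq_single r]
  · choose a ha using fun k => (D.simple j).exists_smul (h ≫ (R r).π j k)
    choose c hc using fun k => D.exists_smul_dual r (rotIn h ≫ rotOut ((R r).π j k))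
    have hh : h = ∑ k, a k • (R r).ι j k := by
      conv_lhs => rw [← D.sum_comp_π_ι (R r) h]
      refine Finset.sum_congr rfl fun k _ => ?_
      rw [← Category.assoc, ha]; simp
    have hr : rotIn h = ∑ k, a k • rotIn ((R r).ι j k) := by
      conv_lhs => rw [hh]
      refine (map_sum (rotInₗ 𝕜) _ _).trans (Finset.sum_congr rfl fun k _ => ?_)
      exact map_smul (rotInₗ 𝕜) _ _
    -- The passage through `hr` and back expands `rotIn h` on the right-hand side only, so that the
    -- terms can be matched by `rot_scalar`.
    rw [Linear.comp_smul, Category.comp_id, hr, ← hr, Preadditive.comp_sum, hr, Finset.smul_sum,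
      ← hr]
    refine Finset.sum_congr rfl fun k _ => ?_
    rw [Linear.comp_smul, ← Category.assoc, hc, smul_smul, ← D.rot_scalar hd h1 h _ (ha k) (hc k),
      Linear.smul_comp, Category.id_comp, smul_smul]
  · intro i _ hi
    rw [Preadditive.comp_sum]
    refine Finset.sum_eq_zero fun k _ => ?_
    rw [Linear.comp_smul, ← Category.assoc,
      D.dual_hom_eq_zero hi.symm (rotIn h ≫ rotOut ((R i).π j k)), zero_comp, smul_zero]
  · simp

end

end SimpleSystem
end Casimir

/-! ### Conjugation by half braidings and partial traces -/

section Averaging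
variable {C : Type u} [Category.{v} C] [MonoidalCategory C] {P : ObjectProperty C} [P.IsMonoidal]

namespace RelCenter

/-- The conjugate of a morphism of `C` by half braidings. -/
def conj (A B : RelCenter P) (f : A.pt ⟶ B.pt) (X : C) (hX : P X) : A.pt ⊗ X ⟶ B.pt ⊗ X :=
  A.σ X hX ≫ X ◁ f ≫ (B.half.β X hX).inv

variable {A B : RelCenter P} (f : A.pt ⟶ B.pt)

lemma conj_naturality {X Y : C} (hX : P X) (hY : P Y) (g : X ⟶ Y) :
    A.pt ◁ g ≫ conj A B f Y hY = conj A B f X hX ≫ B.pt ◁ g := by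
  unfold conj σ
  rw [← Category.assoc, A.half.naturality hX hY, Category.assoc, Category.assoc, Category.assoc,
    ← B.half.inv_nat hX hY, whisker_exchange_assoc]

lemma conj_tensor {U X : C} (hU : P U) (hX : P X) :
    conj A B f (U ⊗ X) (P.prop_tensor hU hX) = (α_ _ _ _).inv ≫ A.σ U hU ▷ X ≫ (α_ _ _ _).hom ≫
      U ◁ conj A B f X hX ≫ (α_ _ _ _).inv ≫ (B.half.β U hU).inv ▷ X ≫ (α_ _ _ _).hom := by
  have hm : A.σ (U ⊗ X) (P.prop_tensor hU hX) = _ := A.half.monoidal U X hU hX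
  unfold conj
  rw [hm, B.half.inv_mul hU hX]
  simp [σ]

lemma hom_conj {A' : RelCenter P} (g : A' ⟶ A) (X : C) (hX : P X) :
    conj A' B (Hom.f g ≫ f) X hX = Hom.f g ▷ X ≫ conj A B f X hX := by
  unfold conj
  rw [MonoidalCategory.whiskerLeft_comp, ← Category.assoc, ← Category.assoc, ← hom_comm]
  simp

lemma conj_hom_comp {B' : RelCenter P} (g : B ⟶ B') (X : C) (hX : P X) :
    conj A B' (f ≫ Hom.f g) X hX = conj A B f X hX ≫ Hom.f g ▷ X := by
  have : (B.half.β X hX).inv ≫ Hom.f g ▷ X = X ◁ Hom.f g ≫ (B'.half.β X hX).inv := by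
    rw [Iso.inv_comp_eq, ← Category.assoc, ← hom_comm]; simp [σ]
  unfold conj
  simp [this]

variable [PivotalCategory C]

/-- The partial trace of the conjugate of a morphism. -/
def avg (A B : RelCenter P) (f : A.pt ⟶ B.pt) (X : C) (hX : P X) : A.pt ⟶ B.pt :=
  𝟙 _ ⊗≫ A.pt ◁ coev X ⊗≫ conj A B f X hX ▷ dual X ⊗≫ B.pt ◁ evR X ⊗≫ 𝟙 _

/-- Morphisms of the center pass through the half braidings and then out of the loop; `avg_hom_comp`
is the other side. -/
lemma hom_avg {A' : RelCenter P} (g : A' ⟶ A) (X : C) (hX : P X) :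
    avg A' B (Hom.f g ≫ f) X hX = Hom.f g ≫ avg A B f X hX := by
  unfold avg
  rw [hom_conj]
  symm
  calc
    _ = 𝟙 _ ⊗≫ (Hom.f g ▷ 𝟙_ C ≫ A.pt ◁ coev X) ⊗≫ conj A B f X hX ▷ dual X ⊗≫
          B.pt ◁ evR X ⊗≫ 𝟙 _ := by monoidal
    _ = _ := by rw [← whisker_exchange]; monoidal

lemma avg_hom_comp {B' : RelCenter P} (g : B ⟶ B') (X : C) (hX : P X) :
    avg A B' (f ≫ Hom.f g) X hX = avg A B f X hX ≫ Hom.f g := by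
  unfold avg
  rw [conj_hom_comp]
  calc
    _ = 𝟙 _ ⊗≫ A.pt ◁ coev X ⊗≫ conj A B f X hX ▷ dual X ⊗≫
          (Hom.f g ▷ (X ⊗ dual X) ≫ B'.pt ◁ evR X) ⊗≫ 𝟙 _ := by monoidal
    _ = _ := by rw [← whisker_exchange]; monoidal

/-- The half braiding cancels its inverse, leaving a free loop whose value is the right dimension.
-/
lemma avg_id (X : C) (hX : P X) :
    avg A A (𝟙 A.pt) X hX = (ρ_ _).inv ≫ A.pt ◁ dimR X ≫ (ρ_ _).hom := by
  have : conj A A (𝟙 A.pt) X hX = 𝟙 _ := by simp [conj, σ]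
  unfold avg
  rw [this]
  simp only [dimR, trR]
  monoidal

/-- A closed half-braided loop slides across `U`. -/
lemma conj_avg {U X : C} (hU : P U) (hX : P X) :
    conj A B (avg A B f X hX) U hU =
      𝟙 _ ⊗≫ A.pt ◁ U ◁ coev X ⊗≫ conj A B f (U ⊗ X) (P.prop_tensor hU hX) ▷ dual X ⊗≫
        B.pt ◁ U ◁ evR X ⊗≫ 𝟙 _ := by
  rw [conj_tensor f hU hX]
  symm
  calc
    _ = 𝟙 _ ⊗≫ ((A.pt ⊗ U) ◁ coev X ≫ A.σ U hU ▷ (X ⊗ dual X)) ⊗≫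
          U ◁ conj A B f X hX ▷ dual X ⊗≫ ((B.half.β U hU).inv ▷ (X ⊗ dual X) ≫
            (B.pt ⊗ U) ◁ evR X) ⊗≫ 𝟙 _ := by monoidal
    _ = _ := by
      rw [whisker_exchange (A.σ U hU) (coev X), ← whisker_exchange (B.half.β U hU).inv (evR X)]
      conv_rhs => unfold conj avg
      monoidal

end RelCenter
end Averaging

/-! ### The handle slide and Maschke averaging -/

section Maschke
variable {C : Type u} [Category.{v} C] [MonoidalCategory C] [Preadditive C]
  [MonoidalPreadditive C] {𝕜 : Type w} [Field 𝕜] [Linear 𝕜 C] [MonoidalLinear 𝕜 C]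
  {P : ObjectProperty C} {I : Type w'} [Fintype I] [PivotalCategory C] [P.IsMonoidal]

namespace RelCenter

section Insert
variable {A B : RelCenter P} (f : A.pt ⟶ B.pt)

variable (𝕜) in
/-- Insertion of an endomorphism next to a closed half-braided loop, as a linear map. -/
def insertLeft (U X : C) (hU : P U) (hX : P X) :
    (U ⊗ X ⟶ U ⊗ X) →ₗ[𝕜] (A.pt ⊗ U ⟶ B.pt ⊗ U) where
  toFun g := 𝟙 _ ⊗≫ A.pt ◁ U ◁ coev X ⊗≫ conj A B f (U ⊗ X) (P.prop_tensor hU hX) ▷ dual X ⊗≫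
    B.pt ◁ g ▷ dual X ⊗≫ B.pt ◁ U ◁ evR X ⊗≫ 𝟙 _
  map_add' g h := by simp [monoidalComp]
  map_smul' c g := by simp [monoidalComp]

variable (𝕜) in
/-- Insertion of an endomorphism next to a closed half-braided loop, as a linear map. -/
def insertRight (U X : C) (hX : P X) :
    (dual X ⊗ U ⟶ dual X ⊗ U) →ₗ[𝕜] (A.pt ⊗ U ⟶ B.pt ⊗ U) where
  toFun g := 𝟙 _ ⊗≫ A.pt ◁ coev X ▷ U ⊗≫ conj A B f X hX ▷ (dual X ⊗ U) ⊗≫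
    (B.pt ⊗ X) ◁ g ⊗≫ B.pt ◁ evR X ▷ U ⊗≫ 𝟙 _
  map_add' g h := by simp [monoidalComp]
  map_smul' c g := by simp [monoidalComp]

lemma insertLeft_id (U X : C) (hU : P U) (hX : P X) :
    insertLeft 𝕜 f U X hU hX (𝟙 _) = conj A B (avg A B f X hX) U hU := by
  rw [conj_avg f hU hX]
  change 𝟙 _ ⊗≫ A.pt ◁ U ◁ coev X ⊗≫ conj A B f (U ⊗ X) (P.prop_tensor hU hX) ▷ dual X ⊗≫
    B.pt ◁ 𝟙 (U ⊗ X) ▷ dual X ⊗≫ B.pt ◁ U ◁ evR X ⊗≫ 𝟙 _ = _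
  monoidal

lemma insertRight_id (U X : C) (hX : P X) :
    insertRight 𝕜 f U X hX (𝟙 _) = avg A B f X hX ▷ U := by
  change 𝟙 _ ⊗≫ A.pt ◁ coev X ▷ U ⊗≫ conj A B f X hX ▷ (dual X ⊗ U) ⊗≫
    (B.pt ⊗ X) ◁ 𝟙 (dual X ⊗ U) ⊗≫ B.pt ◁ evR X ▷ U ⊗≫ 𝟙 _ = _
  unfold avg
  monoidal

/-- Undoing the two rotations along the cup and cap recolours the loop from `Y` to `X`; naturality
of `conj` carries `p` across to meet `i`. -/
lemma insertRight_rot {U X Y : C} (hU : P U) (hX : P X) (hY : P Y) (p : U ⊗ X ⟶ Y)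
    (i : Y ⟶ U ⊗ X) :
    insertRight 𝕜 f U Y hY (rotOut p ≫ rotIn i) = insertLeft 𝕜 f U X hU hX (p ≫ i) := by
  change 𝟙 _ ⊗≫ A.pt ◁ coev Y ▷ U ⊗≫ conj A B f Y hY ▷ (dual Y ⊗ U) ⊗≫
    (B.pt ⊗ Y) ◁ (rotOut p ≫ rotIn i) ⊗≫ B.pt ◁ evR Y ▷ U ⊗≫ 𝟙 _ =
    𝟙 _ ⊗≫ A.pt ◁ U ◁ coev X ⊗≫ conj A B f (U ⊗ X) (P.prop_tensor hU hX) ▷ dual X ⊗≫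
      B.pt ◁ (p ≫ i) ▷ dual X ⊗≫ B.pt ◁ U ◁ evR X ⊗≫ 𝟙 _
  calc
    _ = 𝟙 _ ⊗≫ A.pt ◁ coev Y ▷ U ⊗≫ (conj A B f Y hY ▷ (dual Y ⊗ U) ≫
          (B.pt ⊗ Y) ◁ rotOut p) ⊗≫ B.pt ◁ (Y ◁ rotIn i ⊗≫ evR Y ▷ U) ⊗≫ 𝟙 _ := by monoidal
    _ = 𝟙 _ ⊗≫ A.pt ◁ (coev Y ▷ U ⊗≫ Y ◁ rotOut p) ⊗≫ conj A B f Y hY ▷ dual X ⊗≫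
          B.pt ◁ (Y ◁ rotIn i ⊗≫ evR Y ▷ U) ⊗≫ 𝟙 _ := by
        rw [← whisker_exchange]; monoidal
    _ = 𝟙 _ ⊗≫ A.pt ◁ U ◁ coev X ⊗≫ (A.pt ◁ p ≫ conj A B f Y hY) ▷ dual X ⊗≫
          B.pt ◁ (i ▷ dual X ⊗≫ U ◁ evR X) ⊗≫ 𝟙 _ := by
        rw [coev_rotOut, rotIn_evR]; monoidal
    _ = _ := by
        rw [conj_naturality f (P.prop_tensor hU hX) hY]; monoidal

end Insert

variable [DualStable P] (D : SimpleSystem 𝕜 P I) {d : I → 𝕜}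

/-- The handle slide. Beside the loop `j`, the identity of `j^* ⊗ U` times `d j` is expanded by
`sum_rotOut_rotIn`, and each term becomes an insertion on a loop `i` that encloses `U`. -/
lemma sum_avg_whiskerRight (hd : ∀ i, dimL (D.S i) = d i • 𝟙 (𝟙_ C)) (h1 : 𝟙 (𝟙_ C) ≠ 0)
    {A B : RelCenter P} (f : A.pt ⟶ B.pt) (U : C) (hU : P U) :
    (∑ i, d i • avg A B f (D.S i) (D.mem i)) ▷ U =
      conj A B (∑ i, d i • avg A B f (D.S i) (D.mem i)) U hU := by
  let R (i : I) : Resolution D.S (U ⊗ D.S i) := D.res _ (P.prop_tensor hU (D.mem i))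
  have e1 (j : I) : d j • avg A B f (D.S j) (D.mem j) ▷ U = ∑ i, ∑ k, d i •
      insertLeft 𝕜 f U (D.S i) hU (D.mem i) ((R i).π j k ≫ (R i).ι j k) := by
    rw [← insertRight_id (𝕜 := 𝕜), ← map_smul, ← D.sum_rotOut_rotIn hd h1 hU R j]
    simp only [map_sum, map_smul]
    exact Finset.sum_congr rfl fun i _ => Finset.sum_congr rfl fun k _ => by
      rw [insertRight_rot f hU (D.mem i) (D.mem j)]
  have e2 : conj A B (∑ i, d i • avg A B f (D.S i) (D.mem i)) U hU =
      ∑ i, d i • conj A B (avg A B f (D.S i) (D.mem i)) U hU := by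
    simp [conj, Preadditive.sum_comp, Preadditive.comp_sum, whiskerLeft_sum]
  rw [e2, sum_whiskerRight]
  simp only [MonoidalLinear.smul_whiskerRight, e1, ← insertLeft_id (𝕜 := 𝕜)]
  -- With `i` outermost, the sum over `j` and `k` is the resolved identity of `U ⊗ D.S i`.
  rw [Finset.sum_comm]
  refine Finset.sum_congr rfl fun i _ => ?_
  rw [← (R i).total]
  simp only [map_sum, Finset.smul_sum]

variable (hd : ∀ i, dimL (D.S i) = d i • 𝟙 (𝟙_ C)) (h1 : 𝟙 (𝟙_ C) ≠ 0)

/-- The average of a morphism of `C` is a morphism of the relative center. -/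
def average {A B : RelCenter P} (f : A.pt ⟶ B.pt) : A ⟶ B where
  f := ∑ i, d i • avg A B f (D.S i) (D.mem i)
  comm U hU := by
    rw [sum_avg_whiskerRight D hd h1 f U hU]
    simp [conj, σ]

lemma hom_average {A' A B : RelCenter P} (g : A' ⟶ A) (f : A.pt ⟶ B.pt) :
    average D hd h1 (Hom.f g ≫ f) = g ≫ average D hd h1 f := by
  apply hom_ext
  change ∑ i, d i • avg A' B (Hom.f g ≫ f) _ _ = Hom.f g ≫ ∑ i, d i • avg A B f _ _
  simp [hom_avg, Preadditive.comp_sum]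

lemma average_hom_comp {A B B' : RelCenter P} (f : A.pt ⟶ B.pt) (g : B ⟶ B') :
    average D hd h1 (f ≫ Hom.f g) = average D hd h1 f ≫ g := by
  apply hom_ext
  change ∑ i, d i • avg A B' (f ≫ Hom.f g) _ _ = (∑ i, d i • avg A B f _ _) ≫ Hom.f g
  simp [avg_hom_comp, Preadditive.sum_comp]

/-- The weight `dim_l(i)` multiplies the loop value `dim_r(i)`, which produces the dimension of the
hypothesis. -/
lemma average_id {c : 𝕜} (hc : ∑ i, dimL (D.S i) ≫ dimR (D.S i) = c • 𝟙 (𝟙_ C))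
    (A : RelCenter P) : average D hd h1 (𝟙 A.pt) = c • 𝟙 A := by
  apply hom_ext
  change ∑ i, d i • avg A A (𝟙 A.pt) _ _ = c • 𝟙 A.pt
  simp only [avg_id]
  have : ∑ i, d i • ((ρ_ _).inv ≫ A.pt ◁ dimR (D.S i) ≫ (ρ_ _).hom) =
      (ρ_ _).inv ≫ A.pt ◁ (∑ i, dimL (D.S i) ≫ dimR (D.S i)) ≫ (ρ_ _).hom := by
    simp [hd, Preadditive.sum_comp, Preadditive.comp_sum, whiskerLeft_sum]
  rw [this, hc]
  simp

/-- If the dimension is invertible then the relative center inherits von Neumann regularity. -/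
theorem exists_regular (hd : ∀ i, dimL (D.S i) = d i • 𝟙 (𝟙_ C)) (h1 : 𝟙 (𝟙_ C) ≠ 0) {c : 𝕜}
    (hc : ∑ i, dimL (D.S i) ≫ dimR (D.S i) = c • 𝟙 (𝟙_ C))
    (hc0 : c ≠ 0) (reg : ∀ {X Y : C} (f : X ⟶ Y), ∃ g : Y ⟶ X, f ≫ g ≫ f = f)
    {A B : RelCenter P} (f : A ⟶ B) : ∃ g : B ⟶ A, f ≫ g ≫ f = f := by
  obtain ⟨g, hg⟩ := reg (Hom.f f)
  refine ⟨c⁻¹ • average D hd h1 g, ?_⟩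
  -- The identity is kept so that `f` can be pulled out and `average_id` applied.
  have h2 : Hom.f f ≫ g ≫ Hom.f f = 𝟙 A.pt ≫ Hom.f f := by rw [hg, Category.id_comp]
  rw [Linear.smul_comp, Linear.comp_smul, ← average_hom_comp, ← hom_average, h2, average_hom_comp,
    average_id D hd h1 hc, Linear.smul_comp, Category.id_comp, smul_smul, inv_mul_cancel₀ hc0,
    one_smul]

end RelCenter
end Maschke
end TV

namespace TV

/-! ### Building blocks of the induced half braiding -/

section ToRel
variable {C : Type u} [Category.{v} C] [MonoidalCategory C] [PivotalCategory C]
  {P : ObjectProperty C} [P.IsMonoidal] [DualStable P] {B : C}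

/-- Over a class of objects stable under duality, lax half braidings are half braidings. -/
def LaxHalf.toRel (b : LaxHalf P B) : RelHalfBraiding P B where
  β U hU :=
    { hom := b.s U hU
      inv := b.rot (DualStable.prop_dual hU) (coevR U) (evR U)
      hom_inv_id := b.comp_rot hU _ _ _ (tri4 U)
      inv_hom_id := b.rot_comp hU _ _ _ (tri4 U) }
  naturality := b.nat
  monoidal := b.mul

end ToRel

section Exchange
variable {C : Type u} [Category.{v} C] [MonoidalCategory C] [DualityData C] (X : C)

/-- The morphism `(Y ⊗ X ⊗ Y^*) ⊗ V ⟶ U ⊗ (Z ⊗ X ⊗ Z^*)` given by a morphism `Y ⟶ U ⊗ Z` and the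
rotation of a morphism `V ⊗ Z ⟶ Y`. -/
def exch {U V Y Z : C} (i : Y ⟶ U ⊗ Z) (p : V ⊗ Z ⟶ Y) :
    ((Y ⊗ X) ⊗ dual Y) ⊗ V ⟶ U ⊗ ((Z ⊗ X) ⊗ dual Z) :=
  𝟙 _ ⊗≫ (Y ⊗ X) ◁ rotOut p ⊗≫ i ▷ X ▷ dual Z ⊗≫ 𝟙 _

/-- A morphism on the source strand enters at `p`, and by `exch_whiskerRight` one on the target
strand enters at `i`. Keeping `U` and `V` separate turns naturality of the half braiding into
dinaturality. -/
lemma whiskerLeft_exch {U V V' Y Z : C} (f : V' ⟶ V) (i : Y ⟶ U ⊗ Z) (p : V ⊗ Z ⟶ Y) :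
    ((Y ⊗ X) ⊗ dual Y) ◁ f ≫ exch X i p = exch X i (f ▷ Z ≫ p) := by
  unfold exch
  rw [rotOut_comp_left]
  monoidal

lemma exch_whiskerRight {U U' V Y Z : C} (f : U ⟶ U') (i : Y ⟶ U ⊗ Z) (p : V ⊗ Z ⟶ Y) :
    exch X i p ≫ f ▷ ((Z ⊗ X) ⊗ dual Z) = exch X (i ≫ f ▷ Z) p := by
  unfold exch
  monoidal

lemma exch_comp {U U' V V' Y L Z : C} (i : Y ⟶ U ⊗ L) (p : U' ⊗ L ⟶ Y) (i' : L ⟶ V ⊗ Z)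
    (p' : V' ⊗ Z ⟶ L) :
    exch X i p ▷ V' ≫ (α_ _ _ _).hom ≫ U ◁ exch X i' p' ≫ (α_ _ _ _).inv =
      (α_ _ _ _).hom ≫ exch X (i ≫ U ◁ i' ≫ (α_ _ _ _).inv)
        (((α_ _ _ _).hom ≫ U' ◁ p') ≫ p) := by
  have h : rotOut p ▷ V' ≫ rotOut p' = _ := rotOut_comp_rotOut p p'
  rw [Category.assoc]
  calc
    _ = 𝟙 _ ⊗≫ (Y ⊗ X) ◁ rotOut p ▷ V' ⊗≫ ((i ▷ X) ▷ (dual L ⊗ V') ≫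
          ((U ⊗ L) ⊗ X) ◁ rotOut p') ⊗≫ U ◁ i' ▷ X ▷ dual Z ⊗≫ 𝟙 _ := by
        unfold exch; monoidal
    _ = 𝟙 _ ⊗≫ (Y ⊗ X) ◁ (rotOut p ▷ V' ≫ rotOut p') ⊗≫ i ▷ X ▷ dual Z ⊗≫
          U ◁ i' ▷ X ▷ dual Z ⊗≫ 𝟙 _ := by
        rw [← whisker_exchange]; monoidal
    _ = _ := by
        rw [h]; unfold exch; monoidal

lemma exch_leftUnitor (Y : C) :
    exch X (λ_ Y).inv (λ_ Y).hom = (ρ_ _).hom ≫ (λ_ _).inv := by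
  unfold exch
  rw [rotOut_leftUnitor]
  monoidal

variable [Preadditive C] [MonoidalPreadditive C] (𝕜 : Type w) [Field 𝕜] [Linear 𝕜 C]
  [MonoidalLinear 𝕜 C]

/-- `exch` as a bilinear map. -/
def exchₗ (U V Y Z : C) : (Y ⟶ U ⊗ Z) →ₗ[𝕜] (V ⊗ Z ⟶ Y) →ₗ[𝕜]
    (((Y ⊗ X) ⊗ dual Y) ⊗ V ⟶ U ⊗ ((Z ⊗ X) ⊗ dual Z)) :=
  LinearMap.mk₂ 𝕜 (exch X) (fun _ _ _ => by simp [exch, monoidalComp])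
    (fun _ _ _ => by simp [exch, monoidalComp])
    (fun _ _ _ => by simp [exch, rotOut, monoidalComp])
    (fun _ _ _ => by simp [exch, rotOut, monoidalComp])

@[simp] lemma exchₗ_apply {U V Y Z : C} (i : Y ⟶ U ⊗ Z) (p : V ⊗ Z ⟶ Y) :
    exchₗ X 𝕜 U V Y Z i p = exch X i p := rfl

end Exchange

section Eval
variable {C : Type u} [Category.{v} C] [Preadditive C] {𝕜 : Type w} [Field 𝕜] [Linear 𝕜 C]
  {P : ObjectProperty C} {I : Type w'} [Fintype I] (D : SimpleSystem 𝕜 P I)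

/-- The canonical sum agrees with that of the one-term resolution given by `e`; this evaluates the
half braiding at the unit. -/
lemma SimpleSystem.sum_of_iso {W : C} (R : Resolution D.S W) {i : I} (e : W ≅ D.S i)
    {M : Type*} [AddCommGroup M] [Module 𝕜 M]
    (b : ∀ j, (D.S j ⟶ W) →ₗ[𝕜] (W ⟶ D.S j) →ₗ[𝕜] M) :
    ∑ j, ∑ k, b j (R.ι j k) (R.π j k) = b i e.inv e.hom := by
  rw [Finset.sum_eq_single i]
  · choose c hc using fun k => (D.simple i).exists_smul (e.inv ≫ R.π i k)
    have h1 (k : Fin R.n) : R.π i k = c k • e.hom := by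
      rw [← cancel_epi e.inv, hc]; simp
    have h2 : e.inv = ∑ k, c k • R.ι i k := by
      rw [← D.sum_comp_π_ι R e.inv]
      refine Finset.sum_congr rfl fun k _ => ?_
      rw [← Category.assoc, hc]; simp
    rw [h2]
    simp [h1, map_sum, LinearMap.sum_apply]
  · intro j _ hj
    refine Finset.sum_eq_zero fun k _ => ?_
    have : R.π j k = 0 := by
      rw [← cancel_epi e.inv, D.hom_eq_zero hj.symm (e.inv ≫ R.π j k), comp_zero]
    rw [this, map_zero]
  · simp

end Eval

section Splitting
variable {C : Type u} [Category.{v} C] [MonoidalCategory C] [Preadditive C]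
  [MonoidalPreadditive C]

lemma Splitting.whiskerLeft_hom_ext {J : Type*} [Fintype J] {F : C} {f : J → C}
    (s : Splitting F f) {U Z : C} {g h : Z ⟶ U ⊗ F} (H : ∀ j, g ≫ U ◁ s.π j = h ≫ U ◁ s.π j) :
    g = h := by
  have hid : 𝟙 (U ⊗ F) = ∑ j, U ◁ s.π j ≫ U ◁ s.ι j := by
    rw [← MonoidalCategory.whiskerLeft_id, ← s.total, whiskerLeft_sum]; simp
  rw [← Category.comp_id g, ← Category.comp_id h, hid, Preadditive.comp_sum, Preadditive.comp_sum]
  exact Finset.sum_congr rfl fun j _ => by rw [← Category.assoc, H, Category.assoc]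

end Splitting

/-! ### The induced object of the relative center -/

section Induction
variable {C : Type u} [Category.{v} C] [MonoidalCategory C] [Preadditive C]
  [MonoidalPreadditive C] {𝕜 : Type w} [Field 𝕜] [Linear 𝕜 C] [MonoidalLinear 𝕜 C]
  {P : ObjectProperty C} {I : Type w'} [Fintype I] [PivotalCategory C] [P.IsMonoidal]
  (D : SimpleSystem 𝕜 P I) {X F : C} (s : Splitting F fun i => (D.S i ⊗ X) ⊗ dual (D.S i))

namespace SimpleSystem

/-- The resolution of `U ⊗ S i`. -/
def resTensor (U : C) (hU : P U) (i : I) : Resolution D.S (U ⊗ D.S i) :=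
  D.res _ (P.prop_tensor hU (D.mem i))

/-- A component of the half braiding of the induced object. -/
def indComp (U : C) (hU : P U) (i : I) : F ⊗ U ⟶ U ⊗ ((D.S i ⊗ X) ⊗ dual (D.S i)) :=
  ∑ j, ∑ k, s.π j ▷ U ≫ exch X ((D.resTensor U hU i).ι j k) ((D.resTensor U hU i).π j k)

/-- The half braiding of the induced object. -/
def indHom (U : C) (hU : P U) : F ⊗ U ⟶ U ⊗ F :=
  ∑ i, D.indComp s U hU i ≫ U ◁ s.ι i

lemma indHom_π (U : C) (hU : P U) (i : I) :
    D.indHom s U hU ≫ U ◁ s.π i = D.indComp s U hU i := by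
  unfold indHom
  rw [Preadditive.sum_comp, Finset.sum_eq_single i]
  · simp [← MonoidalCategory.whiskerLeft_comp]
  · intro k _ hk
    simp [← MonoidalCategory.whiskerLeft_comp, s.ι_π_ne hk]
  · simp

lemma indHom_naturality {U V : C} (hU : P U) (hV : P V) (f : U ⟶ V) :
    F ◁ f ≫ D.indHom s V hV = D.indHom s U hU ≫ f ▷ F := by
  refine s.whiskerLeft_hom_ext fun i => ?_
  rw [Category.assoc, indHom_π, Category.assoc, ← whisker_exchange, ← Category.assoc, indHom_π]
  have h := D.dinatural (D.resTensor U hU i) (D.resTensor V hV i) (f ▷ D.S i)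
    (fun j => (exchₗ X 𝕜 V U (D.S j) (D.S i)).compr₂ (Linear.leftComp 𝕜 _ (s.π j ▷ U)))
  simp only [LinearMap.compr₂_apply, exchₗ_apply, Linear.leftComp_apply, ← exch_whiskerRight,
    ← whiskerLeft_exch] at h
  unfold indComp
  simp only [Preadditive.comp_sum, Preadditive.sum_comp, Category.assoc]
  rw [h]
  simp only [whisker_exchange_assoc]

lemma indHom_one : D.indHom s (𝟙_ C) P.prop_unit = (ρ_ F).hom ≫ (λ_ F).inv := by
  refine s.whiskerLeft_hom_ext fun i => ?_
  rw [indHom_π]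
  have h := D.sum_of_iso (D.resTensor (𝟙_ C) P.prop_unit i) (λ_ (D.S i))
    (fun j => (exchₗ X 𝕜 (𝟙_ C) (𝟙_ C) (D.S j) (D.S i)).compr₂
      (Linear.leftComp 𝕜 _ (s.π j ▷ 𝟙_ C)))
  simp only [LinearMap.compr₂_apply, exchₗ_apply, Linear.leftComp_apply, exch_leftUnitor] at h
  unfold indComp
  rw [h]
  simp

/-- Crossing `U` and then `V` sums over resolutions of `V ⊗ S i` and of the `U ⊗ S l`. Dinaturality
trades the latter for the resolution of `(U ⊗ V) ⊗ S i`, after which the former collapses to an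
identity. -/
lemma indHom_tensor (U V : C) (hU : P U) (hV : P V) :
    D.indHom s (U ⊗ V) (P.prop_tensor hU hV) =
      (α_ _ _ _).inv ≫ D.indHom s U hU ▷ V ≫ (α_ _ _ _).hom ≫ U ◁ D.indHom s V hV ≫
        (α_ _ _ _).inv := by
  refine s.whiskerLeft_hom_ext fun i => ?_
  have e1 : ((α_ _ _ _).inv ≫ D.indHom s U hU ▷ V ≫ (α_ _ _ _).hom ≫ U ◁ D.indHom s V hV ≫
        (α_ _ _ _).inv) ≫ (U ⊗ V) ◁ s.π i =
      (α_ _ _ _).inv ≫ D.indHom s U hU ▷ V ≫ (α_ _ _ _).hom ≫ U ◁ D.indComp s V hV i ≫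
        (α_ _ _ _).inv := by
    rw [← indHom_π]; simp
  let R (l : I) := D.resTensor U hU l
  let R' := D.resTensor V hV i
  let R'' := D.resTensor (U ⊗ V) (P.prop_tensor hU hV) i
  have e2 (l : I) (k : Fin R'.n) :
      (α_ _ _ _).inv ≫ D.indHom s U hU ▷ V ≫ (α_ _ _ _).hom ≫
        U ◁ (s.π l ▷ V ≫ exch X (R'.ι l k) (R'.π l k)) ≫ (α_ _ _ _).inv =
      ∑ j, ∑ m, s.π j ▷ (U ⊗ V) ≫ exch X (R''.ι j m)
        (((α_ _ _ _).hom ≫ U ◁ R'.π l k) ≫ (U ◁ R'.ι l k ≫ (α_ _ _ _).inv) ≫ R''.π j m) := by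
    -- The inclusion `R'.ι l k` leaves the `i`-slot of `exch` and reappears in the `p`-slot, where
    -- it can meet `R'.π l k`.
    have h := D.dinatural (R l) R'' (U ◁ R'.ι l k ≫ (α_ _ _ _).inv)
      (fun j => ((exchₗ X 𝕜 (U ⊗ V) (U ⊗ V) (D.S j) (D.S i)).compl₂
        (Linear.leftComp 𝕜 _ ((α_ _ _ _).hom ≫ U ◁ R'.π l k))).compr₂
        (Linear.leftComp 𝕜 _ (s.π j ▷ (U ⊗ V))))
    simp only [LinearMap.compr₂_apply, LinearMap.compl₂_apply, exchₗ_apply,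
      Linear.leftComp_apply] at h
    rw [← h]
    calc
      _ = (α_ _ _ _).inv ≫ (D.indHom s U hU ≫ U ◁ s.π l) ▷ V ≫ (α_ _ _ _).hom ≫
            U ◁ exch X (R'.ι l k) (R'.π l k) ≫ (α_ _ _ _).inv := by simp
      _ = _ := by
        rw [indHom_π]
        unfold indComp
        simp only [sum_whiskerRight, Preadditive.comp_sum, Preadditive.sum_comp]
        refine Finset.sum_congr rfl fun j _ => Finset.sum_congr rfl fun m _ => ?_
        rw [comp_whiskerRight, Category.assoc, exch_comp]
        simp [R]
  rw [e1, indHom_π]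
  conv_rhs => unfold indComp
  simp only [whiskerLeft_sum, Preadditive.comp_sum, Preadditive.sum_comp]
  have e3 : (∑ l, ∑ k, (α_ _ _ _).inv ≫ D.indHom s U hU ▷ V ≫ (α_ _ _ _).hom ≫
        U ◁ (s.π l ▷ V ≫ exch X (R'.ι l k) (R'.π l k)) ≫ (α_ _ _ _).inv) =
      ∑ j, ∑ m, ∑ l, ∑ k, s.π j ▷ (U ⊗ V) ≫ exch X (R''.ι j m)
        (((α_ _ _ _).hom ≫ U ◁ R'.π l k) ≫ (U ◁ R'.ι l k ≫ (α_ _ _ _).inv) ≫ R''.π j m) := by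
    simp only [e2]
    have h3 : ∀ g : I → Fin R'.n → I → Fin R''.n → (F ⊗ U ⊗ V ⟶ (U ⊗ V) ⊗ (D.S i ⊗ X) ⊗
        dual (D.S i)), ∑ l, ∑ k, ∑ j, ∑ m, g l k j m = ∑ j, ∑ m, ∑ l, ∑ k, g l k j m := by
      intro g
      calc
        _ = ∑ l, ∑ j, ∑ k, ∑ m, g l k j m := Finset.sum_congr rfl fun l _ => Finset.sum_comm
        _ = ∑ j, ∑ l, ∑ k, ∑ m, g l k j m := Finset.sum_comm
        _ = ∑ j, ∑ l, ∑ m, ∑ k, g l k j m := Finset.sum_congr rfl fun j _ =>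
          Finset.sum_congr rfl fun l _ => Finset.sum_comm
        _ = _ := Finset.sum_congr rfl fun j _ => Finset.sum_comm
    exact h3 _
  refine Eq.trans ?_ e3.symm
  unfold indComp
  refine Finset.sum_congr rfl fun j _ => Finset.sum_congr rfl fun m _ => ?_
  change s.π j ▷ (U ⊗ V) ≫ exch X (R''.ι j m) (R''.π j m) = _
  -- The inclusions and projections of `R'` are now adjacent and sum to the identity of `V ⊗ S i`.
  have e4 : R''.π j m = ∑ l, ∑ k,
      ((α_ _ _ _).hom ≫ U ◁ R'.π l k) ≫ (U ◁ R'.ι l k ≫ (α_ _ _ _).inv) ≫ R''.π j m := by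
    have : 𝟙 ((U ⊗ V) ⊗ D.S i) =
        (α_ _ _ _).hom ≫ U ◁ (∑ l, ∑ k, R'.π l k ≫ R'.ι l k) ≫ (α_ _ _ _).inv := by
      rw [R'.total]; simp
    conv_lhs => rw [← Category.id_comp (R''.π j m), this]
    simp [whiskerLeft_sum, Preadditive.sum_comp, Preadditive.comp_sum]
  have e5 := congrArg (fun g => s.π j ▷ (U ⊗ V) ≫ exchₗ X 𝕜 _ _ _ _ (R''.ι j m) g) e4
  simp only [map_sum, exchₗ_apply, Preadditive.comp_sum] at e5
  exact e5

variable [DualStable P]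

/-- The object of the relative center induced from `X`, with underlying object
`⨁ i, (S i ⊗ X) ⊗ (S i)^*`. -/
def induced : RelCenter P where
  pt := F
  half := LaxHalf.toRel
    { s := D.indHom s
      nat := D.indHom_naturality s
      mul := D.indHom_tensor s
      one := D.indHom_one s }

end SimpleSystem
end Induction

/-! ### Morphisms into the induced object -/

section Unit
variable {C : Type u} [Category.{v} C] [MonoidalCategory C] {P : ObjectProperty C} [P.IsMonoidal]

namespace RelCenter
variable {A : RelCenter P} {X : C} (f : A.pt ⟶ X)

section
variable [DualityData C]

/-- The morphism `A ⟶ Z ⊗ X ⊗ Z^*` obtained from `f : A ⟶ X` and the half braiding of `A`. -/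
def wrap (Z : C) (hZ : P Z) : A.pt ⟶ (Z ⊗ X) ⊗ dual Z :=
  𝟙 _ ⊗≫ A.pt ◁ coev Z ⊗≫ (A.σ Z hZ ≫ Z ◁ f) ▷ dual Z

/-- Straightening the strand `Z` recovers `Z ◁ f` up to the invertible half braiding, so `wrap`
loses little information. -/
lemma wrap_ev (Z : C) (hZ : P Z) :
    wrap f Z hZ ▷ Z ≫ (α_ _ _ _).hom ≫ (Z ⊗ X) ◁ ev Z ≫ (ρ_ _).hom = A.σ Z hZ ≫ Z ◁ f := by
  unfold wrap
  calc
    _ = 𝟙 _ ⊗≫ A.pt ◁ coev Z ▷ Z ⊗≫ ((A.σ Z hZ ≫ Z ◁ f) ▷ (dual Z ⊗ Z) ≫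
          (Z ⊗ X) ◁ ev Z) ⊗≫ 𝟙 _ := by monoidal
    _ = 𝟙 _ ⊗≫ A.pt ◁ (coev Z ▷ Z ⊗≫ Z ◁ ev Z) ⊗≫ (A.σ Z hZ ≫ Z ◁ f) ⊗≫ 𝟙 _ := by
        rw [← whisker_exchange]; monoidal
    _ = _ := by rw [tri1]; monoidal

/-- Naturality of the half braiding of `A` brings `i` next to `p`. Only `p ≫ i` remains, and it sums
to an identity over a resolution. -/
lemma wrap_exch {U Z Y : C} (hU : P U) (hZ : P Z) (hY : P Y) (i : Y ⟶ U ⊗ Z) (p : U ⊗ Z ⟶ Y) :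
    wrap f Y hY ▷ U ≫ exch X i p =
      𝟙 _ ⊗≫ A.pt ◁ U ◁ coev Z ⊗≫ A.pt ◁ (p ≫ i) ▷ dual Z ⊗≫
        (A.σ (U ⊗ Z) (P.prop_tensor hU hZ) ≫ (U ⊗ Z) ◁ f) ▷ dual Z ⊗≫ 𝟙 _ := by
  unfold wrap exch
  have h : A.pt ◁ i ≫ A.σ (U ⊗ Z) (P.prop_tensor hU hZ) = A.σ Y hY ≫ i ▷ A.pt :=
    A.half.naturality hY (P.prop_tensor hU hZ) i
  calc
    _ = 𝟙 _ ⊗≫ A.pt ◁ coev Y ▷ U ⊗≫ ((A.σ Y hY ≫ Y ◁ f) ▷ (dual Y ⊗ U) ≫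
          (Y ⊗ X) ◁ rotOut p) ⊗≫ i ▷ X ▷ dual Z ⊗≫ 𝟙 _ := by monoidal
    _ = 𝟙 _ ⊗≫ A.pt ◁ (coev Y ▷ U ⊗≫ Y ◁ rotOut p) ⊗≫ (A.σ Y hY ≫
          (Y ◁ f ≫ i ▷ X)) ▷ dual Z ⊗≫ 𝟙 _ := by
        rw [← whisker_exchange]; monoidal
    _ = 𝟙 _ ⊗≫ A.pt ◁ U ◁ coev Z ⊗≫ A.pt ◁ p ▷ dual Z ⊗≫ ((A.σ Y hY ≫ i ▷ A.pt) ≫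
          (U ⊗ Z) ◁ f) ▷ dual Z ⊗≫ 𝟙 _ := by
        rw [coev_rotOut, whisker_exchange]; monoidal
    _ = _ := by rw [← h]; monoidal

lemma σ_wrap {U Z : C} (hU : P U) (hZ : P Z) :
    A.σ U hU ≫ U ◁ wrap f Z hZ =
      𝟙 _ ⊗≫ A.pt ◁ U ◁ coev Z ⊗≫
        (A.σ (U ⊗ Z) (P.prop_tensor hU hZ) ≫ (U ⊗ Z) ◁ f) ▷ dual Z ⊗≫ 𝟙 _ := by
  unfold wrap
  have hm : A.σ (U ⊗ Z) (P.prop_tensor hU hZ) = (α_ _ _ _).inv ≫ A.σ U hU ▷ Z ≫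
      (α_ _ _ _).hom ≫ U ◁ A.σ Z hZ ≫ (α_ _ _ _).inv := A.half.monoidal U Z hU hZ
  rw [hm]
  calc
    _ = 𝟙 _ ⊗≫ (A.σ U hU ▷ 𝟙_ C ≫ (U ⊗ A.pt) ◁ coev Z) ⊗≫
          U ◁ (A.σ Z hZ ≫ Z ◁ f) ▷ dual Z ⊗≫ 𝟙 _ := by monoidal
    _ = _ := by rw [← whisker_exchange]; monoidal

end

section
variable [Preadditive C] [MonoidalPreadditive C] {𝕜 : Type w} [Field 𝕜] [Linear 𝕜 C]
  [MonoidalLinear 𝕜 C] {I : Type w'} [Fintype I] [PivotalCategory C]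
  (D : SimpleSystem 𝕜 P I) {F : C} (s : Splitting F fun i => (D.S i ⊗ X) ⊗ dual (D.S i))

lemma sum_wrap_exch {U Z : C} (hU : P U) (hZ : P Z) (R : Resolution D.S (U ⊗ Z)) :
    ∑ j, ∑ k, wrap f (D.S j) (D.mem j) ▷ U ≫ exch X (R.ι j k) (R.π j k) =
      A.σ U hU ≫ U ◁ wrap f Z hZ := by
  simp only [wrap_exch f hU hZ (D.mem _), σ_wrap f hU hZ]
  have h : A.pt ◁ 𝟙 (U ⊗ Z) ▷ dual Z =
      ∑ j, ∑ k, A.pt ◁ (R.π j k ≫ R.ι j k) ▷ dual Z := by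
    rw [← R.total]
    simp [sum_whiskerRight, whiskerLeft_sum]
  calc
    _ = 𝟙 _ ⊗≫ A.pt ◁ U ◁ coev Z ⊗≫ (∑ j, ∑ k, A.pt ◁ (R.π j k ≫ R.ι j k) ▷ dual Z) ⊗≫
        (A.σ (U ⊗ Z) (P.prop_tensor hU hZ) ≫ (U ⊗ Z) ◁ f) ▷ dual Z ⊗≫ 𝟙 _ := by
      simp [monoidalComp, Preadditive.sum_comp, Preadditive.comp_sum]
    _ = _ := by rw [← h]; monoidal

/-- The underlying morphism of `toInduced`. -/
def wrapSum : A.pt ⟶ F := ∑ i, wrap f (D.S i) (D.mem i) ≫ s.ι i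

lemma wrapSum_π (j : I) : wrapSum f D s ≫ s.π j = wrap f (D.S j) (D.mem j) := by
  unfold wrapSum
  rw [Preadditive.sum_comp, Finset.sum_eq_single j]
  · simp
  · intro i _ hi; simp [s.ι_π_ne hi]
  · simp

lemma wrapSum_comm (U : C) (hU : P U) :
    wrapSum f D s ▷ U ≫ D.indHom s U hU = A.σ U hU ≫ U ◁ wrapSum f D s := by
  refine s.whiskerLeft_hom_ext fun i => ?_
  rw [Category.assoc, D.indHom_π, Category.assoc, ← MonoidalCategory.whiskerLeft_comp, wrapSum_π,
    ← sum_wrap_exch f D hU (D.mem i) (D.resTensor U hU i)]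
  unfold SimpleSystem.indComp
  simp only [Preadditive.comp_sum]
  refine Finset.sum_congr rfl fun j _ => Finset.sum_congr rfl fun k _ => ?_
  rw [← Category.assoc, ← comp_whiskerRight, wrapSum_π]

/-- The morphism to the induced object obtained from a morphism of `C`. -/
def toInduced [DualStable P] : A ⟶ D.induced s where
  f := wrapSum f D s
  comm := wrapSum_comm f D s

end
end RelCenter

end Unit

/-! ### Cancellation of objects of nonzero dimension -/

section Cancel
variable {C : Type u} [Category.{v} C] [MonoidalCategory C] [Preadditive C]
  [MonoidalPreadditive C] {𝕜 : Type w} [Field 𝕜] [Linear 𝕜 C] [MonoidalLinear 𝕜 C]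
  [PivotalCategory C]

/-- Closing the strand `Z` to the left of `f` gives a free loop, that is, `d • f`. -/
lemma eq_zero_of_whiskerLeft {X Y Z : C} {d : 𝕜} (hd : dimL Z = d • 𝟙 (𝟙_ C)) (hd0 : d ≠ 0)
    {f : X ⟶ Y} (hf : Z ◁ f = 0) : f = 0 := by
  have h : (λ_ _).inv ≫ coevR Z ▷ X ≫ (α_ _ _ _).hom ≫ dual Z ◁ Z ◁ f ≫ (α_ _ _ _).inv ≫
      ev Z ▷ Y ≫ (λ_ _).hom = d • f := by
    calc
      _ = 𝟙 _ ⊗≫ dimL Z ▷ X ⊗≫ f := by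
        simp only [dimL, trL]
        calc
          _ = 𝟙 _ ⊗≫ coevR Z ▷ X ⊗≫ ((dual Z ⊗ Z) ◁ f ≫ ev Z ▷ Y) ⊗≫ 𝟙 _ := by monoidal
          _ = _ := by rw [whisker_exchange]; monoidal
      _ = _ := by rw [hd]; simp [monoidalComp]
  rw [hf] at h
  simp only [MonoidalPreadditive.whiskerLeft_zero, zero_comp, comp_zero] at h
  exact (smul_eq_zero.1 h.symm).resolve_left hd0

/-- The same loop to the right of `f`; whiskering by `dual Z` instead of `Z` makes the left
dimension of `Z` appear again. -/
lemma eq_zero_of_whiskerRight_dual {X Y Z : C} {d : 𝕜} (hd : dimL Z = d • 𝟙 (𝟙_ C)) (hd0 : d ≠ 0)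
    {f : X ⟶ Y} (hf : f ▷ dual Z = 0) : f = 0 := by
  have h : (ρ_ _).inv ≫ X ◁ coevR Z ≫ (α_ _ _ _).inv ≫ f ▷ dual Z ▷ Z ≫ (α_ _ _ _).hom ≫
      Y ◁ ev Z ≫ (ρ_ _).hom = d • f := by
    calc
      _ = 𝟙 _ ⊗≫ X ◁ dimL Z ⊗≫ f := by
        simp only [dimL, trL]
        calc
          _ = 𝟙 _ ⊗≫ X ◁ coevR Z ⊗≫ (f ▷ (dual Z ⊗ Z) ≫ Y ◁ ev Z) ⊗≫ 𝟙 _ := by monoidal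
          _ = _ := by rw [← whisker_exchange]; monoidal
      _ = _ := by rw [hd]; simp [monoidalComp]
  rw [hf] at h
  simp only [MonoidalPreadditive.zero_whiskerRight, zero_comp, comp_zero] at h
  exact (smul_eq_zero.1 h.symm).resolve_left hd0

end Cancel

namespace RelCenter
variable {C : Type u} [Category.{v} C] [MonoidalCategory C] [Preadditive C]
  [MonoidalPreadditive C] {𝕜 : Type w} [Field 𝕜] [Linear 𝕜 C] [MonoidalLinear 𝕜 C]
  {P : ObjectProperty C} {I : Type w'} [Fintype I] [PivotalCategory C] [P.IsMonoidal]
  [DualStable P] (D : SimpleSystem 𝕜 P I) {X F : C}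
  (s : Splitting F fun i => (D.S i ⊗ X) ⊗ dual (D.S i)) {i : I} {d : 𝕜}

/-- The `i`-component, straightened by `wrap_ev`, is an isomorphism followed by `D.S i ◁ f`, and
`D.S i` can be cancelled. -/
lemma toInduced_ne_zero (hd : dimL (D.S i) = d • 𝟙 (𝟙_ C)) (hd0 : d ≠ 0) {A : RelCenter P}
    {f : A.pt ⟶ X} (hf : f ≠ 0) : toInduced f D s ≠ 0 := by
  intro h
  have h1 : wrap f (D.S i) (D.mem i) = 0 := by
    have h0 : wrapSum f D s = 0 := congrArg Hom.f h
    rw [← wrapSum_π f D s, h0, zero_comp]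
  have h2 := wrap_ev f (D.S i) (D.mem i)
  rw [h1] at h2
  simp only [MonoidalPreadditive.zero_whiskerRight, zero_comp] at h2
  refine hf (eq_zero_of_whiskerLeft hd hd0 ?_)
  rw [← cancel_epi (A.half.β (D.S i) (D.mem i)).hom, comp_zero]
  exact h2.symm

lemma id_induced_ne_zero (hd : dimL (D.S i) = d • 𝟙 (𝟙_ C)) (hd0 : d ≠ 0) (hX : 𝟙 X ≠ 0) :
    𝟙 (D.induced s) ≠ 0 := by
  intro h
  have h0 : 𝟙 F = 0 := congrArg Hom.f h
  have h1 : 𝟙 ((D.S i ⊗ X) ⊗ dual (D.S i)) = 0 := by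
    rw [← s.ι_π_self i, ← Category.id_comp (s.π i), h0, zero_comp, comp_zero]
  refine hX (eq_zero_of_whiskerLeft hd hd0 (eq_zero_of_whiskerRight_dual hd hd0 ?_))
  simpa using h1

end RelCenter
end TV

namespace TV

/-! ### Representatives of the simple objects of one degree -/

section System
variable {C : Type u} [Category.{v} C] [Preadditive C] {𝕜 : Type w} [Field 𝕜] [Linear 𝕜 C]

lemma simpleRep_mem {P : ObjectProperty C} (c : simpleClasses 𝕜 P) : P (simpleRep 𝕜 P c) :=
  c.2.choose_spec.1

lemma isSimpleObj_simpleRep {P : ObjectProperty C} (c : simpleClasses 𝕜 P) :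
    IsSimpleObj 𝕜 (simpleRep 𝕜 P c) := c.2.choose_spec.2.1

lemma mk_simpleRep {P : ObjectProperty C} (c : simpleClasses 𝕜 P) :
    Quotient.mk (isIsomorphicSetoid C) (simpleRep 𝕜 P c) = c := c.2.choose_spec.2.2

variable [MonoidalCategory C] {G : Type w'} [Group G] {grading : G → ObjectProperty C}

/-- A simple retract of an object of `C_α` is isomorphic to one of the representatives. -/
lemma exists_iso_simpleRep [IsGGraded grading] {α : G} {X : C} (hX : grading α X) {S : C}
    (hS : IsSimpleObj 𝕜 S) (i : S ⟶ X) (p : X ⟶ S) (h : i ≫ p = 𝟙 S) :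
    ∃ c : simpleClasses 𝕜 (grading α), Nonempty (S ≅ simpleRep 𝕜 (grading α) c) := by
  obtain ⟨Y, hY, ⟨e⟩⟩ := exists_iso_of_retract hX i p h
  let c : simpleClasses 𝕜 (grading α) := ⟨Quotient.mk _ Y, Y, hY, hS.of_iso e, rfl⟩
  have h2 : Quotient.mk (isIsomorphicSetoid C) (simpleRep 𝕜 (grading α) c) = Quotient.mk _ Y :=
    mk_simpleRep c
  obtain ⟨e'⟩ : Nonempty (simpleRep 𝕜 (grading α) c ≅ Y) := Quotient.exact h2
  exact ⟨c, ⟨e ≪≫ e'.symm⟩⟩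

open Classical in
/-- The representatives of the simple objects of `C_α`. -/
def simpleSystem [IsGGraded grading] (h : IsSplitSemisimple C 𝕜) (α : G)
    [Fintype (simpleClasses 𝕜 (grading α))] :
    SimpleSystem 𝕜 (grading α) (simpleClasses 𝕜 (grading α)) where
  S := simpleRep 𝕜 (grading α)
  mem := simpleRep_mem
  simple := isSimpleObj_simpleRep
  hom_eq_zero {c c'} hcc f := by
    refine h.hom_eq_zero _ _ (isSimpleObj_simpleRep c) (isSimpleObj_simpleRep c') ⟨fun e => ?_⟩ f
    apply hcc
    apply Subtype.ext
    rw [← mk_simpleRep c, ← mk_simpleRep c']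
    exact Quotient.sound ⟨e⟩
  res W hW := Nonempty.some <| by
    obtain ⟨n, f, hf, ⟨s⟩⟩ := h.exists_splitting W
    choose c hc using fun k => exists_iso_simpleRep hW (hf k) (s.ι k) (s.π k) (s.ι_π_self k)
    have e (j : simpleClasses 𝕜 (grading α)) (k : Fin n) (hk : c k = j) :
        f k ≅ simpleRep 𝕜 (grading α) j := (hc k).some ≪≫ eqToIso (by rw [hk])
    -- All classes share the index set `Fin n`: the `k`-th summand counts only for its own class,
    -- and the other entries are padded by zero.
    refine ⟨{
      n := n
      ι := fun j k => if hk : c k = j then (e j k hk).inv ≫ s.ι k else 0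
      π := fun j k => if hk : c k = j then s.π k ≫ (e j k hk).hom else 0
      total := ?_ }⟩
    rw [Finset.sum_comm, ← s.total]
    refine Finset.sum_congr rfl fun k _ => ?_
    rw [Finset.sum_eq_single (c k)]
    · simp
    · intro j _ hj
      rw [dif_neg hj.symm, zero_comp]
    · simp

end System

/-! ### Semisimplicity and simple objects of the G-center -/

section Fusion
variable {𝕜 : Type w} [Field 𝕜] {C : Type u} [Category.{v} C] [MonoidalCategory C]

namespace RelCenter
variable {P : ObjectProperty C} [P.IsMonoidal]

lemma exists_split_idem (idem : ∀ {X : C} (e : X ⟶ X), e ≫ e = e →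
      ∃ (Y : C) (i : Y ⟶ X) (p : X ⟶ Y), i ≫ p = 𝟙 Y ∧ p ≫ i = e) {A : RelCenter P} (e : A ⟶ A)
    (he : e ≫ e = e) :
    ∃ (B : RelCenter P) (i : B ⟶ A) (p : A ⟶ B), i ≫ p = 𝟙 B ∧ p ≫ i = e := by
  obtain ⟨Y, i, p, hip, hpi⟩ := idem (Hom.f e) (congrArg Hom.f he)
  have hc (U : C) (hU : P U) : (p ≫ i) ▷ U ≫ A.σ U hU = A.σ U hU ≫ U ◁ (p ≫ i) := by
    rw [hpi]; exact hom_comm e U hU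
  exact ⟨retract A i p hip hc, retractι A i p hip hc, retractπ A i p hip hc, hom_ext hip,
    hom_ext hpi⟩

variable [Preadditive C] [MonoidalPreadditive C] [Linear 𝕜 C] [MonoidalLinear 𝕜 C]

lemma finite_hom (A B : RelCenter P) [Module.Finite 𝕜 (A.pt ⟶ B.pt)] : Module.Finite 𝕜 (A ⟶ B) :=
  Module.Finite.of_injective
    ({ toFun := fun f => Hom.f f, map_add' := fun _ _ => rfl, map_smul' := fun _ _ => rfl } :
      (A ⟶ B) →ₗ[𝕜] (A.pt ⟶ B.pt)) fun _ _ h => hom_ext h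

lemma isSimpleObj_unit (h : IsSimpleObj 𝕜 (𝟙_ C)) : IsSimpleObj 𝕜 (𝟙_ (RelCenter P)) := by
  refine isSimpleObj_of_exists_smul (fun h0 => h.id_ne_zero (congrArg Hom.f h0)) fun f => ?_
  obtain ⟨c, hc⟩ := h.exists_smul (Hom.f f)
  exact ⟨c, hom_ext hc⟩

end RelCenter

variable [Preadditive C] [Linear 𝕜 C] [PivotalCategory C] {G : Type w'} [Group G]
  {grading : G → ObjectProperty C} [IsPivotalGraded grading]

lemma exists_induced_splitting {I : Type*} [Fintype I] (D : SimpleSystem 𝕜 (grading 1) I) {α : G}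
    {X : C} (hX : grading α X) :
    ∃ F, grading α F ∧ Nonempty (Splitting F fun i => (D.S i ⊗ X) ⊗ dual (D.S i)) := by
  refine exists_splitting_mem _ fun i => ?_
  exact IsGGraded.tensor_one grading (IsGGraded.one_tensor grading hX (D.mem i))
    (DualStable.prop_dual (D.mem i))

variable [MonoidalPreadditive C] [MonoidalLinear 𝕜 C]

/-- Some simple object of the neutral component has nonzero left dimension. -/
lemma exists_dimL_ne_zero (hC : IsGFusion 𝕜 grading) (hdim : dimension 𝕜 (grading 1) ≠ 0) :
    ∃ (c : simpleClasses 𝕜 (grading 1)) (d : 𝕜),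
      dimL (simpleRep 𝕜 (grading 1) c) = d • 𝟙 (𝟙_ C) ∧ d ≠ 0 := by
  by_contra! H
  refine hdim (finsum_eq_zero_of_forall_eq_zero fun c => ?_)
  obtain ⟨d, hd⟩ := hC.unit_simple.exists_smul (dimL (simpleRep 𝕜 (grading 1) c))
  rw [hd, H c d hd, zero_smul, zero_comp]

variable [IsAlgClosed 𝕜]

/-- The center of a fusion category relative to a neutral component of nonzero dimension is split
semisimple. -/
theorem isSplitSemisimple_center (hC : IsGFusion 𝕜 grading)
    (hdim : dimension 𝕜 (grading 1) ≠ 0) : IsSplitSemisimple (GCenter grading) 𝕜 := by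
  have := IsGGraded.hasFiniteBiproducts (grading := grading)
  have : Fintype (simpleClasses 𝕜 (grading 1)) := (hC.finite_simple 1).fintype
  have ss := hC.splitSemisimple
  let D : SimpleSystem 𝕜 (grading 1) _ := simpleSystem ss 1
  choose d hd using fun c => hC.unit_simple.exists_smul (dimL (D.S c))
  obtain ⟨c, hc⟩ := hC.unit_simple.exists_smul (dimension 𝕜 (grading 1))
  have hsum : ∑ i, dimL (D.S i) ≫ dimR (D.S i) = c • 𝟙 (𝟙_ C) := by
    rw [← hc, dimension, finsum_eq_sum_of_fintype]; rfl
  have hc0 : c ≠ 0 := by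
    rintro rfl
    exact hdim (by rw [hc, zero_smul])
  refine isSplitSemisimple_of_regular (fun A => ?_) (fun f => ?_) (fun e he => ?_)
  · have := ss.finite_hom A.pt A.pt
    exact RelCenter.finite_hom A A
  · exact RelCenter.exists_regular D hd hC.unit_simple.id_ne_zero hsum hc0
      (fun f => ss.exists_regular f) f
  · exact RelCenter.exists_split_idem (fun e he => ss.exists_split_idem e he) e he

/-- The object induced from a simple of `C_α` is nonzero of degree `α`, hence has a simple retract.
-/
theorem exists_simple_center (hC : IsGFusion 𝕜 grading)
    (hdim : dimension 𝕜 (grading 1) ≠ 0) (α : G) :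
    ∃ A, centerGrading grading α A ∧ IsSimpleObj 𝕜 A := by
  have : Fintype (simpleClasses 𝕜 (grading 1)) := (hC.finite_simple 1).fintype
  let D : SimpleSystem 𝕜 (grading 1) _ := simpleSystem hC.splitSemisimple 1
  obtain ⟨c, d, hd, hd0⟩ := exists_dimL_ne_zero hC hdim
  obtain ⟨X, hX, hXs⟩ := hC.exists_simple α
  obtain ⟨F, hF, ⟨s⟩⟩ := exists_induced_splitting D hX
  obtain ⟨S, a, b, hS, hab⟩ := (isSplitSemisimple_center hC hdim).exists_simple_retract
    (𝟙 (D.induced s)) (RelCenter.id_induced_ne_zero D s (i := c) hd hd0 hXs.id_ne_zero)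
  rw [Category.id_comp] at hab
  have hF' : centerGrading grading α (D.induced s) := hF
  -- The retract may lie in the graded piece only up to isomorphism, so it is replaced by an
  -- isomorphic object.
  obtain ⟨Z, hZ, ⟨e⟩⟩ := exists_iso_of_retract hF' a b hab
  exact ⟨Z, hZ, hS.of_iso e⟩

/-- A simple object of the center maps nontrivially to the object induced from a simple summand of
its underlying object, so it is isomorphic to a summand of that induced object. -/
theorem finite_simple_center (hC : IsGFusion 𝕜 grading)
    (hdim : dimension 𝕜 (grading 1) ≠ 0) (α : G) :
    (simpleClasses 𝕜 (centerGrading grading α)).Finite := by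
  have : Fintype (simpleClasses 𝕜 (grading 1)) := (hC.finite_simple 1).fintype
  have : Finite (simpleClasses 𝕜 (grading α)) := hC.finite_simple α
  let D : SimpleSystem 𝕜 (grading 1) _ := simpleSystem hC.splitSemisimple 1
  obtain ⟨i, d, hd, hd0⟩ := exists_dimL_ne_zero hC hdim
  have ss := isSplitSemisimple_center hC hdim
  choose F hF s using fun c : simpleClasses 𝕜 (grading α) =>
    exists_induced_splitting D (simpleRep_mem c)
  choose n T hT t using fun c => ss.exists_splitting (D.induced (s c).some)
  -- The bound: simple summands of the objects induced from the finitely many simples of `C_α`.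
  refine (Set.finite_range fun p : Σ c, Fin (n c) =>
    Quotient.mk (isIsomorphicSetoid (GCenter grading)) (T p.1 p.2)).subset ?_
  rintro _ ⟨A, hA, hAs, rfl⟩
  have hA0 : 𝟙 A.pt ≠ 0 := fun h => hAs.id_ne_zero (RelCenter.hom_ext h)
  obtain ⟨S, a, b, hS, hab⟩ := hC.splitSemisimple.exists_simple_retract (𝟙 A.pt) hA0
  rw [Category.id_comp] at hab
  obtain ⟨c, ⟨e⟩⟩ := exists_iso_simpleRep (𝕜 := 𝕜) (show grading α A.pt from hA) hS a b hab
  have hf : b ≫ e.hom ≠ 0 := by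
    intro h
    apply hS.id_ne_zero
    rw [← hab, ← Category.comp_id b, ← e.hom_inv_id, reassoc_of% h]
    simp
  have hne := RelCenter.toInduced_ne_zero D (s c).some (i := i) hd hd0 hf
  obtain ⟨k, hk⟩ : ∃ k, RelCenter.toInduced (b ≫ e.hom) D (s c).some ≫ (t c).some.π k ≠ 0 := by
    by_contra! H
    exact hne ((t c).some.hom_ext_left fun k => by rw [H, zero_comp])
  refine ⟨⟨c, k⟩, Quotient.sound ?_⟩
  by_contra he
  exact hk (ss.hom_eq_zero _ _ hAs (hT c k) ⟨fun e => he ⟨e.symm⟩⟩ _)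

end Fusion

end TV

end

theorem lemma4p3 {𝕜 : Type w} [Field 𝕜] [IsAlgClosed 𝕜] {G : Type w'} [Group G]
    {C : Type u} [Category.{v} C] [MonoidalCategory C] [Preadditive C] [MonoidalPreadditive C]
    [Linear 𝕜 C] [MonoidalLinear 𝕜 C] [TV.PivotalCategory C]
    (grading : G → ObjectProperty C) [TV.IsPivotalGraded grading]
    (hC : TV.IsGFusion 𝕜 grading) (hdim : TV.dimension 𝕜 (grading 1) ≠ 0) :
    TV.IsGFusion 𝕜 (TV.centerGrading grading) ∧
      ((∀ (α β : G) (X : C), grading α X → grading β X → α = β) →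
        ∀ (α β : G) (A : TV.GCenter grading),
          TV.centerGrading grading α A → TV.centerGrading grading β A → α = β) :=
  ⟨{ toIsPivotalGraded := TV.isPivotalGraded_center grading
     unit_simple := TV.RelCenter.isSimpleObj_unit hC.unit_simple
     splitSemisimple := TV.isSplitSemisimple_center hC hdim
     exists_simple := TV.exists_simple_center hC hdim
     finite_simple := TV.finite_simple_center hC hdim },
    -- Degree in the center is that of the underlying object, so disjointness is inherited.
    fun h α β A hA hB => h α β A.pt hA hB⟩
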